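/- Consider the $(M,\omega)$-asymmetric RAM: a random access machine with a symmetric fast memory of $M$ words and an unbounded slow memory, where the I/O cost $Q$ is the number of reads from slow memory plus $\omega$ times the number of writes to slow memory, and the work $W$ is $Q$ plus the number of reads from and writes to fast memory. A word holds a non-negative integer of $\Theta(\log n)$ bits (any word length at least $b_0(\log n+1)$, for a constant $b_0$, suffices), or one edge weight; weights are real numbers that can only be copied and compared. Consider the following variant of Borůvka's algorithm on a connected simple graph $G$ with $n$ vertices, $m$ edges and real edge weights, given by adjacency arrays in slow memory. Each vertex has a pointer, and following the chain of pointers leads to the root of its component; initially every vertex is its own component. As long as more than one component is left, the algorithm makes rounds. In a round it finds, for every component, a lightest edge to another component, scanning the adjacency lists of the component's members, which are kept in a linked list (among edges of equal weight it prefers one to the component with the smallest root). Then it adds the selected edges to the output and merges the components joined by them, each old root receiving a pointer to the root of the merged component. (If two components select each other, the smaller one becomes the root of the merged component, and only the other one's selected edge is output.) * Phase one consists of the first $\lceil\log_2\log_2 n\rceil$ rounds (for $n\ge 2$; none for $n=1$), in which pointers are not shortcut. After them every vertex is shortcut to point directly to the root of its component; the components at that time are the phase-one components. * Phase two consists of the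 remaining rounds. After each of them only the roots of the phase-one components are shortcut to point directly to the root of their current component. There are constants $M_0$, $b_0$ and $C$ such that, on every such graph, this algorithm, written as one fixed program for the machine, halts on every machine with $M\ge M_0$ (so that it uses only $O(1)$ fast memory), outputs the $n-1$ edges of a minimum spanning tree of $G$, and for every integer write cost $\omega\ge 1$ satisfies $$Q\le C\,(m\log_2 n+\omega n)\qquad\text{and}\qquad W\le C\,(m\log_2 n+\omega n).$$ -/

import Mathlib

/-! ## The asymmetric random access machine

A random access machine with a symmetric fast memory of `M` words and an unbounded asymmetric slow
memory.  A word holds a natural number below `2 ^ b` (an index, address or counter), or an atomic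
edge weight from a linear order `K`, on which the machine can only do comparisons and copies. -/

namespace ARAM

/-- The content of one memory word. -/
inductive Word (K : Type) where
  | idx (k : ℕ)
  | wt (x : K)

/-- The two memories of the machine. -/
structure Mem (K : Type) where
  fast : ℕ → Word K
  slow : ℕ → Word K

/-- The numbers of memory accesses made by a run. -/
@[ext]
structure Cost where
  slowReads : ℕ
  slowWrites : ℕ
  fastReads : ℕ
  fastWrites : ℕ

namespace Cost

def zero : Cost := ⟨0, 0, 0, 0⟩

def add (c d : Cost) : Cost :=
  ⟨c.slowReads + d.slowReads, c.slowWrites + d.slowWrites,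
    c.fastReads + d.fastReads, c.fastWrites + d.fastWrites⟩

/-- The asymmetric I/O cost `Q` for write cost `ω`: slow reads plus `ω` times slow writes. -/
def ioCost (ω : ℕ) (c : Cost) : ℕ := c.slowReads + ω * c.slowWrites

/-- The asymmetric work `W`: the I/O cost plus all reads from and writes to fast memory. -/
def work (ω : ℕ) (c : Cost) : ℕ := c.ioCost ω + c.fastReads + c.fastWrites

end Cost

/-- Arithmetic instructions on natural numbers; subtraction is truncated. -/
inductive Op where
  | add | sub | mul | div

def Op.eval : Op → ℕ → ℕ → ℕ
  | .add, x, y => x + y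
  | .sub, x, y => x - y
  | .mul, x, y => x * y
  | .div, x, y => x / y

/-- Instructions.  Plain operands are addresses of fast memory words. -/
inductive Instr where
  /-- `fast[d] := k` -/
  | const (d k : ℕ)
  /-- `fast[d] := fast[s]` -/
  | move (d s : ℕ)
  /-- `fast[d] := fast[x] o fast[y]` -/
  | arith (o : Op) (d x y : ℕ)
  /-- `fast[d] := slow[fast[a]]` -/
  | load (d a : ℕ)
  /-- `slow[fast[a]] := fast[s]` -/
  | store (a s : ℕ)
  /-- `fast[d] := fast[fast[a]]` -/
  | loadFast (d a : ℕ)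
  /-- `fast[fast[a]] := fast[s]` -/
  | storeFast (a s : ℕ)

def Mem.setFast {K : Type} (s : Mem K) (a : ℕ) (x : Word K) : Mem K :=
  { s with fast := Function.update s.fast a x }

def Mem.setSlow {K : Type} (s : Mem K) (a : ℕ) (x : Word K) : Mem K :=
  { s with slow := Function.update s.slow a x }

/-- One instruction on a machine with `M` words of fast memory and `b`-bit words.  The result is
`none` (the machine is stuck) if an address of fast memory is not below `M`, a computed number does
not fit in a word, or an operand has the wrong kind. -/
def Instr.step {K : Type} (M b : ℕ) (s : Mem K) : Instr → Option (Mem K × Cost)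
  | .const d k =>
      if d < M ∧ k < 2 ^ b then some (s.setFast d (.idx k), ⟨0, 0, 0, 1⟩) else none
  | .move d x =>
      if d < M ∧ x < M then some (s.setFast d (s.fast x), ⟨0, 0, 1, 1⟩) else none
  | .arith o d x y =>
      if d < M ∧ x < M ∧ y < M then
        match s.fast x, s.fast y with
        | .idx k, .idx l =>
            if o.eval k l < 2 ^ b then some (s.setFast d (.idx (o.eval k l)), ⟨0, 0, 2, 1⟩)
            else none
        | _, _ => none
      else none
  | .load d a =>
      if d < M ∧ a < M then
        match s.fast a with
        | .idx k => some (s.setFast d (s.slow k), ⟨1, 0, 1, 1⟩)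
        | .wt _ => none
      else none
  | .store a x =>
      if a < M ∧ x < M then
        match s.fast a with
        | .idx k => some (s.setSlow k (s.fast x), ⟨0, 1, 2, 0⟩)
        | .wt _ => none
      else none
  | .loadFast d a =>
      if d < M ∧ a < M then
        match s.fast a with
        | .idx k => if k < M then some (s.setFast d (s.fast k), ⟨0, 0, 2, 1⟩) else none
        | .wt _ => none
      else none
  | .storeFast a x =>
      if a < M ∧ x < M then
        match s.fast a with
        | .idx k => if k < M then some (s.setFast k (s.fast x), ⟨0, 0, 2, 1⟩) else none
        | .wt _ => none
      else none

inductive Cmp where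
  | eq | ne | lt | le

def Cmp.eval {α : Type} [LinearOrder α] : Cmp → α → α → Bool
  | .eq, x, y => decide (x = y)
  | .ne, x, y => decide (x ≠ y)
  | .lt, x, y => decide (x < y)
  | .le, x, y => decide (x ≤ y)

/-- A comparison of two fast memory words, which must both be numbers or both be weights. -/
structure Test where
  cmp : Cmp
  x : ℕ
  y : ℕ

def Test.eval {K : Type} [LinearOrder K] (M : ℕ) (s : Mem K) (t : Test) : Option Bool :=
  if t.x < M ∧ t.y < M then
    match s.fast t.x, s.fast t.y with
    | .idx k, .idx l => some (t.cmp.eval k l)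
    | .wt p, .wt q => some (t.cmp.eval p q)
    | _, _ => none
  else none

/-- A test reads two words of fast memory. -/
def Test.cost : Cost := ⟨0, 0, 2, 0⟩

/-- Structured programs. -/
inductive Prog where
  | skip
  | instr (i : Instr)
  | seq (p q : Prog)
  | cond (t : Test) (p q : Prog)
  | loop (t : Test) (p : Prog)

/-- `Exec M b p s c s'`: on a machine with `M` words of fast memory and `b`-bit words, program `p`
started with memory `s` halts with memory `s'`, at cost `c`. -/
inductive Exec {K : Type} [LinearOrder K] (M b : ℕ) : Prog → Mem K → Cost → Mem K → Prop
  | skip (s : Mem K) : Exec M b .skip s .zero s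
  | instr {i : Instr} {s s' : Mem K} {c : Cost} (h : i.step M b s = some (s', c)) :
      Exec M b (.instr i) s c s'
  | seq {p q : Prog} {s s' s'' : Mem K} {c d : Cost} (hp : Exec M b p s c s')
      (hq : Exec M b q s' d s'') : Exec M b (.seq p q) s (c.add d) s''
  | condTrue {t : Test} {p q : Prog} {s s' : Mem K} {c : Cost} (ht : t.eval M s = some true)
      (hp : Exec M b p s c s') : Exec M b (.cond t p q) s (Test.cost.add c) s'
  | condFalse {t : Test} {p q : Prog} {s s' : Mem K} {c : Cost} (ht : t.eval M s = some false)
      (hq : Exec M b q s c s') : Exec M b (.cond t p q) s (Test.cost.add c) s'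
  | loopStop {t : Test} {p : Prog} {s : Mem K} (ht : t.eval M s = some false) :
      Exec M b (.loop t p) s Test.cost s
  | loopStep {t : Test} {p : Prog} {s s' s'' : Mem K} {c d : Cost}
      (ht : t.eval M s = some true) (hp : Exec M b p s c s') (hl : Exec M b (.loop t p) s' d s'') :
      Exec M b (.loop t p) s (Test.cost.add (c.add d)) s''

/-- The machine is deterministic: a program has at most one halting run from a given memory. -/
theorem Exec.deterministic {K : Type} [LinearOrder K] {M b : ℕ} {p : Prog} {s s₁ s₂ : Mem K}
    {c₁ c₂ : Cost} (h₁ : Exec M b p s c₁ s₁) (h₂ : Exec M b p s c₂ s₂) : c₁ = c₂ ∧ s₁ = s₂ := by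
  induction h₁ generalizing c₂ s₂ with
  | skip s => cases h₂; exact ⟨rfl, rfl⟩
  | instr h => cases h₂ with | instr h' => simp_all
  | seq hp hq ihp ihq =>
    cases h₂ with
    | seq hp' hq' =>
      obtain ⟨rfl, rfl⟩ := ihp hp'
      obtain ⟨rfl, rfl⟩ := ihq hq'
      exact ⟨rfl, rfl⟩
  | condTrue ht hp ih =>
    cases h₂ with
    | condTrue ht' hp' => obtain ⟨rfl, rfl⟩ := ih hp'; exact ⟨rfl, rfl⟩
    | condFalse ht' hp' => simp_all
  | condFalse ht hp ih =>
    cases h₂ with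
    | condFalse ht' hp' => obtain ⟨rfl, rfl⟩ := ih hp'; exact ⟨rfl, rfl⟩
    | condTrue ht' hp' => simp_all
  | loopStop ht =>
    cases h₂ with
    | loopStop ht' => exact ⟨rfl, rfl⟩
    | loopStep ht' hp' hl' => simp_all
  | loopStep ht hp hl ihp ihl =>
    cases h₂ with
    | loopStop ht' => simp_all
    | loopStep ht' hp' hl' =>
      obtain ⟨rfl, rfl⟩ := ihp hp'
      obtain ⟨rfl, rfl⟩ := ihl hl'
      exact ⟨rfl, rfl⟩

end ARAM

/-! ## The variant of Borůvka's algorithm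

The program reads a graph on the vertices `0, …, n - 1` stored as adjacency arrays and works with
the following arrays of `n` words in slow memory:

* `par`: a vertex points towards the root of its component, and a root points to itself;
* `nxt`, `tail`: the members of the component with root `c` form a linked list that starts at `c`,
  continues along `nxt` and ends at `tail[c]`;
* `act`: the roots of the current components (the first `k` entries);
* `hk`, `bu`, `bv`: for a root, the component it is to be merged with, and the two endpoints of the
  selected lightest edge leaving it;
* `p1`: the roots of the phase-one components (the first `k1` entries). -/

namespace Boruvka

open ARAM

/-! Addresses of the fast memory words (registers) used. -/

def rZero : ℕ := 0
def rOne : ℕ := 1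
/-- scratch register for addresses -/
def rT : ℕ := 2
/-- number of vertices -/
def rN : ℕ := 3
/-- number of adjacency slots, twice the number of edges -/
def rS : ℕ := 4
/-! base addresses of the arrays in slow memory -/
def aOff : ℕ := 5
def aNbr : ℕ := 6
def aWt : ℕ := 7
def aPar : ℕ := 8
def aNxt : ℕ := 9
def aTail : ℕ := 10
def aHk : ℕ := 11
def aBu : ℕ := 12
def aBv : ℕ := 13
def aAct : ℕ := 14
def aP1 : ℕ := 15
/-- address of the next output word -/
def rOut : ℕ := 16
/-- number of current components -/
def rK : ℕ := 17
/-- number of phase-one components -/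
def rK1 : ℕ := 18
/-- number of remaining rounds of phase one -/
def rR : ℕ := 19
def rI : ℕ := 20
def rKK : ℕ := 21
def rC : ℕ := 22
def rE : ℕ := 23
def rV : ℕ := 24
def rJ : ℕ := 25
def rJE : ℕ := 26
def rU : ℕ := 27
def rX : ℕ := 28
def rP : ℕ := 29
def rW : ℕ := 30
/-! the best edge found so far: weight, target component, endpoints -/
def rBW : ℕ := 31
def rBT : ℕ := 32
def rBU : ℕ := 33
def rBV : ℕ := 34

/-! Abbreviations for program fragments. -/

def block : List Prog → Prog
  | [] => .skip
  | p :: ps => .seq p (block ps)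

def const (d k : ℕ) : Prog := .instr (.const d k)
def move (d x : ℕ) : Prog := .instr (.move d x)
def add (d x y : ℕ) : Prog := .instr (.arith .add d x y)
def sub (d x y : ℕ) : Prog := .instr (.arith .sub d x y)
def load (d a : ℕ) : Prog := .instr (.load d a)
def store (a x : ℕ) : Prog := .instr (.store a x)
def incr (d : ℕ) : Prog := add d d rOne
/-- `d := base[i]` -/
def get (d base i : ℕ) : Prog := .seq (add rT base i) (load d rT)
/-- `base[i] := x` -/
def put (base i x : ℕ) : Prog := .seq (add rT base i) (store rT x)
/-- for `rI = 0, …, bound - 1` do `p` -/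
def forI (bound : ℕ) (p : Prog) : Prog :=
  .seq (const rI 0) (.loop ⟨.lt, rI, bound⟩ (.seq p (incr rI)))

/-- `rX := ` the root of the component of the vertex `rX`, by following the chain of pointers. -/
def findX : Prog := .seq (get rP aPar rX)
  (.loop ⟨.ne, rP, rX⟩ (.seq (move rX rP) (get rP aPar rX)))

/-- Read the input size, place the arrays, and make every vertex a component of its own.
Input: slow word `0` holds `n`; then come the `n + 1` offsets, the neighbours, and the weights.
The output starts just after the input and takes `2 (n - 1)` words. -/
def setup : Prog := block [
  const rZero 0, const rOne 1,
  load rN rZero,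
  const aOff 1,
  get rS aOff rN,
  add aNbr rN rOne, incr aNbr,
  add aWt aNbr rS,
  add rOut aWt rS,
  add aPar rOut rN, add aPar aPar rN,
  add aNxt aPar rN, add aTail aNxt rN, add aHk aTail rN, add aBu aHk rN, add aBv aBu rN,
  add aAct aBv rN, add aP1 aAct rN,
  move rK rN,
  forI rN (block [put aPar rI rI, put aTail rI rI, put aAct rI rI])]

/-- `y := ⌈log₂ x⌉` (and `0` for `x ≤ 1`), by repeated doubling of `p`. -/
def ceilLog (y p x : ℕ) : Prog := block [
  const y 0, const p 1,
  .loop ⟨.lt, p, x⟩ (block [add p p p, incr y])]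

/-- `rR := ⌈log₂ ⌈log₂ n⌉⌉`, the number of rounds of phase one. -/
def computeRounds : Prog := block [ceilLog rX rP rN, ceilLog rR rP rX]

/-- Record the edge in adjacency slot `rJ` as the best one so far. -/
def update : Prog := block [move rBW rW, move rBT rX, move rBU rV, move rBV rU]

/-- Look at all edges at vertex `rV` that leave the component `rC`, and keep the lightest one.
Among edges of equal weight, one with the smaller target component is preferred. -/
def scanVertex : Prog := block [
  get rJ aOff rV,
  add rT rV rOne, get rJE aOff rT,
  .loop ⟨.lt, rJ, rJE⟩ (block [
    get rU aNbr rJ, move rX rU, findX,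
    .cond ⟨.ne, rX, rC⟩
      (.seq (get rW aWt rJ)
        (.cond ⟨.eq, rBT, rC⟩ update
          (.cond ⟨.lt, rW, rBW⟩ update
            (.cond ⟨.eq, rW, rBW⟩ (.cond ⟨.lt, rX, rBT⟩ update .skip) .skip))))
      .skip,
    incr rJ])]

/-- For every component find the lightest edge that connects it to another component. -/
def select : Prog := forI rK (block [
  get rC aAct rI, move rBT rC, get rE aTail rC,
  move rV rC, scanVertex,
  .loop ⟨.ne, rV, rE⟩ (block [get rV aNxt rV, scanVertex]),
  put aHk rC rBT, put aBu rC rBU, put aBv rC rBV])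

/-- Output the selected edge of the component `rC`. -/
def emit : Prog := block [
  get rU aBu rC, store rOut rU, incr rOut,
  get rU aBv rC, store rOut rU, incr rOut]

/-- Where two components selected each other, the smaller one becomes a root of the merged
component; the selected edges of all other components join the spanning tree. -/
def hook : Prog := forI rK (block [
  get rC aAct rI, get rX aHk rC, get rP aHk rX,
  .cond ⟨.eq, rP, rC⟩ (.cond ⟨.lt, rC, rX⟩ (put aHk rC rC) emit) emit])

/-- Let every component point directly to the root of its tree of selected components. -/
def resolve : Prog := forI rK (block [
  get rC aAct rI,
  move rX rC, get rP aHk rX,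
  .loop ⟨.ne, rP, rX⟩ (block [move rX rP, get rP aHk rX]),
  get rP aHk rC,
  .loop ⟨.ne, rP, rX⟩ (block [put aHk rC rX, move rC rP, get rP aHk rC])])

/-- Merge the components: each old root gets a pointer to the root of the merged component, the
lists of members are concatenated, and the list of current components is compacted. -/
def merge : Prog := block [
  const rKK 0,
  forI rK (block [
    get rC aAct rI, get rX aHk rC,
    .cond ⟨.eq, rX, rC⟩ (.seq (put aAct rKK rC) (incr rKK))
      (block [put aPar rC rX, get rE aTail rX, put aNxt rE rC, get rE aTail rC, put aTail rX rE])]),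
  move rK rKK]

/-- One round, without any shortcutting. -/
def round : Prog := block [select, hook, resolve, merge]

/-- Shortcut all vertices to point directly to their component. -/
def shortcutAll : Prog := forI rN (block [move rX rI, findX, put aPar rI rX])

/-- Shortcut only the phase-one components. -/
def shortcutPhaseOne : Prog := forI rK1 (block [get rC aP1 rI, move rX rC, findX, put aPar rC rX])

/-- Remember the list of phase-one components. -/
def savePhaseOne : Prog := .seq (move rK1 rK) (forI rK1 (block [get rC aAct rI, put aP1 rI rC]))

/-- Phase one makes at most `⌈log₂ log₂ n⌉` rounds without shortcuts; then all vertices are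
shortcut; in phase two every round is followed by a shortcut of the phase-one components. -/
def boruvka : Prog := block [
  setup,
  computeRounds,
  .loop ⟨.lt, rZero, rR⟩ (block [.cond ⟨.lt, rOne, rK⟩ round .skip, sub rR rR rOne]),
  shortcutAll,
  savePhaseOne,
  .loop ⟨.lt, rOne, rK⟩ (.seq round shortcutPhaseOne)]

end Boruvka

/-! ## Weighted graphs in memory, and minimum spanning trees -/

namespace ARAM

/-- The slow memory starts with the adjacency arrays of the graph `G` with edge weights `w`:
the number `n` of vertices, `n + 1` offsets, the neighbours of vertex `0`, of vertex `1`, …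
(those of `v` in the slots from `off v` to `off (v + 1) - 1`, in any order), and the weights of the
corresponding edges.  The rest of the memory is arbitrary. -/
def HoldsGraph {K : Type} {n : ℕ} (slow : ℕ → Word K) (G : SimpleGraph (Fin n))
    (w : Sym2 (Fin n) → K) : Prop :=
  slow 0 = .idx n ∧
  ∃ (off : ℕ → ℕ) (nbr : ℕ → Fin n),
    off 0 = 0 ∧
    (∀ v < n, off v ≤ off (v + 1)) ∧
    (∀ v ≤ n, slow (1 + v) = .idx (off v)) ∧
    (∀ v : Fin n, Set.BijOn nbr (Set.Ico (off v) (off (v + 1))) (G.neighborSet v)) ∧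
    (∀ v : Fin n, ∀ j ∈ Set.Ico (off v) (off (v + 1)),
      slow (n + 2 + j) = .idx (nbr j) ∧ slow (n + 2 + off n + j) = .wt (w s(v, nbr j)))

/-- The `2 (n - 1)` words of slow memory from address `a` on are the endpoints of `n - 1` edges,
and these are exactly the edges of `T`. -/
def HoldsTree {K : Type} {n : ℕ} (slow : ℕ → Word K) (a : ℕ) (T : SimpleGraph (Fin n)) : Prop :=
  ∃ u v : ℕ → Fin n,
    (∀ i < n - 1, slow (a + 2 * i) = .idx (u i) ∧ slow (a + 2 * i + 1) = .idx (v i)) ∧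
    T.edgeSet = {e | ∃ i < n - 1, e = s(u i, v i)}

end ARAM

/-- `T` is a minimum spanning tree of `G` with edge weights `w`. -/
def IsMinSpanningTree {V : Type} [Fintype V] (G : SimpleGraph V) (w : Sym2 V → ℝ)
    (T : SimpleGraph V) : Prop :=
  (T ≤ G ∧ T.IsTree) ∧
  ∀ T' : SimpleGraph V, T' ≤ G → T'.IsTree → ∑ᶠ e ∈ T.edgeSet, w e ≤ ∑ᶠ e ∈ T'.edgeSet, w e

/-! Correctness rests on the cut property, `IsMinSpanningTree.exists_insert`: if part of a minimum
spanning tree has no edge leaving a vertex set, a lightest edge leaving that set can be added to it.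
No distinctness of weights is needed, but the selected edges must not close a cycle. Ties are broken
towards the smaller root. If `h c` is the component selected by `c`, then `h c` sees the same edge
from the other side, so its own choice is at least as good, and two selections in a row strictly
lower the pair (weight, root) lexicographically unless they return to `c`. Once the smaller
component of each mutually selecting pair is made a root, all chains end (`hookTo_hooks`). The
distance `dep` to the end of the chain then orders the selected edges: adding them by increasing
`dep`, no earlier edge leaves the component whose turn it is (`exists_isMinSpanningTree_union`).

Every surviving root has a partner that does not survive, so a round at least halves the number `k`
of components. A round makes at most `9 * k` slow writes, which the potential `18 * k` pays for, so
the rounds proper write O(n) words in total.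

Reads are governed by the depth of the pointers. In phase one the depth grows by at most one per
round, so `R = ⌈log₂ log₂ n⌉` rounds cost O(R² m + R n), and R² = O(log n) by `rounds_mul_le`.
Afterwards at most n / 2^R ≤ n / log₂ n components remain, or just one. In phase two each vertex
points to a phase-one root, which points to its current root. The depth is 2 at the start of each
round and each of the at most log₂ n rounds costs O(m + n). Restoring this needs one write per
phase-one root per round, hence at most n writes in all. As G is connected, n ≤ m + 1, so the reads
fit into O(m log n + n).

The program is verified with a weakest precondition `wp` that carries two counters. `round_spec`
describes one round, `phaseOne_spec` and `phaseTwo_spec` iterate it, and `boruvka_spec` adds up the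
costs. -/

namespace ARAM

/-! ### Cost counters, frame conditions and weakest preconditions. -/

/-- All accesses other than writes to slow memory. -/
def Cost.ops (c : Cost) : ℕ := c.slowReads + c.fastReads + c.fastWrites

/-- Two counters that do not mention `ω` determine the work for every `ω`, so a single run analysis
serves all write costs. -/
theorem Cost.work_eq (ω : ℕ) (c : Cost) : c.work ω = c.ops + ω * c.slowWrites := by
  simp only [Cost.work, Cost.ioCost, Cost.ops]; omega

theorem Cost.ops_add (c d : Cost) : (c.add d).ops = c.ops + d.ops := by
  simp only [Cost.add, Cost.ops]; omega

theorem Cost.slowWrites_add (c d : Cost) :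
    (c.add d).slowWrites = c.slowWrites + d.slowWrites := rfl

/-- The instruction certainly leaves register `r` unchanged. -/
def Instr.keeps (r : ℕ) : Instr → Bool
  | .const d _ => d != r
  | .move d _ => d != r
  | .arith _ d _ _ => d != r
  | .load d _ => d != r
  | .store _ _ => true
  | .loadFast d _ => d != r
  | .storeFast _ _ => false

/-- The program certainly leaves register `r` unchanged. -/
def Prog.keeps (r : ℕ) : Prog → Bool
  | .skip => true
  | .instr i => i.keeps r
  | .seq p q => p.keeps r && q.keeps r
  | .cond _ p q => p.keeps r && q.keeps r
  | .loop _ p => p.keeps r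

/-- The program does not write to slow memory. -/
def Prog.readOnly : Prog → Bool
  | .skip => true
  | .instr (.store _ _) => false
  | .instr _ => true
  | .seq p q => p.readOnly && q.readOnly
  | .cond _ p q => p.readOnly && q.readOnly
  | .loop _ p => p.readOnly

section
variable {K : Type} {M b : ℕ}

/-- The target of `storeFast` is computed at run time, so `keeps` rejects it for every register; all
other targets are visible in the program text. -/
theorem Instr.step_keeps {s s' : Mem K} {c : Cost} {i : Instr} {r : ℕ}
    (h : i.step M b s = some (s', c)) (hk : i.keeps r = true) : s'.fast r = s.fast r := by
  cases i <;> simp only [Instr.step] at h <;> split at h <;> try (simp at h; done)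
  all_goals simp only [Instr.keeps, bne_iff_ne, ne_eq, Bool.false_eq_true] at hk
  all_goals (try split at h) <;> (try split at h)
  all_goals first
    | (simp at h; done)
    | (obtain ⟨rfl, -⟩ := by simpa using h
       simp [Mem.setFast, Function.update_of_ne (Ne.symm hk)])
    | (obtain ⟨rfl, -⟩ := by simpa using h
       rfl)

theorem Instr.step_slow {s s' : Mem K} {c : Cost} {i : Instr}
    (h : i.step M b s = some (s', c)) (hk : (Prog.instr i).readOnly = true) :
    s'.slow = s.slow := by
  cases i <;> simp only [Instr.step] at h <;> split at h <;> try (simp at h; done)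
  all_goals simp only [Prog.readOnly, Bool.false_eq_true] at hk
  all_goals (try split at h) <;> (try split at h)
  all_goals first
    | (simp at h; done)
    | (obtain ⟨rfl, -⟩ := by simpa using h
       rfl)

variable [LinearOrder K]

theorem Exec.fast_eq {p : Prog} {s s' : Mem K} {c : Cost} (h : Exec M b p s c s') {r : ℕ}
    (hk : p.keeps r = true) : s'.fast r = s.fast r := by
  induction h with
  | skip => rfl
  | instr h => exact Instr.step_keeps h hk
  | seq hp hq ihp ihq =>
    simp only [Prog.keeps, Bool.and_eq_true] at hk
    rw [ihq hk.2, ihp hk.1]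
  | condTrue ht hp ih => simp only [Prog.keeps, Bool.and_eq_true] at hk; exact ih hk.1
  | condFalse ht hp ih => simp only [Prog.keeps, Bool.and_eq_true] at hk; exact ih hk.2
  | loopStop ht => rfl
  | loopStep ht hp hl ihp ihl => rw [ihl hk, ihp hk]

theorem Exec.slow_eq {p : Prog} {s s' : Mem K} {c : Cost} (h : Exec M b p s c s')
    (hk : p.readOnly = true) : s'.slow = s.slow := by
  induction h with
  | skip => rfl
  | instr h => exact Instr.step_slow h hk
  | seq hp hq ihp ihq =>
    simp only [Prog.readOnly, Bool.and_eq_true] at hk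
    rw [ihq hk.2, ihp hk.1]
  | condTrue ht hp ih => simp only [Prog.readOnly, Bool.and_eq_true] at hk; exact ih hk.1
  | condFalse ht hp ih => simp only [Prog.readOnly, Bool.and_eq_true] at hk; exact ih hk.2
  | loopStop ht => rfl
  | loopStep ht hp hl ihp ihl => rw [ihl hk, ihp hk]

variable (M b) in
/-- Weakest precondition: started from `s`, with `t` operations and `w` slow writes already made,
the program halts, and the final memory and counters satisfy `Q`. -/
def wp (p : Prog) (Q : Mem K → ℕ → ℕ → Prop) (s : Mem K) (t w : ℕ) : Prop :=
  ∃ c s', Exec M b p s c s' ∧ Q s' (t + c.ops) (w + c.slowWrites)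

variable {p q : Prog} {Q R : Mem K → ℕ → ℕ → Prop} {s : Mem K} {t w : ℕ}

/-- Use the specification `R` of a program, and the fact that it changes only what it can. -/
theorem wp_call (h : wp M b p R s t w)
    (hQ : ∀ s' t' w', (∀ r, p.keeps r = true → s'.fast r = s.fast r) →
      (p.readOnly = true → s'.slow = s.slow) → R s' t' w' → Q s' t' w') :
    wp M b p Q s t w := by
  obtain ⟨c, s', he, hr⟩ := h
  exact ⟨c, s', he, hQ _ _ _ (fun r hk => he.fast_eq hk) he.slow_eq hr⟩

theorem wp_skip (h : Q s t w) : wp M b .skip Q s t w := ⟨_, _, .skip s, h⟩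

theorem wp_seq (h : wp M b p (wp M b q Q) s t w) : wp M b (.seq p q) Q s t w := by
  obtain ⟨c, s', he, d, s'', hd, h⟩ := h
  refine ⟨_, _, .seq he hd, ?_⟩
  rwa [Cost.ops_add, Cost.slowWrites_add, ← add_assoc, ← add_assoc]

theorem wp_shift (a : ℕ) (h : wp M b p Q s (t + a) w) :
    wp M b p (fun s' t' w' => Q s' (t' + a) w') s t w := by
  obtain ⟨c, s', he, h⟩ := h
  exact ⟨c, s', he, by rwa [add_right_comm] at h⟩

theorem wp_instr {i : Instr} {s' : Mem K} {c : Cost} (hi : i.step M b s = some (s', c))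
    (h : Q s' (t + c.ops) (w + c.slowWrites)) : wp M b (.instr i) Q s t w :=
  ⟨c, s', .instr hi, h⟩

theorem wp_cond {T : Test} {v : Bool} (hv : T.eval M s = some v)
    (htrue : v = true → wp M b p Q s (t + 2) w) (hfalse : v = false → wp M b q Q s (t + 2) w) :
    wp M b (.cond T p q) Q s t w := by
  cases v with
  | true =>
    obtain ⟨c, s', he, h⟩ := htrue rfl
    refine ⟨_, _, .condTrue hv he, ?_⟩
    rwa [Cost.ops_add, Cost.slowWrites_add, ← add_assoc, ← add_assoc]
  | false =>
    obtain ⟨c, s', he, h⟩ := hfalse rfl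
    refine ⟨_, _, .condFalse hv he, ?_⟩
    rwa [Cost.ops_add, Cost.slowWrites_add, ← add_assoc, ← add_assoc]

theorem wp_loop {T : Test} {v : Bool} (hv : T.eval M s = some v)
    (htrue : v = true → wp M b p (wp M b (.loop T p) Q) s (t + 2) w)
    (hfalse : v = false → Q s (t + 2) w) :
    wp M b (.loop T p) Q s t w := by
  cases v with
  | true =>
    obtain ⟨c, s', he, d, s'', hd, h⟩ := htrue rfl
    refine ⟨_, _, .loopStep hv he hd, ?_⟩
    rw [Cost.ops_add, Cost.slowWrites_add, Cost.ops_add, Cost.slowWrites_add]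
    have e1 : t + (Test.cost.ops + (c.ops + d.ops)) = t + 2 + c.ops + d.ops := by
      simp only [Test.cost, Cost.ops]; omega
    have e2 : w + (Test.cost.slowWrites + (c.slowWrites + d.slowWrites))
        = w + c.slowWrites + d.slowWrites := by
      simp only [Test.cost]; omega
    rwa [e1, e2]
  | false => exact ⟨_, _, .loopStop hv, hfalse rfl⟩

/-- The program uses the registers 0 to 34 only, which is where the bound 35 on fast memory comes
from. -/
theorem Test.eval_idx {T : Test} {k l : ℕ} (hM : 35 ≤ M) (hx : s.fast T.x = .idx k)
    (hy : s.fast T.y = .idx l) (hx' : T.x < 35 := by first | assumption | decide) (hy' : T.y < 35 := by first | assumption | decide) :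
    T.eval M s = some (T.cmp.eval k l) := by
  simp [Test.eval, hx, hy, hx'.trans_le hM, hy'.trans_le hM]

theorem Test.eval_wt {T : Test} {k l : K} (hM : 35 ≤ M) (hx : s.fast T.x = .wt k)
    (hy : s.fast T.y = .wt l) (hx' : T.x < 35 := by first | assumption | decide) (hy' : T.y < 35 := by first | assumption | decide) :
    T.eval M s = some (T.cmp.eval k l) := by
  simp [Test.eval, hx, hy, hx'.trans_le hM, hy'.trans_le hM]

end

end ARAM

/-! ### Rules for single instructions, array accesses and counted loops. -/

namespace Boruvka

open ARAM

section
variable {K : Type} [LinearOrder K] {M b : ℕ} {p : Prog} {ps : List Prog}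
  {Q : Mem K → ℕ → ℕ → Prop} {s : Mem K} {t w : ℕ}

theorem wp_nil (h : Q s t w) : wp M b (block []) Q s t w := wp_skip h

theorem wp_cons (h : wp M b p (wp M b (block ps) Q) s t w) : wp M b (block (p :: ps)) Q s t w :=
  wp_seq h

theorem wp_const {d k : ℕ} (hM : 35 ≤ M) (hk : k < 2 ^ b)
    (h : Q (s.setFast d (.idx k)) (t + 1) w) (hd : d < 35 := by first | assumption | decide) :
    wp M b (const d k) Q s t w := by
  refine wp_instr (c := ⟨0, 0, 0, 1⟩) ?_ h
  simp [Instr.step, hk, hd.trans_le hM]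

theorem wp_move {d x : ℕ} (hM : 35 ≤ M)
    (h : Q (s.setFast d (s.fast x)) (t + 2) w) (hd : d < 35 := by first | assumption | decide)
    (hx' : x < 35 := by first | assumption | decide) : wp M b (move d x) Q s t w := by
  refine wp_instr (c := ⟨0, 0, 1, 1⟩) ?_ h
  simp [Instr.step, hx'.trans_le hM, hd.trans_le hM]

theorem wp_add {d x y k l : ℕ} (hM : 35 ≤ M) (hx : s.fast x = .idx k) (hy : s.fast y = .idx l)
    (hk : k + l < 2 ^ b) (h : Q (s.setFast d (.idx (k + l))) (t + 3) w)
    (hd : d < 35 := by first | assumption | decide) (hx' : x < 35 := by first | assumption | decide) (hy' : y < 35 := by first | assumption | decide) :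
    wp M b (add d x y) Q s t w := by
  refine wp_instr (c := ⟨0, 0, 2, 1⟩) ?_ h
  simp [Instr.step, hk, hx, hy, Op.eval, hd.trans_le hM, hx'.trans_le hM, hy'.trans_le hM]

theorem wp_sub {d x y k l : ℕ} (hM : 35 ≤ M) (hx : s.fast x = .idx k) (hy : s.fast y = .idx l)
    (hk : k - l < 2 ^ b) (h : Q (s.setFast d (.idx (k - l))) (t + 3) w)
    (hd : d < 35 := by first | assumption | decide) (hx' : x < 35 := by first | assumption | decide) (hy' : y < 35 := by first | assumption | decide) :
    wp M b (sub d x y) Q s t w := by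
  refine wp_instr (c := ⟨0, 0, 2, 1⟩) ?_ h
  simp [Instr.step, hk, hx, hy, Op.eval, hd.trans_le hM, hx'.trans_le hM, hy'.trans_le hM]

theorem wp_incr {d k : ℕ} (hM : 35 ≤ M) (hx : s.fast d = .idx k) (hone : s.fast rOne = .idx 1)
    (hk : k + 1 < 2 ^ b) (h : Q (s.setFast d (.idx (k + 1))) (t + 3) w)
    (hd : d < 35 := by first | assumption | decide) : wp M b (incr d) Q s t w :=
  wp_add hM hx hone hk h

theorem wp_load {d a k : ℕ} {x : Word K} (hM : 35 ≤ M) (ha : s.fast a = .idx k)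
    (hx : s.slow k = x) (h : Q (s.setFast d x) (t + 3) w)
    (hd : d < 35 := by first | assumption | decide) (ha' : a < 35 := by first | assumption | decide) :
    wp M b (load d a) Q s t w := by
  subst hx
  refine wp_instr (c := ⟨1, 0, 1, 1⟩) ?_ h
  simp [Instr.step, ha, hd.trans_le hM, ha'.trans_le hM]

theorem wp_store {a x k : ℕ} {y : Word K} (hM : 35 ≤ M) (ha : s.fast a = .idx k)
    (hx : s.fast x = y) (h : Q (s.setSlow k y) (t + 2) (w + 1))
    (hx' : x < 35 := by first | assumption | decide) (ha' : a < 35 := by first | assumption | decide) :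
    wp M b (store a x) Q s t w := by
  subst hx
  refine wp_instr (c := ⟨0, 1, 2, 0⟩) ?_ h
  simp [Instr.step, ha, hx'.trans_le hM, ha'.trans_le hM]

theorem wp_get {d base i B k : ℕ} {x : Word K} (hM : 35 ≤ M) (hb : s.fast base = .idx B)
    (hi : s.fast i = .idx k) (hk : B + k < 2 ^ b) (hx : s.slow (B + k) = x)
    (h : Q ((s.setFast rT (.idx (B + k))).setFast d x) (t + 6) w)
    (hd : d < 35 := by first | assumption | decide) (hb' : base < 35 := by first | assumption | decide) (hi' : i < 35 := by first | assumption | decide) :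
    wp M b (get d base i) Q s t w :=
  wp_seq (wp_add hM hb hi hk (wp_load hM rfl hx h))

theorem wp_put {base i x B k : ℕ} {y : Word K} (hM : 35 ≤ M) (hb : s.fast base = .idx B)
    (hi : s.fast i = .idx k) (hk : B + k < 2 ^ b)
    (hx : (s.setFast rT (.idx (B + k))).fast x = y)
    (h : Q ((s.setFast rT (.idx (B + k))).setSlow (B + k) y) (t + 5) (w + 1))
    (hx' : x < 35 := by first | assumption | decide) (hb' : base < 35 := by first | assumption | decide) (hi' : i < 35 := by first | assumption | decide) :
    wp M b (put base i x) Q s t w :=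
  wp_seq (wp_add hM hb hi hk (wp_store hM rfl hx h))

/-- Before the body, 5 operations are charged: 2 for the loop test and 3 for the increment that
follows the body. Hence `Inv (i + 1)` is required of the memory with `rI` already advanced. The 2
operations in `fin` are the failing test. -/
theorem wp_forI {bound N : ℕ} (hM : 35 ≤ M) (hN : N < 2 ^ b) (hbound : s.fast bound = .idx N)
    (hone : s.fast rOne = .idx 1) (Inv : ℕ → Mem K → ℕ → ℕ → Prop)
    (h0 : Inv 0 (s.setFast rI (.idx 0)) (t + 1) w)
    (step : ∀ i < N, ∀ s₁ t₁ w₁, s₁.fast rI = .idx i →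
      (∀ r, r ≠ rI → p.keeps r = true → s₁.fast r = s.fast r) → Inv i s₁ t₁ w₁ →
      wp M b p (fun s₂ t₂ w₂ => Inv (i + 1) (s₂.setFast rI (.idx (i + 1))) t₂ w₂) s₁ (t₁ + 5) w₁)
    (fin : ∀ s₁ t₁ w₁, (∀ r, r ≠ rI → p.keeps r = true → s₁.fast r = s.fast r) →
      Inv N s₁ t₁ w₁ → Q s₁ (t₁ + 2) w₁)
    (hk : (p.keeps rI && p.keeps bound && p.keeps rOne) = true := by decide)
    (hb : bound ≠ rI := by decide) (hb' : bound < 35 := by first | assumption | decide) :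
    wp M b (forI bound p) Q s t w := by
  simp only [Bool.and_eq_true] at hk
  obtain ⟨⟨hkI, hkb⟩, hk1⟩ := hk
  refine wp_seq (wp_const hM (by positivity) ?_)
  suffices H : ∀ d i s₁ t₁ w₁, i + d = N → s₁.fast rI = .idx i →
      (∀ r, r ≠ rI → p.keeps r = true → s₁.fast r = s.fast r) → Inv i s₁ t₁ w₁ →
      wp M b (.loop ⟨.lt, rI, bound⟩ (.seq p (incr rI))) Q s₁ t₁ w₁ by
    refine H N 0 _ _ _ (by omega) rfl (fun r hr _ => ?_) h0
    simp [Mem.setFast, Function.update_of_ne hr]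
  intro d
  induction d with
  | zero =>
    intro i s₁ t₁ w₁ hd hi hf hI
    have hbd : s₁.fast bound = .idx N := (hf bound hb hkb).trans hbound
    refine wp_loop (Test.eval_idx hM hi hbd (show rI < 35 by decide) hb') (fun h => ?_) (fun _ => ?_)
    · have : i < N := of_decide_eq_true h
      omega
    · obtain rfl : i = N := by omega
      exact fin _ _ _ hf hI
  | succ d ih =>
    intro i s₁ t₁ w₁ hd hi hf hI
    have hbd : s₁.fast bound = .idx N := (hf bound hb hkb).trans hbound
    refine wp_loop (Test.eval_idx hM hi hbd (show rI < 35 by decide) hb') (fun _ => ?_) (fun h => ?_)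
    · refine wp_seq (wp_call (wp_shift 3 (step i (by omega) s₁ t₁ w₁ hi hf hI)) ?_)
      intro s₂ t₂ w₂ hf₂ _ hI₂
      refine wp_incr hM ((hf₂ rI hkI).trans hi)
        ((hf₂ rOne hk1).trans ((hf rOne (by decide) hk1).trans hone)) (by omega) ?_
      refine ih (i + 1) _ _ _ (by omega) rfl (fun r hr hkr => ?_) hI₂
      rw [← hf r hr hkr, ← hf₂ r hkr]
      simp [Mem.setFast, Function.update_of_ne hr]
    · have : ¬ i < N := of_decide_eq_false h
      omega

end

end Boruvka

/-! ### Layout of the slow memory: arrays, frames and output. -/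

namespace Boruvka

open ARAM

/-- The adjacency arrays of a graph: number of vertices, number of slots, offsets, neighbours and
weights. -/
structure Input (K : Type) where
  n : ℕ
  S : ℕ
  off : ℕ → ℕ
  nb : ℕ → ℕ
  wj : ℕ → K

namespace Input

variable {K : Type} (I : Input K)

structure Valid : Prop where
  off_zero : I.off 0 = 0
  off_mono : ∀ v < I.n, I.off v ≤ I.off (v + 1)
  off_last : I.off I.n = I.S
  nb_lt : ∀ j < I.S, I.nb j < I.n

/-- Base address of the array `a`: arrays `0` and `1` form the output, then come `par`, `nxt`,
`tail`, `hk`, `bu`, `bv`, `act` and `p1`. -/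
def P (a : ℕ) : ℕ := I.n + 2 + 2 * I.S + a * I.n

structure Fits (M b : ℕ) : Prop where
  fast : 35 ≤ M
  slow : I.n + 2 + 2 * I.S + 10 * I.n < 2 ^ b

/-- The slow memory contains the adjacency arrays. -/
structure Inp (sl : ℕ → Word K) : Prop where
  off : ∀ v ≤ I.n, sl (1 + v) = .idx (I.off v)
  nb : ∀ j < I.S, sl (I.n + 2 + j) = .idx (I.nb j)
  wj : ∀ j < I.S, sl (I.n + 2 + I.S + j) = .wt (I.wj j)

/-- The registers that are set once and for all. -/
structure Regs (s : Mem K) : Prop where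
  zero : s.fast rZero = .idx 0
  one : s.fast rOne = .idx 1
  n : s.fast rN = .idx I.n
  off : s.fast aOff = .idx 1
  nbr : s.fast aNbr = .idx (I.n + 2)
  wt : s.fast aWt = .idx (I.n + 2 + I.S)
  base : ∀ a, 2 ≤ a → a < 10 → s.fast (a + 6) = .idx (I.P a)

variable {I}

/-- Registers 2 and 4 are exempt: the former is the scratch register `rT`, the latter is `rS`,
needed only while the arrays are placed. -/
theorem Regs.congr {s s' : Mem K} (h : I.Regs s) {p : ℕ → Bool}
    (hf : ∀ r, p r = true → s'.fast r = s.fast r)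
    (hp : ∀ r < 16, r ≠ 2 → r ≠ 4 → p r = true := by decide) : I.Regs s' where
  zero := (hf 0 (hp 0 (by decide) (by decide) (by decide))).trans h.zero
  one := (hf 1 (hp 1 (by decide) (by decide) (by decide))).trans h.one
  n := (hf 3 (hp 3 (by decide) (by decide) (by decide))).trans h.n
  off := (hf 5 (hp 5 (by decide) (by decide) (by decide))).trans h.off
  nbr := (hf 6 (hp 6 (by decide) (by decide) (by decide))).trans h.nbr
  wt := (hf 7 (hp 7 (by decide) (by decide) (by decide))).trans h.wt
  base a h2 ha :=
    (hf (a + 6) (hp (a + 6) (by omega) (by omega) (by omega))).trans (h.base a h2 ha)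

theorem Regs.frame {s s' : Mem K} (h : I.Regs s) {p : Prog}
    (hf : ∀ r, p.keeps r = true → s'.fast r = s.fast r)
    (hp : ∀ r < 16, r ≠ 2 → r ≠ 4 → p.keeps r = true := by decide) : I.Regs s' :=
  h.congr hf hp

theorem Regs.frameI {s s' : Mem K} (h : I.Regs s) {p : Prog}
    (hf : ∀ r, r ≠ rI → p.keeps r = true → s'.fast r = s.fast r)
    (hp : ∀ r < 16, r ≠ 2 → r ≠ 4 → p.keeps r = true := by decide) : I.Regs s' :=
  h.congr (p := fun r => decide (r ≠ rI) && p.keeps r)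
    (fun r hr => by
      simp only [Bool.and_eq_true, decide_eq_true_eq] at hr
      exact hf r hr.1 hr.2)
    (fun r h1 h2 h3 => by
      simp only [Bool.and_eq_true, decide_eq_true_eq]
      exact ⟨by simp only [rI]; omega, hp r h1 h2 h3⟩)

theorem Fits.lt {M b : ℕ} (F : I.Fits M b) {a k : ℕ} (ha : a < 10) (hk : k < I.n) :
    I.P a + k < 2 ^ b := by
  have h1 : (a + 1) * I.n ≤ 10 * I.n := Nat.mul_le_mul_right _ ha
  have := F.slow
  simp only [P]
  linarith [Nat.add_mul a 1 I.n]

theorem Fits.lt' {M b : ℕ} (F : I.Fits M b) {k : ℕ} (hk : k ≤ I.n + 2 + 2 * I.S + 10 * I.n) :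
    k < 2 ^ b := hk.trans_lt F.slow

/-- Relative to the start of the arrays, the array number and the index are quotient and remainder
by `I.n`. All non-interference between arrays comes down to this. -/
theorem P_inj {a a' i j : ℕ} (hi : i < I.n) (hj : j < I.n) (h : I.P a + i = I.P a' + j) :
    a = a' ∧ i = j := by
  simp only [P, Nat.add_assoc] at h
  have h' : a * I.n + i = a' * I.n + j := by omega
  have hn : 0 < I.n := by omega
  have e : a = a' := by
    have := congrArg (· / I.n) h'
    simpa [Nat.mul_comm _ I.n, Nat.mul_add_div hn, Nat.div_eq_of_lt hi, Nat.div_eq_of_lt hj]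
      using this
  subst e
  exact ⟨rfl, by omega⟩

variable (I) in
/-- Only the arrays in `L` have changed. -/
def Frame (L : List ℕ) (sl sl' : ℕ → Word K) : Prop :=
  ∀ x, (∀ a ∈ L, ¬ (I.P a ≤ x ∧ x < I.P a + I.n)) → sl' x = sl x

theorem Frame.refl (L : List ℕ) (sl : ℕ → Word K) : I.Frame L sl sl := fun _ _ => rfl

theorem Frame.trans {L L' L'' : List ℕ} {sl sl' sl'' : ℕ → Word K} (h : I.Frame L sl sl')
    (h' : I.Frame L' sl' sl'') (hL : L ⊆ L'' := by decide) (hL' : L' ⊆ L'' := by decide) :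
    I.Frame L'' sl sl'' := fun x hx =>
  (h' x fun a ha => hx a (hL' ha)).trans (h x fun a ha => hx a (hL ha))

theorem Frame.store {L : List ℕ} {sl sl' : ℕ → Word K} (h : I.Frame L sl sl') {a i : ℕ}
    {y : Word K} (hi : i < I.n) (ha : a ∈ L := by decide) :
    I.Frame L sl (Function.update sl' (I.P a + i) y) := by
  intro x hx
  have : x ≠ I.P a + i := fun e => hx a ha (by omega)
  rw [Function.update_of_ne this, h x hx]

theorem Frame.read {L : List ℕ} {sl sl' : ℕ → Word K} (h : I.Frame L sl sl') {a i : ℕ}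
    (hi : i < I.n) (ha : a ∉ L := by decide) : sl' (I.P a + i) = sl (I.P a + i) := by
  refine h _ fun a' ha' hc => ha ?_
  have e : I.P a + i = I.P a' + (I.P a + i - I.P a') := by omega
  rwa [(P_inj hi (by omega) e).1]

theorem Frame.inp {L : List ℕ} {sl sl' : ℕ → Word K} (h : I.Frame L sl sl') (hI : I.Inp sl) :
    I.Inp sl' := by
  have key : ∀ x, x < I.n + 2 + 2 * I.S → sl' x = sl x := fun x hx =>
    h x fun a _ hc => by simp only [P] at hc; omega
  exact ⟨fun v hv => (key _ (by omega)).trans (hI.off v hv),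
    fun j hj => (key _ (by omega)).trans (hI.nb j hj),
    fun j hj => (key _ (by omega)).trans (hI.wj j hj)⟩

variable (I) in
/-- The array `a` has the values `f` on `D`. -/
def IsArr (sl : ℕ → Word K) (a : ℕ) (D : ℕ → Prop) (f : ℕ → ℕ) : Prop :=
  ∀ i < I.n, D i → sl (I.P a + i) = .idx (f i)

theorem IsArr.frame {L : List ℕ} {sl sl' : ℕ → Word K} {a : ℕ} {D : ℕ → Prop} {f : ℕ → ℕ}
    (h : I.IsArr sl a D f) (hf : I.Frame L sl sl') (ha : a ∉ L := by decide) :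
    I.IsArr sl' a D f := fun i hi hD => (hf.read hi ha).trans (h i hi hD)

theorem IsArr.mono {sl : ℕ → Word K} {a : ℕ} {D D' : ℕ → Prop} {f f' : ℕ → ℕ}
    (h : I.IsArr sl a D f) (hD : ∀ i < I.n, D' i → D i ∧ f i = f' i) : I.IsArr sl a D' f' :=
  fun i hi h' => by rw [h i hi (hD i hi h').1, (hD i hi h').2]

theorem IsArr.store {sl : ℕ → Word K} {a : ℕ} {D : ℕ → Prop} {f : ℕ → ℕ} {i y : ℕ}
    (h : I.IsArr sl a D f) (hi : i < I.n) :
    I.IsArr (Function.update sl (I.P a + i) (.idx y)) a (fun j => D j ∨ j = i)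
      (Function.update f i y) := by
  intro j hj hD
  by_cases e : j = i
  · subst e; simp
  · have : I.P a + j ≠ I.P a + i := by omega
    rw [Function.update_of_ne this, Function.update_of_ne e]
    exact h j hj (hD.resolve_right e)

theorem IsArr.store_ne {sl : ℕ → Word K} {a a' : ℕ} {D : ℕ → Prop} {f : ℕ → ℕ} {i : ℕ}
    {y : Word K} (h : I.IsArr sl a D f) (hi : i < I.n) (ha : a ≠ a' := by decide) :
    I.IsArr (Function.update sl (I.P a' + i) y) a D f := by
  intro j hj hD
  have : I.P a + j ≠ I.P a' + i := fun e => ha (P_inj hj hi e).1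
  rw [Function.update_of_ne this]
  exact h j hj hD

variable (I) in
/-- The edges `l` have been output. -/
def Out (sl : ℕ → Word K) (l : List (ℕ × ℕ)) : Prop :=
  ∀ i (h : i < l.length),
    sl (I.P 0 + 2 * i) = .idx l[i].1 ∧ sl (I.P 0 + (2 * i + 1)) = .idx l[i].2

theorem Out.frame {L : List ℕ} {sl sl' : ℕ → Word K} {l : List (ℕ × ℕ)} (h : I.Out sl l)
    (hf : I.Frame L sl sl') (hl : l.length ≤ I.n) (h0 : 0 ∉ L := by decide)
    (h1 : 1 ∉ L := by decide) : I.Out sl' l := by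
  have key : ∀ x, x < 2 * I.n → sl' (I.P 0 + x) = sl (I.P 0 + x) := by
    intro x hx
    by_cases hxn : x < I.n
    · exact hf.read hxn h0
    · have e : I.P 0 + x = I.P 1 + (x - I.n) := by simp only [P]; omega
      rw [e]
      exact hf.read (by omega) h1
  intro i hi
  exact ⟨(key _ (by omega)).trans (h i hi).1, (key _ (by omega)).trans (h i hi).2⟩

/-- The output runs through arrays 0 and 1 as one block of `2 * I.n` words, so a write may fall into
either. -/
theorem Frame.store_out {L : List ℕ} {sl sl' : ℕ → Word K} (h : I.Frame L sl sl') {x : ℕ}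
    {y : Word K} (hx : x < 2 * I.n) (h0 : 0 ∈ L := by decide) (h1 : 1 ∈ L := by decide) :
    I.Frame L sl (Function.update sl' (I.P 0 + x) y) := by
  by_cases hxn : x < I.n
  · exact h.store hxn h0
  · have e : I.P 0 + x = I.P 1 + (x - I.n) := by simp only [P]; omega
    rw [e]
    exact h.store (by omega) h1

theorem Out.push {sl : ℕ → Word K} {l : List (ℕ × ℕ)} (h : I.Out sl l) (u v : ℕ) :
    I.Out (Function.update (Function.update sl (I.P 0 + 2 * l.length) (.idx u))
      (I.P 0 + (2 * l.length + 1)) (.idx v)) (l ++ [(u, v)]) := by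
  intro i hi
  rw [List.length_append, List.length_singleton] at hi
  by_cases e : i = l.length
  · subst e
    constructor
    · rw [Function.update_of_ne (by omega)]; simp
    · simp
  · have hi' : i < l.length := by omega
    rw [Function.update_of_ne (by omega), Function.update_of_ne (by omega),
      Function.update_of_ne (by omega), Function.update_of_ne (by omega),
      List.getElem_append_left hi']
    exact h i hi'

end Input

/-! ### Pointer forests, and following a chain of pointers. -/

/-- In the pointer structure `par` on `{0, …, n - 1}`, following pointers leads from `v` to the
root `ρ v` in at most `D` steps. -/
structure Forest (n : ℕ) (par ρ : ℕ → ℕ) (D : ℕ) : Prop where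
  lt : ∀ v < n, par v < n
  root_par : ∀ v < n, ρ (par v) = ρ v
  par_root : ∀ v < n, par (ρ v) = ρ v
  iter : ∀ v < n, par^[D] v = ρ v

namespace Forest

variable {n D : ℕ} {par par' ρ : ℕ → ℕ}

theorem iter_lt (h : ∀ v < n, par v < n) (d : ℕ) : ∀ v < n, par^[d] v < n := by
  induction d with
  | zero => exact fun v hv => hv
  | succ d ih => exact fun v hv => by rw [Function.iterate_succ_apply]; exact ih _ (h v hv)

theorem root_lt (h : Forest n par ρ D) {v : ℕ} (hv : v < n) : ρ v < n := by
  rw [← h.iter v hv]; exact iter_lt h.lt D v hv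

theorem root_of_fixed (h : Forest n par ρ D) {v : ℕ} (hv : v < n) (e : par v = v) : ρ v = v := by
  rw [← h.iter v hv]; exact Function.iterate_fixed e D

theorem root_root (h : Forest n par ρ D) {v : ℕ} (hv : v < n) : ρ (ρ v) = ρ v :=
  h.root_of_fixed (h.root_lt hv) (h.par_root v hv)

theorem fixed_iff (h : Forest n par ρ D) {v : ℕ} (hv : v < n) : par v = v ↔ ρ v = v :=
  ⟨h.root_of_fixed hv, fun e => by have := h.par_root v hv; rwa [e] at this⟩

/-- Shortcutting some of the pointers. -/
theorem shortcut (h : Forest n par ρ D) (h' : ∀ v < n, par' v = par v ∨ par' v = ρ v) :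
    Forest n par' ρ D := by
  have hroot : ∀ v < n, par' (ρ v) = ρ v := fun v hv => by
    rcases h' _ (h.root_lt hv) with e | e
    · rw [e, h.par_root v hv]
    · rw [e, h.root_root hv]
  refine ⟨fun v hv => ?_, fun v hv => ?_, hroot, ?_⟩
  · rcases h' v hv with e | e <;> rw [e]
    exacts [h.lt v hv, h.root_lt hv]
  · rcases h' v hv with e | e <;> rw [e]
    exacts [h.root_par v hv, h.root_root hv]
  · suffices H : ∀ d, ∀ v < n, par^[d] v = ρ v → par'^[d] v = ρ v from
      fun v hv => H D v hv (h.iter v hv)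
    intro d
    induction d with
    | zero => exact fun v _ e => e
    | succ d ih =>
      intro v hv e
      rw [Function.iterate_succ_apply] at e ⊢
      rcases h' v hv with e' | e' <;> rw [e']
      · rw [ih _ (h.lt v hv) (by rw [e, h.root_par v hv]), h.root_par v hv]
      · exact Function.iterate_fixed (hroot v hv) d

/-- Old roots receive pointers to new roots. -/
theorem merge (h : Forest n par ρ D) {rt : ℕ → ℕ} (hrt : ∀ c < n, ρ c = c → rt c < n ∧
      ρ (rt c) = rt c ∧ rt (rt c) = rt c)
    (h' : ∀ v < n, par' v = if ρ v = v then rt v else par v) :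
    Forest n par' (fun v => rt (ρ v)) (D + 1) := by
  have hr : ∀ v < n, rt (ρ v) < n ∧ ρ (rt (ρ v)) = rt (ρ v) ∧ rt (rt (ρ v)) = rt (ρ v) :=
    fun v hv => hrt _ (h.root_lt hv) (h.root_root hv)
  have hroot : ∀ v < n, par' (rt (ρ v)) = rt (ρ v) := fun v hv => by
    rw [h' _ (hr v hv).1, if_pos (hr v hv).2.1, (hr v hv).2.2]
  refine ⟨fun v hv => ?_, fun v hv => ?_, hroot, ?_⟩
  · rw [h' v hv]; split_ifs with e
    exacts [(hrt v hv e).1, h.lt v hv]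
  · simp only [h' v hv]; split_ifs with e
    · rw [(hrt v hv e).2.1, (hrt v hv e).2.2, e]
    · rw [h.root_par v hv]
  · suffices H : ∀ d, ∀ v < n, par^[d] v = ρ v → par'^[d + 1] v = rt (ρ v) from
      fun v hv => H D v hv (h.iter v hv)
    intro d
    induction d with
    | zero =>
      intro v hv e
      simp only [Function.iterate_zero, id_eq] at e
      simp only [zero_add, Function.iterate_one, h' v hv, ← e, if_pos]
    | succ d ih =>
      intro v hv e
      rw [Function.iterate_succ_apply] at e ⊢
      by_cases hv' : ρ v = v
      · have e1 : par' v = rt (ρ v) := by rw [h' v hv, if_pos hv', hv']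
        rw [e1]
        exact Function.iterate_fixed (hroot v hv) _
      · rw [h' v hv, if_neg hv', ih _ (h.lt v hv) (by rw [e, h.root_par v hv]), h.root_par v hv]

theorem of_eq_root (h : Forest n par ρ D) (h' : ∀ v < n, par' v = ρ v) : Forest n par' ρ 1 := by
  refine ⟨fun v hv => ?_, fun v hv => ?_, fun v hv => ?_, fun v hv => ?_⟩
  · rw [h' v hv]; exact h.root_lt hv
  · rw [h' v hv, h.root_root hv]
  · rw [h' _ (h.root_lt hv), h.root_root hv]
  · exact h' v hv

end Forest

section
variable {K : Type} [LinearOrder K] {M b : ℕ} {I : Input K} {Q : Mem K → ℕ → ℕ → Prop}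
  {s : Mem K} {t w : ℕ}

theorem wp_geta {a d base i k : ℕ} {x : Word K} (F : I.Fits M b)
    (hb : s.fast base = .idx (I.P a)) (hi : s.fast i = .idx k) (hk : k < I.n)
    (hx : s.slow (I.P a + k) = x)
    (h : Q ((s.setFast rT (.idx (I.P a + k))).setFast d x) (t + 6) w)
    (ha : a < 10 := by first | assumption | decide) (hd : d < 35 := by first | assumption | decide) (hb' : base < 35 := by first | assumption | decide)
    (hi' : i < 35 := by first | assumption | decide) : wp M b (get d base i) Q s t w :=
  wp_get F.fast hb hi (F.lt ha hk) hx h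

theorem wp_puta {a base i x k : ℕ} {y : Word K} (F : I.Fits M b)
    (hb : s.fast base = .idx (I.P a)) (hi : s.fast i = .idx k) (hk : k < I.n)
    (hx : (s.setFast rT (.idx (I.P a + k))).fast x = y)
    (h : Q ((s.setFast rT (.idx (I.P a + k))).setSlow (I.P a + k) y) (t + 5) (w + 1))
    (ha : a < 10 := by first | assumption | decide) (hx' : x < 35 := by first | assumption | decide) (hb' : base < 35 := by first | assumption | decide)
    (hi' : i < 35 := by first | assumption | decide) : wp M b (put base i x) Q s t w :=
  wp_put F.fast hb hi (F.lt ha hk) hx h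

/-- Follow a chain of pointers `g` of length `k` to its end `r`. -/
theorem wp_follow {a base : ℕ} {p : Prog} {g : ℕ → ℕ} {D : ℕ → Prop} {r : ℕ} (F : I.Fits M b)
    -- The same loop is written in two syntactic forms, one in `findX` and one in `resolve`.
    (hp : p = .seq (move rX rP) (get rP base rX) ∨ p = block [move rX rP, get rP base rX])
    (ha : a < 10) (hbase : 2 < base) (hbase' : base < 16) (hr : g r = r) (k : ℕ) :
    ∀ (y : ℕ) (s : Mem K) (t : ℕ), s.fast base = .idx (I.P a) → I.IsArr s.slow a D g →
      (∀ j ≤ k, g^[j] y < I.n ∧ D (g^[j] y)) → g^[k] y = r →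
      s.fast rX = .idx y → s.fast rP = .idx (g y) →
      wp M b (.loop ⟨.ne, rP, rX⟩ p) (fun s' t' w' => s'.fast rX = .idx r ∧
        s'.slow = s.slow ∧ t' ≤ t + 10 * k + 2 ∧ w' = w) s t w := by
  have hb1 : base < 35 := by omega
  have hne : rP ≠ base := by simp only [rP]; omega
  have hne' : rX ≠ base := by simp only [rX]; omega
  have hnT : rT ≠ base := by simp only [rT]; omega
  induction k with
  | zero =>
    intro y s t hb hA hD hk hx hP
    simp only [Function.iterate_zero, id_eq] at hk
    subst hk
    refine wp_loop (Test.eval_idx F.fast hP hx) (fun h => ?_) (fun _ => ⟨hx, rfl, by omega, rfl⟩)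
    exact absurd hr (of_decide_eq_true h)
  | succ k ih =>
    intro y s t hb hA hD hk hx hP
    refine wp_loop (Test.eval_idx F.fast hP hx) (fun h => ?_) (fun h => ?_)
    · have h1 := hD 1 (by omega)
      rw [Function.iterate_one] at h1
      have hrd := hA (g y) h1.1 h1.2
      have key : wp M b (.loop ⟨.ne, rP, rX⟩ p) (fun s' t' w' => s'.fast rX = .idx r ∧
          s'.slow = s.slow ∧ t' ≤ t + 10 * (k + 1) + 2 ∧ w' = w)
          ((((s.setFast rX (s.fast rP)).setFast rT (.idx (I.P a + g y)))).setFast rP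
            (.idx (g (g y)))) (t + 2 + 2 + 6) w := by
        refine wp_call (ih (g y) _ _ ?_ hA ?_ (by rwa [Function.iterate_succ_apply] at hk)
          hP rfl) ?_
        · simp [Mem.setFast, Function.update_of_ne, hne.symm, hne'.symm, hnT.symm, hb]
        · intro j hj
          have := hD (j + 1) (by omega)
          rwa [Function.iterate_succ_apply] at this
        · rintro s' t' w' - - ⟨h1, h2, h3, h4⟩
          exact ⟨h1, h2, by omega, h4⟩
      rcases hp with rfl | rfl
      · refine wp_seq (wp_move F.fast ?_)
        refine wp_geta F ?_ hP h1.1 hrd key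
        simp [Mem.setFast, Function.update_of_ne, hne'.symm, hb]
      · refine wp_cons (wp_move F.fast ?_)
        refine wp_cons (wp_geta F ?_ hP h1.1 hrd (wp_nil key))
        simp [Mem.setFast, Function.update_of_ne, hne'.symm, hb]
    -- Here `k` only bounds the length of the chain: if the loop stops sooner, `y` is a fixed point
    -- and therefore already equals `r`.
    · have e : g y = y := not_not.1 (of_decide_eq_false h)
      rw [Function.iterate_fixed e] at hk
      subst hk
      exact ⟨hx, rfl, by omega, rfl⟩

/-- The first access costs 6, each pointer step 10 (test 2, move 2, access 6), and the failing test
2. -/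
theorem findX_spec {par ρ : ℕ → ℕ} {D x : ℕ} (F : I.Fits M b) (hR : I.Regs s)
    (hA : I.IsArr s.slow 2 (fun _ => True) par) (hF : Forest I.n par ρ D)
    (hx : s.fast rX = .idx x) (hxn : x < I.n) :
    wp M b findX (fun s' t' w' => s'.fast rX = .idx (ρ x) ∧ t' ≤ t + 10 * D + 8 ∧ w' = w)
      s t w := by
  refine wp_seq (wp_geta F (hR.base 2 (by decide) (by decide)) hx hxn (hA x hxn trivial) ?_)
  refine wp_call (wp_follow F (.inl rfl) (a := 2) (by decide) (by decide) (by decide)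
    (hF.par_root x hxn) D x _ _ (hR.base 2 (by decide) (by decide)) hA
    (fun j _ => ⟨Forest.iter_lt hF.lt j x hxn, trivial⟩) (hF.iter x hxn) hx rfl) ?_
  rintro s' t' w' - - ⟨h1, -, h3, h4⟩
  exact ⟨h1, by omega, h4⟩

end

end Boruvka

/-! ### Scanning adjacency slots for the lightest outgoing edge. -/

namespace Boruvka

open ARAM

variable {K : Type}

theorem Input.Valid.off_le {I : Input K} (hV : I.Valid) {u v : ℕ} (huv : u ≤ v) (hv : v ≤ I.n) :
    I.off u ≤ I.off v := by
  induction v, huv using Nat.le_induction with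
  | base => exact le_rfl
  | succ v huv ih => exact (ih (by omega)).trans (hV.off_mono v (by omega))

theorem Input.Valid.off_le_S {I : Input K} (hV : I.Valid) {v : ℕ} (hv : v ≤ I.n) :
    I.off v ≤ I.S := by
  rw [← hV.off_last]; exact hV.off_le hv le_rfl

/-- `j` is an adjacency slot of the vertex `v`. -/
def Input.IsSlot (I : Input K) (v j : ℕ) : Prop := I.off v ≤ j ∧ j < I.off (v + 1)

/-- Among the slots satisfying `J`, the slot `j` holds a lightest edge to a component other than
`c`, and the smallest target among these. -/
structure Input.IsBest [LinearOrder K] (I : Input K) (ρ : ℕ → ℕ) (c : ℕ) (J : ℕ → Prop)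
    (j : ℕ) : Prop where
  mem : J j
  ne : ρ (I.nb j) ≠ c
  le : ∀ j', J j' → ρ (I.nb j') ≠ c →
    I.wj j < I.wj j' ∨ I.wj j = I.wj j' ∧ ρ (I.nb j) ≤ ρ (I.nb j')

section
variable [LinearOrder K]

/-- The registers hold the best edge among the slots satisfying `J`, if there is any. -/
def Best (I : Input K) (ρ : ℕ → ℕ) (c : ℕ) (J : ℕ → Prop) (s : Mem K) : Prop :=
  (s.fast rBT = .idx c ∧ ∀ j, J j → ρ (I.nb j) = c) ∨
  ∃ j v, I.IsBest ρ c J j ∧ v < I.n ∧ I.IsSlot v j ∧ s.fast rBW = .wt (I.wj j) ∧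
    s.fast rBT = .idx (ρ (I.nb j)) ∧ s.fast rBU = .idx v ∧ s.fast rBV = .idx (I.nb j)

theorem Best.congr {I : Input K} {ρ : ℕ → ℕ} {c : ℕ} {J J' : ℕ → Prop} {s s' : Mem K}
    (h : Best I ρ c J s) (hJ : ∀ j, J j ↔ J' j) (h1 : s'.fast rBW = s.fast rBW)
    (h2 : s'.fast rBT = s.fast rBT) (h3 : s'.fast rBU = s.fast rBU)
    (h4 : s'.fast rBV = s.fast rBV) : Best I ρ c J' s' := by
  obtain rfl : J = J' := funext fun j => propext (hJ j)
  unfold Best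
  rwa [h1, h2, h3, h4]

variable {M b : ℕ} {I : Input K} {Q : Mem K → ℕ → ℕ → Prop} {s : Mem K} {t w : ℕ}

/-- Look at the edge in slot `rJ`. -/
def scanSlot : Prog := block [
    get rU aNbr rJ, move rX rU, findX,
    .cond ⟨.ne, rX, rC⟩
      (.seq (get rW aWt rJ)
        (.cond ⟨.eq, rBT, rC⟩ update
          (.cond ⟨.lt, rW, rBW⟩ update
            (.cond ⟨.eq, rW, rBW⟩ (.cond ⟨.lt, rX, rBT⟩ update .skip) .skip))))
      .skip,
    incr rJ]

theorem update_spec {ρ : ℕ → ℕ} {c v j : ℕ} {J : ℕ → Prop} (F : I.Fits M b) (hv : v < I.n)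
    (hW : s.fast rW = .wt (I.wj j)) (hX : s.fast rX = .idx (ρ (I.nb j)))
    (hrV : s.fast rV = .idx v) (hU : s.fast rU = .idx (I.nb j)) (hj : I.IsSlot v j)
    (hb : I.IsBest ρ c J j) :
    wp M b update (fun s' t' w' => Best I ρ c J s' ∧ t' ≤ t + 8 ∧ w' = w) s t w := by
  refine wp_cons (wp_move F.fast ?_)
  refine wp_cons (wp_move F.fast ?_)
  refine wp_cons (wp_move F.fast ?_)
  refine wp_cons (wp_move F.fast (wp_nil ?_))
  exact ⟨.inr ⟨j, v, hb, hv, hj, hW, hX, hrV, hU⟩, by omega, rfl⟩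

/-- The nested tests compare (weight, target root) lexicographically, so each branch either replaces
the recorded optimum or shows that the new slot does not beat it. -/
theorem scanSlot_spec {par ρ : ℕ → ℕ} {D c v j : ℕ} {J : ℕ → Prop} (F : I.Fits M b)
    (hV : I.Valid) (hR : I.Regs s) (hI : I.Inp s.slow)
    (hA : I.IsArr s.slow 2 (fun _ => True) par) (hF : Forest I.n par ρ D)
    (hc : s.fast rC = .idx c) (hrV : s.fast rV = .idx v) (hv : v < I.n)
    (hJ : s.fast rJ = .idx j) (hj : I.IsSlot v j) (hB : Best I ρ c J s) :
    wp M b scanSlot (fun s' t' w' => s'.fast rJ = .idx (j + 1) ∧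
      Best I ρ c (fun j' => J j' ∨ j' = j) s' ∧ t' ≤ t + 10 * D + 43 ∧ w' = w) s t w := by
  have hjS : j < I.S := hj.2.trans_le (hV.off_le_S hv)
  refine wp_cons (wp_get F.fast hR.nbr hJ (F.lt' (by omega)) (hI.nb j hjS) ?_)
  refine wp_cons (wp_move F.fast ?_)
  refine wp_cons (wp_call (findX_spec F (hR.congr (p := fun r => decide (r < 16 ∧ r ≠ 2))
    (fun r hr => ?_)) hA hF rfl (hV.nb_lt j hjS)) ?_)
  · simp only [decide_eq_true_eq] at hr
    have h1 : r ≠ rX := by simp only [rX]; omega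
    have h2 : r ≠ rU := by simp only [rU]; omega
    have h3 : r ≠ rT := hr.2
    simp [Mem.setFast, Function.update_of_ne, h1, h2, h3]
  intro s₁ t₁ w₁ hf₁ hs₁ ⟨hX₁, ht₁, hw₁⟩
  replace hs₁ : s₁.slow = s.slow := hs₁ rfl
  have hc₁ : s₁.fast rC = .idx c := (hf₁ rC rfl).trans hc
  have hV₁ : s₁.fast rV = .idx v := (hf₁ rV rfl).trans hrV
  have hJ₁ : s₁.fast rJ = .idx j := (hf₁ rJ rfl).trans hJ
  have hU₁ : s₁.fast rU = .idx (I.nb j) := (hf₁ rU rfl).trans rfl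
  have hone : s₁.fast rOne = .idx 1 := (hf₁ rOne rfl).trans hR.one
  have hwt : s₁.fast aWt = .idx (I.n + 2 + I.S) := (hf₁ aWt rfl).trans hR.wt
  have hB₁ : Best I ρ c J s₁ := hB.congr (fun _ => Iff.rfl) (hf₁ rBW rfl) (hf₁ rBT rfl)
    (hf₁ rBU rfl) (hf₁ rBV rfl)
  have fin : ∀ s' t', s'.fast rJ = .idx j → s'.fast rOne = .idx 1 →
      Best I ρ c (fun j' => J j' ∨ j' = j) s' → t' ≤ t + 10 * D + 40 →
      wp M b (block [incr rJ]) (fun s' t' w' => s'.fast rJ = .idx (j + 1) ∧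
      Best I ρ c (fun j' => J j' ∨ j' = j) s' ∧ t' ≤ t + 10 * D + 43 ∧ w' = w) s' t' w₁ := by
    intro s' t' h1 h2 h3 h4
    refine wp_cons (wp_incr F.fast h1 h2 (F.lt' (by omega)) (wp_nil ⟨rfl, ?_, by omega, hw₁⟩))
    exact h3.congr (fun _ => Iff.rfl) rfl rfl rfl rfl
  refine wp_cons (wp_cond (Test.eval_idx F.fast hX₁ hc₁) (fun h => ?_) (fun h => ?_))
  swap
  · have hne : ρ (I.nb j) = c := not_not.1 (of_decide_eq_false h)
    refine wp_skip (fin _ _ hJ₁ hone ?_ (by omega))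
    rcases hB₁ with ⟨h1, h2⟩ | ⟨j', v', h1, h2⟩
    · exact .inl ⟨h1, fun i hi => hi.elim (h2 i) (fun e => e ▸ hne)⟩
    · refine .inr ⟨j', v', ⟨.inl h1.mem, h1.ne, fun i hi hic => ?_⟩, h2⟩
      exact hi.elim (fun hi => h1.le i hi hic) (fun e => absurd (e ▸ hne) hic)
  have hne : ρ (I.nb j) ≠ c := of_decide_eq_true h
  refine wp_seq (wp_get F.fast hwt hJ₁ (F.lt' (by omega)) (x := .wt (I.wj j))
    (by rw [hs₁]; exact hI.wj j hjS) ?_)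
  have upd : ∀ (s' : Mem K) (t' : ℕ), s'.fast rW = .wt (I.wj j) →
      s'.fast rX = .idx (ρ (I.nb j)) → s'.fast rV = .idx v → s'.fast rU = .idx (I.nb j) →
      s'.fast rJ = .idx j → s'.fast rOne = .idx 1 → t' ≤ t + 10 * D + 32 →
      (∀ j', J j' → ρ (I.nb j') ≠ c →
        I.wj j < I.wj j' ∨ I.wj j = I.wj j' ∧ ρ (I.nb j) ≤ ρ (I.nb j')) →
      wp M b update (wp M b (block [incr rJ]) (fun s' t' w' => s'.fast rJ = .idx (j + 1) ∧
        Best I ρ c (fun j' => J j' ∨ j' = j) s' ∧ t' ≤ t + 10 * D + 43 ∧ w' = w)) s' t' w₁ := by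
    intro s' t' h1 h2 h3 h4 h5 h6 h7 h8
    refine wp_call (update_spec F hv h1 h2 h3 h4 hj (J := fun j' => J j' ∨ j' = j) (c := c)
      ⟨.inr rfl, hne, fun j' hj' hn => ?_⟩) ?_
    · rcases hj' with hj' | rfl
      exacts [h8 j' hj' hn, .inr ⟨rfl, le_rfl⟩]
    · rintro s₂ t₂ w₂ hf₂ - ⟨hb, ht, rfl⟩
      exact fin _ _ ((hf₂ rJ rfl).trans h5) ((hf₂ rOne rfl).trans h6) hb (by omega)
  -- `rBT = rC` encodes that no outgoing edge has been seen; a recorded edge always has a target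
  -- different from `c`.
  rcases hB₁ with ⟨hBT, hall⟩ | ⟨j', v', hbest, hv', hslot, hBW, hBT, hBU, hBV⟩
  · refine wp_cond (Test.eval_idx F.fast hBT hc₁) (fun h => ?_) (fun h => ?_)
    · exact upd _ _ rfl hX₁ hV₁ hU₁ hJ₁ hone (by omega) (fun i hi hic => absurd (hall i hi) hic)
    · exact absurd rfl (of_decide_eq_false h)
  refine wp_cond (Test.eval_idx F.fast hBT hc₁) (fun h => ?_) (fun _ => ?_)
  · exact absurd (of_decide_eq_true h) hbest.ne
  have keep : I.wj j' < I.wj j ∨ I.wj j' = I.wj j ∧ ρ (I.nb j') ≤ ρ (I.nb j) →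
      ∀ s' : Mem K, s'.fast rBW = s₁.fast rBW → s'.fast rBT = s₁.fast rBT →
      s'.fast rBU = s₁.fast rBU → s'.fast rBV = s₁.fast rBV →
      Best I ρ c (fun i => J i ∨ i = j) s' := by
    intro hle s' h1 h2 h3 h4
    refine .inr ⟨j', v', ⟨.inl hbest.mem, hbest.ne, fun i hi hic => ?_⟩, hv', hslot,
      h1.trans hBW, h2.trans hBT, h3.trans hBU, h4.trans hBV⟩
    rcases hi with hi | rfl
    exacts [hbest.le i hi hic, hle]
  refine wp_cond (Test.eval_wt F.fast rfl hBW) (fun h => ?_) (fun h => ?_)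
  · have hlt : I.wj j < I.wj j' := of_decide_eq_true h
    refine upd _ _ rfl hX₁ hV₁ hU₁ hJ₁ hone (by omega) (fun i hi hic => ?_)
    rcases hbest.le i hi hic with h | h
    exacts [.inl (hlt.trans h), .inl (hlt.trans_eq h.1)]
  have hnlt : ¬ I.wj j < I.wj j' := of_decide_eq_false h
  refine wp_cond (Test.eval_wt F.fast rfl hBW) (fun h => ?_) (fun h => ?_)
  swap
  · have hne' : ¬ I.wj j = I.wj j' := of_decide_eq_false h
    refine wp_skip (fin _ _ hJ₁ hone (keep (.inl ?_) _ rfl rfl rfl rfl) (by omega))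
    exact lt_of_le_of_ne (not_lt.1 hnlt) (Ne.symm hne')
  have heq : I.wj j = I.wj j' := of_decide_eq_true h
  refine wp_cond (Test.eval_idx F.fast hX₁ hBT) (fun h => ?_) (fun h => ?_)
  · have hlt : ρ (I.nb j) < ρ (I.nb j') := of_decide_eq_true h
    refine upd _ _ rfl hX₁ hV₁ hU₁ hJ₁ hone (by omega) (fun i hi hic => ?_)
    rcases hbest.le i hi hic with h | h
    exacts [.inl (heq.trans_lt h), .inr ⟨heq.trans h.1, hlt.le.trans h.2⟩]
  · have hge : ¬ ρ (I.nb j) < ρ (I.nb j') := of_decide_eq_false h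
    exact wp_skip (fin _ _ hJ₁ hone (keep (.inr ⟨heq.symm, not_lt.1 hge⟩) _ rfl rfl rfl rfl)
      (by omega))

theorem scanVertex_spec {par ρ : ℕ → ℕ} {D c v : ℕ} {J : ℕ → Prop} (F : I.Fits M b)
    (hV : I.Valid) (hR : I.Regs s) (hI : I.Inp s.slow)
    (hA : I.IsArr s.slow 2 (fun _ => True) par) (hF : Forest I.n par ρ D)
    (hc : s.fast rC = .idx c) (hrV : s.fast rV = .idx v) (hv : v < I.n) (hB : Best I ρ c J s) :
    wp M b scanVertex (fun s' t' w' => Best I ρ c (fun j => J j ∨ I.IsSlot v j) s' ∧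
      t' ≤ t + 17 + (10 * D + 45) * (I.off (v + 1) - I.off v) ∧ w' = w) s t w := by
  refine wp_cons (wp_get F.fast hR.off hrV (F.lt' (by omega)) (hI.off v hv.le) ?_)
  refine wp_cons (wp_add F.fast hrV hR.one (F.lt' (by omega)) ?_)
  refine wp_cons (wp_get F.fast hR.off rfl (F.lt' (by omega)) (hI.off (v + 1) hv) ?_)
  refine wp_cons ?_
  suffices H : ∀ d j s₁ t₁, j + d = I.off (v + 1) → I.off v ≤ j →
      (∀ r, scanVertex.keeps r = true → s₁.fast r = s.fast r) → s₁.slow = s.slow →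
      s₁.fast rJ = .idx j → s₁.fast rJE = .idx (I.off (v + 1)) →
      Best I ρ c (fun j' => J j' ∨ I.off v ≤ j' ∧ j' < j) s₁ →
      wp M b (.loop ⟨.lt, rJ, rJE⟩ scanSlot) (fun s' t' w' =>
        Best I ρ c (fun j => J j ∨ I.IsSlot v j) s' ∧
        t' ≤ t₁ + 2 + (10 * D + 45) * d ∧ w' = w) s₁ t₁ w by
    refine wp_call (H (I.off (v + 1) - I.off v) (I.off v) _ _
      (by have := hV.off_mono v hv; omega) le_rfl ?_ rfl rfl rfl ?_) ?_
    · intro r hr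
      have h1 : r ≠ rJ := fun e => by subst e; exact absurd hr (by decide)
      have h2 : r ≠ rJE := fun e => by subst e; exact absurd hr (by decide)
      have h3 : r ≠ rT := fun e => by subst e; exact absurd hr (by decide)
      simp [Mem.setFast, Function.update_of_ne, h1, h2, h3]
    · exact hB.congr (fun j => ⟨.inl, fun h => h.elim id fun h => absurd h.2 (by omega)⟩)
        rfl rfl rfl rfl
    · rintro s' t' w' - - ⟨h1, h2, h3⟩
      exact wp_nil ⟨h1, by omega, h3⟩
  intro d
  induction d with
  | zero =>
    intro j s₁ t₁ hd hj hf hs hJ hJE hB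
    refine wp_loop (Test.eval_idx F.fast hJ hJE) (fun h => ?_) (fun _ => ⟨?_, by omega, rfl⟩)
    · have : j < I.off (v + 1) := of_decide_eq_true h
      omega
    · refine hB.congr (fun i => ?_) rfl rfl rfl rfl
      simp only [Input.IsSlot]; rw [← hd, add_zero]
  | succ d ih =>
    intro j s₁ t₁ hd hj hf hs hJ hJE hB
    refine wp_loop (Test.eval_idx F.fast hJ hJE) (fun _ => ?_) (fun h => ?_)
    swap
    · have : ¬ j < I.off (v + 1) := of_decide_eq_false h
      omega
    refine wp_call (scanSlot_spec F hV (hR.frame hf) (hs ▸ hI) (hs ▸ hA) hF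
      ((hf rC rfl).trans hc) ((hf rV rfl).trans hrV) hv hJ ⟨hj, by omega⟩ hB) ?_
    rintro s₂ t₂ w₂ hf₂ hs₂ ⟨hJ₂, hB₂, ht₂, rfl⟩
    refine wp_call (ih (j + 1) s₂ t₂ (by omega) (by omega) (fun r hr => ?_)
      ((hs₂ rfl).trans hs) hJ₂ ((hf₂ rJE rfl).trans hJE) ?_) ?_
    · refine (hf₂ r ?_).trans (hf r hr)
      simp only [scanVertex, scanSlot, block, Prog.keeps, Bool.and_eq_true] at hr ⊢
      tauto
    · refine hB₂.congr (fun i => ?_) rfl rfl rfl rfl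
      by_cases hJi : J i <;> simp only [hJi, true_or, false_or]
      omega
    · rintro s' t' w' - - ⟨h1, h2, h3⟩
      exact ⟨h1, by rw [Nat.mul_succ]; omega, h3⟩

end

end Boruvka

/-! ### Lists of members, and the selection of one edge per component. -/

namespace Boruvka

open ARAM

section
variable {K : Type}

/-- The members of the component with root `c` form a linked list. -/
def Input.Members (I : Input K) (sl : ℕ → Word K) (ρ : ℕ → ℕ) (c : ℕ) : Prop :=
  ∃ L : List ℕ, (c :: L).IsChain (fun x y => sl (I.P 3 + x) = .idx y) ∧ (c :: L).Nodup ∧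
    sl (I.P 4 + c) = .idx ((c :: L).getLast (List.cons_ne_nil c L)) ∧
    ∀ v, v ∈ c :: L ↔ v < I.n ∧ ρ v = c

/-- `rs` lists the roots. -/
structure Roots (n : ℕ) (ρ : ℕ → ℕ) (rs : List ℕ) : Prop where
  nodup : rs.Nodup
  mem_iff : ∀ c, c ∈ rs ↔ c < n ∧ ρ c = c

theorem Roots.length_le {n : ℕ} {ρ : ℕ → ℕ} {rs : List ℕ} (h : Roots n ρ rs) :
    rs.length ≤ n := by
  have := (List.subperm_of_subset h.nodup (l₂ := List.range n)
    (fun c hc => List.mem_range.2 ((h.mem_iff c).1 hc).1)).length_le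
  simpa using this

/-- The list `rs` is stored at the beginning of array `a`. -/
def Input.Stored (I : Input K) (sl : ℕ → Word K) (a : ℕ) (rs : List ℕ) : Prop :=
  ∀ i (h : i < rs.length), sl (I.P a + i) = .idx rs[i]

theorem Input.Stored.frame {I : Input K} {L : List ℕ} {sl sl' : ℕ → Word K} {a : ℕ} {rs : List ℕ}
    (h : I.Stored sl a rs) (hf : I.Frame L sl sl') (hl : rs.length ≤ I.n)
    (ha : a ∉ L := by decide) : I.Stored sl' a rs :=
  fun i hi => (hf.read (by omega) ha).trans (h i hi)

theorem Input.Members.frame {I : Input K} {L : List ℕ} {sl sl' : ℕ → Word K} {ρ : ℕ → ℕ} {c : ℕ}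
    (h : I.Members sl ρ c) (hf : I.Frame L sl sl') (h3 : 3 ∉ L := by decide)
    (h4 : 4 ∉ L := by decide) : I.Members sl' ρ c := by
  obtain ⟨l, hc, hn, ht, hm⟩ := h
  have hlt : ∀ v ∈ c :: l, v < I.n := fun v hv => ((hm v).1 hv).1
  refine ⟨l, ?_, hn, ?_, hm⟩
  · refine (List.isChain_iff_getElem.2 fun i hi => ?_)
    rw [hf.read (hlt _ (List.getElem_mem _)) h3]
    exact List.isChain_iff_getElem.1 hc i hi
  · rw [hf.read (hlt c List.mem_cons_self) h4, ht]

/-- The slots of the vertices of the component `c`. -/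
def Input.CompSlot (I : Input K) (ρ : ℕ → ℕ) (c j : ℕ) : Prop :=
  ∃ v, v < I.n ∧ ρ v = c ∧ I.IsSlot v j

/-- The 25 covers the overhead 17 of `scanVertex`, plus a loop test (2) and the access to the next
member (6). -/
def Input.scanCost (I : Input K) (D v : ℕ) : ℕ := 25 + (10 * D + 45) * (I.off (v + 1) - I.off v)

/-- The numbers of slots telescope along the offsets, so a pass over all vertices pays for each slot
once. -/
theorem Input.Valid.sum_scanCost {I : Input K} (hV : I.Valid) (D : ℕ) :
    ∑ v ∈ Finset.range I.n, I.scanCost D v = 25 * I.n + (10 * D + 45) * I.S := by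
  have h : ∀ m ≤ I.n, ∑ v ∈ Finset.range m, (I.off (v + 1) - I.off v) = I.off m := by
    intro m
    induction m with
    | zero => simp [hV.off_zero]
    | succ m ih =>
      intro hm
      rw [Finset.sum_range_succ, ih (by omega)]
      have := hV.off_mono m hm
      omega
  simp only [scanCost]
  rw [Finset.sum_add_distrib, ← Finset.mul_sum, h _ le_rfl, hV.off_last]
  simp [Nat.mul_comm]

variable [LinearOrder K]

/-- The slot `j` of the vertex `v` holds the edge selected by the component `c`. -/
structure Input.Selects (I : Input K) (ρ : ℕ → ℕ) (c j v : ℕ) : Prop where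
  best : I.IsBest ρ c (I.CompSlot ρ c) j
  lt : v < I.n
  root : ρ v = c
  slot : I.IsSlot v j

variable {M b : ℕ} {I : Input K} {Q : Mem K → ℕ → ℕ → Prop} {s : Mem K} {t w : ℕ}

/-- Look at all vertices after `rV` in the list of members ending at `rE`. -/
def scanRest : Prog := .loop ⟨.ne, rV, rE⟩ (block [get rV aNxt rV, scanVertex])

theorem scanRest_spec {par ρ : ℕ → ℕ} {D c : ℕ} (F : I.Fits M b) (hV : I.Valid)
    (hF : Forest I.n par ρ D) (L : List ℕ) :
    ∀ (v : ℕ) (J : ℕ → Prop) (s : Mem K) (t : ℕ), I.Regs s → I.Inp s.slow →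
      I.IsArr s.slow 2 (fun _ => True) par → s.fast rC = .idx c → s.fast rV = .idx v →
      s.fast rE = .idx ((v :: L).getLast (List.cons_ne_nil v L)) →
      (v :: L).IsChain (fun x y => s.slow (I.P 3 + x) = .idx y) → (v :: L).Nodup →
      (∀ u ∈ v :: L, u < I.n) → Best I ρ c J s →
      wp M b scanRest (fun s' t' w' =>
        Best I ρ c (fun j => J j ∨ ∃ u ∈ L, I.IsSlot u j) s' ∧
        t' ≤ t + 2 + (L.map (I.scanCost D)).sum ∧ w' = w) s t w := by
  induction L with
  | nil =>
    intro v J s t hR hI hA hc hrV hE hch hnd hlt hB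
    refine wp_loop (Test.eval_idx F.fast hrV hE) (fun h => ?_) (fun _ => ⟨?_, by simp, rfl⟩)
    · exact absurd rfl (of_decide_eq_true h)
    · exact hB.congr (fun j => by simp) rfl rfl rfl rfl
  | cons u L ih =>
    intro v J s t hR hI hA hc hrV hE hch hnd hlt hB
    refine wp_loop (Test.eval_idx F.fast hrV hE) (fun _ => ?_) (fun h => ?_)
    swap
    -- Stopping here would mean that `v` is the last member, which occurs later in the list; `Nodup`
    -- excludes it.
    · refine absurd ?_ (List.nodup_cons.1 hnd).1
      have e : v = _ := not_not.1 (of_decide_eq_false h)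
      rw [List.getLast_cons (List.cons_ne_nil u L)] at e
      rw [e]
      exact List.getLast_mem _
    rw [List.isChain_cons_cons] at hch
    have hu : u < I.n := hlt u (by simp)
    refine wp_cons (wp_geta F (hR.base 3 (by decide) (by decide)) hrV (hlt v (by simp)) hch.1 ?_)
    refine wp_cons (wp_call (scanVertex_spec F hV (v := u) (c := c) (J := J)
      (hR.congr (p := fun r => decide (r < 16 ∧ r ≠ 2)) (fun r hr => ?_)) hI hA hF hc rfl hu
      (hB.congr (fun _ => Iff.rfl) rfl rfl rfl rfl)) ?_)
    · simp only [decide_eq_true_eq] at hr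
      have h1 : r ≠ rV := by simp only [rV]; omega
      have h3 : r ≠ rT := hr.2
      simp [Mem.setFast, Function.update_of_ne, h1, h3]
    rintro s₁ t₁ w₁ hf₁ hs₁ ⟨hB₁, ht₁, rfl⟩
    replace hs₁ : s₁.slow = s.slow := hs₁ rfl
    refine wp_nil (wp_call (ih u (fun j => J j ∨ I.IsSlot u j) s₁ t₁ ?_ (hs₁ ▸ hI) (hs₁ ▸ hA)
      ((hf₁ rC rfl).trans hc) ((hf₁ rV rfl).trans rfl) ?_ (hs₁ ▸ hch.2)
      (List.nodup_cons.1 hnd).2 (fun x hx => hlt x (List.mem_cons_of_mem _ hx)) hB₁) ?_)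
    · refine hR.congr (p := fun r => decide (r < 16 ∧ r ≠ 2 ∧ r ≠ 4)) (fun r hr => ?_)
      simp only [decide_eq_true_eq] at hr
      have h1 : r ≠ rV := by simp only [rV]; omega
      have h3 : r ≠ rT := hr.2.1
      refine (hf₁ r ?_).trans (by simp [Mem.setFast, Function.update_of_ne, h1, h3])
      have : ∀ r < 16, r ≠ 2 → r ≠ 4 → scanVertex.keeps r = true := by decide
      exact this r hr.1 hr.2.1 hr.2.2
    · refine (hf₁ rE rfl).trans (hE.trans ?_)
      rw [List.getLast_cons (List.cons_ne_nil u L)]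
    · rintro s' t' w' - - ⟨h1, h2, h3⟩
      refine ⟨h1.congr (fun j => by simp [or_assoc]) rfl rfl rfl rfl, ?_, h3⟩
      simp only [List.map_cons, List.sum_cons, Input.scanCost] at h2 ⊢
      omega

/-- The time is charged to vertices: each belongs to exactly one component, so the scans of all
components together cost one pass over the graph. `hex` guarantees that the sentinel in `rBT` is
overwritten for every component. -/
theorem select_spec {par ρ : ℕ → ℕ} {D : ℕ} {rs : List ℕ} (F : I.Fits M b) (hV : I.Valid)
    (hR : I.Regs s) (hI : I.Inp s.slow) (hA : I.IsArr s.slow 2 (fun _ => True) par)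
    (hF : Forest I.n par ρ D) (hrs : Roots I.n ρ rs) (hact : I.Stored s.slow 8 rs)
    (hmem : ∀ c ∈ rs, I.Members s.slow ρ c) (hK : s.fast rK = .idx rs.length)
    (hex : ∀ c ∈ rs, ∃ j, I.CompSlot ρ c j ∧ ρ (I.nb j) ≠ c) :
    wp M b select (fun s' t' w' => I.Frame [5, 6, 7] s.slow s'.slow ∧
      (∀ c ∈ rs, ∃ j v, I.Selects ρ c j v ∧ s'.slow (I.P 5 + c) = .idx (ρ (I.nb j)) ∧
        s'.slow (I.P 6 + c) = .idx v ∧ s'.slow (I.P 7 + c) = .idx (I.nb j)) ∧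
      t' ≤ t + 70 * I.n + (10 * D + 45) * I.S + 3 ∧ w' = w + 3 * rs.length) s t w := by
  have hlen := hrs.length_le
  refine wp_forI F.fast (F.lt' (by omega)) hK hR.one (fun i s' t' w' =>
    I.Frame [5, 6, 7] s.slow s'.slow ∧
    (∀ c ∈ rs.take i, ∃ j v, I.Selects ρ c j v ∧ s'.slow (I.P 5 + c) = .idx (ρ (I.nb j)) ∧
        s'.slow (I.P 6 + c) = .idx v ∧ s'.slow (I.P 7 + c) = .idx (I.nb j)) ∧
    t' ≤ t + 1 + 45 * i + ∑ v ∈ (Finset.range I.n).filter (fun v => ρ v ∈ rs.take i),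
      I.scanCost D v ∧ w' = w + 3 * i) ?_ ?_ ?_
  · exact ⟨.refl _ _, by simp, by simp, rfl⟩
  · rintro i hi s₁ t₁ w₁ hiI hf₁ ⟨hfr, hsel, ht, rfl⟩
    have hc := List.getElem_mem hi
    generalize hcd : rs[i] = c at hc
    have hcn := ((hrs.mem_iff c).1 hc).1
    have hR₁ : I.Regs s₁ := hR.frameI hf₁
    have hA₁ := hA.frame hfr
    have hI₁ := hfr.inp hI
    obtain ⟨L, hch, hnd, htl, hmm⟩ := (hmem c hc).frame hfr
    refine wp_cons (wp_geta F (hR₁.base 8 (by decide) (by decide)) hiI (by omega)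
      ((hact.frame hfr hlen) i hi) ?_)
    rw [hcd]
    refine wp_cons (wp_move F.fast ?_)
    refine wp_cons (wp_geta F (hR₁.base 4 (by decide) (by decide)) rfl hcn htl ?_)
    refine wp_cons (wp_move F.fast ?_)
    refine wp_cons (wp_call (scanVertex_spec F hV (v := c) (c := c) (J := fun _ => False)
      (hR₁.congr (p := fun r => decide (r < 16 ∧ r ≠ 2)) (fun r hr => ?_)) hI₁ hA₁ hF rfl rfl hcn
      (.inl ⟨rfl, fun _ => False.elim⟩)) ?_)
    · simp only [decide_eq_true_eq] at hr
      have h1 : r ≠ rV := by simp only [rV]; omega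
      have h2 : r ≠ rE := by simp only [rE]; omega
      have h4 : r ≠ rBT := by simp only [rBT]; omega
      have h5 : r ≠ rC := by simp only [rC]; omega
      have h3 : r ≠ rT := hr.2
      simp [Mem.setFast, Function.update_of_ne, h1, h2, h3, h4, h5]
    rintro s₂ t₂ w₂ hf₂ hs₂ ⟨hB₂, ht₂, rfl⟩
    replace hs₂ : s₂.slow = s₁.slow := hs₂ rfl
    have hR₂ : I.Regs s₂ := by
      refine hR₁.congr (p := fun r => decide (r < 16 ∧ r ≠ 2 ∧ r ≠ 4)) (fun r hr => ?_)
      simp only [decide_eq_true_eq] at hr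
      have h1 : r ≠ rV := by simp only [rV]; omega
      have h2 : r ≠ rE := by simp only [rE]; omega
      have h4 : r ≠ rBT := by simp only [rBT]; omega
      have h5 : r ≠ rC := by simp only [rC]; omega
      have h3 : r ≠ rT := hr.2.1
      refine (hf₂ r ?_).trans (by simp [Mem.setFast, Function.update_of_ne, h1, h2, h3, h4, h5])
      have : ∀ r < 16, r ≠ 2 → r ≠ 4 → scanVertex.keeps r = true := by decide
      exact this r hr.1 hr.2.1 hr.2.2
    refine wp_cons (wp_call (scanRest_spec F hV hF L c _ s₂ t₂ hR₂ (hs₂ ▸ hI₁) (hs₂ ▸ hA₁)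
      ((hf₂ rC rfl).trans rfl) ((hf₂ rV rfl).trans rfl) ((hf₂ rE rfl).trans rfl) (hs₂ ▸ hch) hnd
      (fun u hu => ((hmm u).1 hu).1) hB₂) ?_)
    rintro s₃ t₃ w₃ hf₃ hs₃ ⟨hB₃, ht₃, rfl⟩
    replace hs₃ : s₃.slow = s₁.slow := (hs₃ rfl).trans hs₂
    have hR₃ : I.Regs s₃ := hR₂.frame hf₃
    have hC₃ : s₃.fast rC = .idx c := (hf₃ rC rfl).trans ((hf₂ rC rfl).trans rfl)
    replace hB₃ : Best I ρ c (I.CompSlot ρ c) s₃ := by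
      refine hB₃.congr (fun j => ?_) rfl rfl rfl rfl
      simp only [Input.CompSlot, ← and_assoc, ← hmm, List.mem_cons]
      simp
    obtain ⟨j, v, hbest, hv, hslot, -, hBT, hBU, hBV⟩ : ∃ j v, I.IsBest ρ c (I.CompSlot ρ c) j ∧
        v < I.n ∧ I.IsSlot v j ∧ s₃.fast rBW = .wt (I.wj j) ∧
        s₃.fast rBT = .idx (ρ (I.nb j)) ∧ s₃.fast rBU = .idx v ∧ s₃.fast rBV = .idx (I.nb j) := by
      refine hB₃.resolve_left fun h => ?_
      obtain ⟨j, hj, hne⟩ := hex c hc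
      exact hne (h.2 j hj)
    -- The scan recorded some vertex `v` owning the slot `j`. Slot intervals of different vertices
    -- are disjoint, so `v` is the member of `c` that put `j` among the slots of the component.
    have hroot : ρ v = c := by
      obtain ⟨u, hu, hur, hus⟩ := hbest.mem
      rcases lt_trichotomy u v with h | h | h
      · have := hV.off_le (u := u + 1) (v := v) h hv.le
        have h1 := hus.2; have h2 := hslot.1; omega
      · rw [← h, hur]
      · have := hV.off_le (u := v + 1) (v := u) h hu.le
        have h1 := hus.1; have h2 := hslot.2; omega
    refine wp_cons (wp_puta F (hR₃.base 5 (by decide) (by decide)) hC₃ hcn hBT ?_)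
    refine wp_cons (wp_puta F (hR₃.base 6 (by decide) (by decide)) hC₃ hcn hBU ?_)
    refine wp_cons (wp_puta F (hR₃.base 7 (by decide) (by decide)) hC₃ hcn hBV (wp_nil ?_))
    have hne : ∀ a a' c', a ≠ a' → c' < I.n → I.P a + c ≠ I.P a' + c' :=
      fun a a' c' ha hc' e => ha (Input.P_inj hcn hc' e).1
    refine ⟨?_, fun c' hc' => ?_, ?_, rfl⟩
    · exact (((hs₃ ▸ hfr : I.Frame [5, 6, 7] s.slow s₃.slow).store hcn).store hcn).store hcn
    · by_cases e : c' = c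
      · subst e
        refine ⟨j, v, ⟨hbest, hv, hroot, hslot⟩, ?_⟩
        simp only [Mem.setSlow, Mem.setFast]
        rw [Function.update_of_ne (hne 5 7 c' (by decide) hcn),
          Function.update_of_ne (hne 5 6 c' (by decide) hcn), Function.update_self,
          Function.update_of_ne (hne 6 7 c' (by decide) hcn), Function.update_self,
          Function.update_self]
        exact ⟨rfl, rfl, rfl⟩
      · have hc'' : c' ∈ rs.take i := by
          rw [List.take_add_one, List.getElem?_eq_getElem hi, hcd] at hc'
          simpa [e] using hc'
        have hcn' := ((hrs.mem_iff c').1 (List.mem_of_mem_take hc'')).1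
        obtain ⟨j', v', hs', h5, h6, h7⟩ := hsel c' hc''
        have key : ∀ a, I.P a + c' ≠ I.P 5 + c ∧ I.P a + c' ≠ I.P 6 + c ∧
            I.P a + c' ≠ I.P 7 + c :=
          fun a => ⟨fun h => e (Input.P_inj hcn' hcn h).2, fun h => e (Input.P_inj hcn' hcn h).2,
            fun h => e (Input.P_inj hcn' hcn h).2⟩
        refine ⟨j', v', hs', ?_⟩
        simp only [Mem.setSlow, Mem.setFast]
        simp only [Function.update_of_ne (key _).1, Function.update_of_ne (key _).2.1,
          Function.update_of_ne (key _).2.2, hs₃]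
        exact ⟨h5, h6, h7⟩
    -- The members of `c` are disjoint from those of the components treated before, so their costs
    -- extend the partial sum.
    · have hsum : I.scanCost D c + (L.map (I.scanCost D)).sum +
          ∑ v ∈ (Finset.range I.n).filter (fun v => ρ v ∈ rs.take i), I.scanCost D v ≤
          ∑ v ∈ (Finset.range I.n).filter (fun v => ρ v ∈ rs.take (i + 1)), I.scanCost D v := by
        rw [← List.sum_cons, ← List.map_cons, ← List.sum_toFinset _ hnd, ← Finset.sum_union]
        · refine Finset.sum_le_sum_of_subset fun v hv => ?_
          rw [Finset.mem_union, List.mem_toFinset, hmm] at hv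
          simp only [Finset.mem_filter, Finset.mem_range] at hv ⊢
          rw [List.take_add_one, List.getElem?_eq_getElem hi, hcd]
          rcases hv with hv | hv
          · exact ⟨hv.1, by simp [hv.2]⟩
          · exact ⟨hv.1, by simp [hv.2]⟩
        · rw [Finset.disjoint_left]
          intro v hv hv'
          rw [List.mem_toFinset, hmm] at hv
          rw [Finset.mem_filter, hv.2, ← hcd] at hv'
          obtain ⟨k, hk, hki⟩ := List.mem_take_iff_getElem.1 hv'.2
          have := (List.Nodup.getElem_inj_iff hrs.nodup).1 hki
          omega
      have hsc : I.scanCost D c = 25 + (10 * D + 45) * (I.off (c + 1) - I.off c) := rfl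
      omega
  · rintro s₁ t₁ w₁ - ⟨h1, h2, h3, h4⟩
    rw [List.take_length] at h2 h3
    refine ⟨h1, h2, ?_, h4⟩
    have := Finset.sum_le_sum_of_subset (f := I.scanCost D)
      (Finset.filter_subset (fun v => ρ v ∈ rs) (Finset.range I.n))
    rw [hV.sum_scanCost] at this
    omega

end

end Boruvka

/-! ### Hooking: acyclicity and halving of the number of components. -/

namespace Boruvka

open ARAM

/-- The component that `c` is merged with: where two components select each other, the smaller
one becomes a root. -/
def hookTo (h : ℕ → ℕ) (c : ℕ) : ℕ := if h (h c) = c ∧ c < h c then c else h c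

/-- On `rs`, the pointers `g` form a forest; `rt` gives the roots, and `dep` decreases along
pointers. -/
structure Hooks (rs : List ℕ) (g rt dep : ℕ → ℕ) : Prop where
  mem : ∀ c ∈ rs, g c ∈ rs
  rt_mem : ∀ c ∈ rs, rt c ∈ rs
  rt_step : ∀ c ∈ rs, rt (g c) = rt c
  step_rt : ∀ c ∈ rs, g (rt c) = rt c
  rt_fixed : ∀ c ∈ rs, g c = c → rt c = c
  dep_lt : ∀ c ∈ rs, g c ≠ c → dep (g c) < dep c

namespace Hooks

variable {rs : List ℕ} {g rt dep : ℕ → ℕ}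

theorem rt_rt (h : Hooks rs g rt dep) {c : ℕ} (hc : c ∈ rs) : rt (rt c) = rt c :=
  h.rt_fixed _ (h.rt_mem c hc) (h.step_rt c hc)

theorem iter_mem (h : Hooks rs g rt dep) (j : ℕ) : ∀ c ∈ rs, g^[j] c ∈ rs := by
  induction j with
  | zero => exact fun c hc => hc
  | succ j ih => exact fun c hc => by rw [Function.iterate_succ_apply]; exact ih _ (h.mem c hc)

theorem dep_le (h : Hooks rs g rt dep) {c : ℕ} (hc : c ∈ rs) : dep (g c) ≤ dep c := by
  by_cases e : g c = c
  · rw [e]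
  · exact (h.dep_lt c hc e).le

theorem dep_iter_le (h : Hooks rs g rt dep) (j : ℕ) : ∀ c ∈ rs, dep (g^[j] c) ≤ dep c := by
  induction j with
  | zero => exact fun c _ => le_rfl
  | succ j ih =>
    intro c hc
    rw [Function.iterate_succ_apply]
    exact (ih _ (h.mem c hc)).trans (h.dep_le hc)

theorem exists_iter (h : Hooks rs g rt dep) : ∀ c ∈ rs, ∃ k, g^[k] c = rt c := by
  suffices H : ∀ d, ∀ c ∈ rs, dep c < d → ∃ k, g^[k] c = rt c from
    fun c hc => H _ c hc (Nat.lt_succ_self _)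
  intro d
  induction d with
  | zero => intro c _ hd; omega
  | succ d ih =>
    intro c hc hd
    by_cases e : g c = c
    · exact ⟨0, (h.rt_fixed c hc e).symm⟩
    · obtain ⟨k, hk⟩ := ih (g c) (h.mem c hc) (by have := h.dep_lt c hc e; omega)
      exact ⟨k + 1, by rw [Function.iterate_succ_apply, hk, h.rt_step c hc]⟩

theorem dep_rt_lt (h : Hooks rs g rt dep) {c : ℕ} (hc : c ∈ rs) (e : g c ≠ c) :
    dep (rt c) < dep c := by
  obtain ⟨k, hk⟩ := h.exists_iter (g c) (h.mem c hc)
  rw [← h.rt_step c hc, ← hk]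
  exact (h.dep_iter_le k _ (h.mem c hc)).trans_lt (h.dep_lt c hc e)

/-- This is what makes path compression sound while other chains still run through `c`: neither `rt`
nor `dep` has to change. -/
theorem update (h : Hooks rs g rt dep) {c : ℕ} (hc : c ∈ rs) :
    Hooks rs (Function.update g c (rt c)) rt dep := by
  refine ⟨fun x hx => ?_, h.rt_mem, fun x hx => ?_, fun x hx => ?_, fun x hx e => ?_,
    fun x hx e => ?_⟩
  · by_cases hxc : x = c
    · subst hxc; simpa using h.rt_mem x hx
    · simpa [hxc] using h.mem x hx
  · by_cases hxc : x = c
    · subst hxc; simpa using h.rt_rt hx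
    · simpa [hxc] using h.rt_step x hx
  · by_cases hxc : rt x = c
    · rw [← hxc]; simpa using h.rt_rt hx
    · simpa [hxc] using h.step_rt x hx
  · by_cases hxc : x = c
    · subst hxc; simpa using e
    · rw [Function.update_of_ne hxc] at e; exact h.rt_fixed x hx e
  · by_cases hxc : x = c
    · subst hxc
      rw [Function.update_self] at e ⊢
      refine h.dep_rt_lt hx fun e' => e (h.rt_fixed x hx e')
    · rw [Function.update_of_ne hxc] at e ⊢; exact h.dep_lt x hx e

end Hooks

/-- A chain that avoids `y` does not notice that the pointer of `y` has been redirected. -/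
theorem iterate_update {g : ℕ → ℕ} {y v : ℕ} (k : ℕ) :
    ∀ z, (∀ j < k, g^[j] z ≠ y) → (Function.update g y v)^[k] z = g^[k] z := by
  induction k with
  | zero => exact fun z _ => rfl
  | succ k ih =>
    intro z hz
    have h0 : z ≠ y := hz 0 (Nat.succ_pos k)
    rw [Function.iterate_succ_apply, Function.iterate_succ_apply, Function.update_of_ne h0]
    refine ih _ fun j hj => ?_
    rw [← Function.iterate_succ_apply]
    exact hz (j + 1) (Nat.succ_lt_succ hj)

/-- Every pointer structure on `rs` in which all chains end is a forest. -/
theorem exists_hooks {rs : List ℕ} {g : ℕ → ℕ} (hg : ∀ c ∈ rs, g c ∈ rs)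
    (hend : ∀ c ∈ rs, ∃ d, g (g^[d] c) = g^[d] c) : ∃ rt dep, Hooks rs g rt dep := by
  -- `dep` counts the steps until the chain becomes stationary, and the root is where it does.
  let dep : ℕ → ℕ := fun c => sInf {d | g (g^[d] c) = g^[d] c}
  have hdep : ∀ c ∈ rs, g (g^[dep c] c) = g^[dep c] c := fun c hc => Nat.sInf_mem (hend c hc)
  have hmin : ∀ c d, g (g^[d] c) = g^[d] c → dep c ≤ d := fun c d h => Nat.sInf_le h
  have hiter : ∀ j, ∀ c ∈ rs, g^[j] c ∈ rs := by
    intro j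
    induction j with
    | zero => exact fun c hc => hc
    | succ j ih => exact fun c hc => by rw [Function.iterate_succ_apply]; exact ih _ (hg c hc)
  have hstep : ∀ c ∈ rs, g c ≠ c → dep (g c) < dep c ∧ g^[dep (g c)] (g c) = g^[dep c] c := by
    intro c hc hne
    have h0 : dep c ≠ 0 := fun e => by
      have := hdep c hc
      rw [e] at this
      exact hne this
    obtain ⟨e, he⟩ := Nat.exists_eq_succ_of_ne_zero h0
    have h1 := hdep c hc
    rw [he, Function.iterate_succ_apply] at h1
    have h2 := hmin (g c) e h1
    refine ⟨by omega, ?_⟩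
    rw [he, Function.iterate_succ_apply]
    obtain ⟨m, hm⟩ := Nat.exists_eq_add_of_le' h2
    rw [hm, Function.iterate_add_apply, Function.iterate_fixed (hdep (g c) (hg c hc))]
  refine ⟨fun c => g^[dep c] c, dep, hg, fun c hc => hiter _ c hc, fun c hc => ?_, hdep,
    fun c hc e => Function.iterate_fixed e _, fun c hc e => (hstep c hc e).1⟩
  by_cases e : g c = c
  · simp only [e]
  · exact (hstep c hc e).2

variable {K : Type} [LinearOrder K]

/-- Hooking along lightest edges makes no cycles, as ties are broken consistently. -/
theorem hookTo_hooks {rs : List ℕ} {h : ℕ → ℕ} {W : ℕ → K} (hmem : ∀ c ∈ rs, h c ∈ rs)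
    (hW : ∀ c ∈ rs, W (h c) < W c ∨ W (h c) = W c ∧ h (h c) ≤ c) :
    ∃ rt dep, Hooks rs (hookTo h) rt dep := by
  have hmem' : ∀ c ∈ rs, hookTo h c ∈ rs := fun c hc => by
    unfold hookTo; split_ifs
    exacts [hc, hmem c hc]
  refine exists_hooks hmem' ?_
  -- Weight first, then the root itself, as the tie-breaking rule suggests. One selection need not
  -- decrease this key, but two do unless they return to the start.
  let key : {c // c ∈ rs} → K ×ₗ ℕ := fun c => toLex (W c, c)
  have wf : WellFounded (fun x y : {c // c ∈ rs} => key x < key y) :=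
    have : Finite {c // c ∈ rs} := List.finite_toSet rs
    have : IsTrans {c // c ∈ rs} (fun x y => key x < key y) := ⟨fun _ _ _ => lt_trans⟩
    have : Std.Irrefl (fun x y : {c // c ∈ rs} => key x < key y) := ⟨fun _ => lt_irrefl _⟩
    Finite.wellFounded_of_trans_of_irrefl _
  intro c hc
  have := wf.induction (C := fun c => ∃ d, hookTo h ((hookTo h)^[d] c) = (hookTo h)^[d] c)
    ⟨c, hc⟩
  refine this ?_
  rintro ⟨c, hc⟩ ih
  by_cases h0 : hookTo h c = c
  · exact ⟨0, h0⟩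
  by_cases h1 : hookTo h (h c) = h c
  · refine ⟨1, ?_⟩
    have : hookTo h c = h c := by
      unfold hookTo at h0 ⊢
      split_ifs at h0 ⊢
      · exact absurd rfl h0
      · rfl
    simpa [this] using h1
  have e0 : hookTo h c = h c := by
    unfold hookTo at h0 ⊢
    split_ifs at h0 ⊢
    · exact absurd rfl h0
    · rfl
  have e1 : hookTo h (h c) = h (h c) := by
    unfold hookTo at h1 ⊢
    split_ifs at h1 ⊢
    · exact absurd rfl h1
    · rfl
  -- In a mutually selecting pair the smaller one is fixed by `hookTo`, while here neither `c` nor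
  -- `h c` is.
  have hne : h (h c) ≠ c := by
    intro e
    rcases lt_trichotomy c (h c) with hlt | heq | hgt
    · exact h0 (by simp [hookTo, e, hlt])
    · exact h0 (e0.trans heq.symm)
    · exact h1 (by simp [hookTo, e, hgt])
  obtain ⟨d, hd⟩ := ih ⟨h (h c), hmem _ (hmem c hc)⟩ (by
    simp only [key, Prod.Lex.toLex_lt_toLex]
    rcases hW c hc with a | ⟨a, a'⟩ <;> rcases hW (h c) (hmem c hc) with b | ⟨b, -⟩
    · exact .inl (b.trans a)
    · exact .inl (b.trans_lt a)
    · exact .inl (b.trans_eq a)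
    · exact .inr ⟨b.trans a, lt_of_le_of_ne a' hne⟩)
  refine ⟨d + 2, ?_⟩
  rw [Function.iterate_add_apply]
  simpa [e0, e1] using hd

/-- At most half of the components remain roots. -/
theorem two_mul_length_fixed_le {rs : List ℕ} {h : ℕ → ℕ} (hnd : rs.Nodup)
    (hmem : ∀ c ∈ rs, h c ∈ rs) (hne : ∀ c ∈ rs, h c ≠ c) :
    2 * (rs.filter (fun c => hookTo h c = c)).length ≤ rs.length := by
  have hcond : ∀ c ∈ rs, hookTo h c = c → h (h c) = c ∧ c < h c := by
    intro c hc e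
    unfold hookTo at e
    split_ifs at e with hh
    · exact hh
    · exact absurd e (hne c hc)
  have h1 : (rs.filter (fun c => hookTo h c = c)).length ≤
      (rs.filter (fun c => ¬ hookTo h c = c)).length := by
    rw [← List.toFinset_card_of_nodup (hnd.filter _), ← List.toFinset_card_of_nodup (hnd.filter _)]
    -- Each surviving root is mapped to its partner. The partner is larger, so it does not survive,
    -- and applying `h` again recovers the root.
    refine Finset.card_le_card_of_injOn h ?_ ?_
    · intro c hc
      simp only [List.coe_toFinset, List.mem_filter, decide_eq_true_eq, Set.mem_ofPred_eq] at hc ⊢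
      obtain ⟨e1, e2⟩ := hcond c hc.1 hc.2
      refine ⟨hmem c hc.1, fun e => ?_⟩
      have := hcond _ (hmem c hc.1) e
      omega
    · intro c hc c' hc' e
      simp only [List.coe_toFinset, List.mem_filter, decide_eq_true_eq, Set.mem_ofPred_eq] at hc hc'
      rw [← (hcond c hc.1 hc.2).1, ← (hcond c' hc'.1 hc'.2).1, e]
  have h2 := List.length_eq_length_filter_add (l := rs) (fun c => decide (hookTo h c = c))
  have h3 : (rs.filter (fun c => ¬ hookTo h c = c)).length =
      (rs.filter (fun c => !decide (hookTo h c = c))).length := by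
    congr 2; funext c; simp
  omega

end Boruvka

/-! ### The programs that hook components and resolve the chains. -/

namespace Boruvka

open ARAM

section
variable {K : Type} [LinearOrder K] {M b : ℕ} {I : Input K} {Q : Mem K → ℕ → ℕ → Prop}
  {s : Mem K} {t w : ℕ}

theorem emit_spec {l : List (ℕ × ℕ)} {c u v : ℕ} (F : I.Fits M b) (hR : I.Regs s)
    (hc : s.fast rC = .idx c) (hcn : c < I.n) (hu : s.slow (I.P 6 + c) = .idx u)
    (hv : s.slow (I.P 7 + c) = .idx v) (hO : I.Out s.slow l) (hl : l.length < I.n)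
    (hr : s.fast rOut = .idx (I.P 0 + 2 * l.length)) :
    wp M b emit (fun s' t' w' => I.Out s'.slow (l ++ [(u, v)]) ∧
      s'.fast rOut = .idx (I.P 0 + 2 * (l ++ [(u, v)]).length) ∧
      I.Frame [0, 1] s.slow s'.slow ∧ t' = t + 22 ∧ w' = w + 2) s t w := by
  have hfr₁ : I.Frame [0, 1] s.slow
      (Function.update s.slow (I.P 0 + 2 * l.length) (.idx u)) :=
    (Input.Frame.refl _ _).store_out (by omega)
  have hP : I.P 0 + 2 * l.length + 2 < 2 ^ b := F.lt' (by simp only [Input.P]; omega)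
  refine wp_cons (wp_geta F (hR.base 6 (by decide) (by decide)) hc hcn hu ?_)
  refine wp_cons (wp_store F.fast hr rfl ?_)
  refine wp_cons (wp_incr F.fast hr hR.one (by omega) ?_)
  refine wp_cons (wp_geta F (hR.base 7 (by decide) (by decide)) hc hcn
    ((hfr₁.read hcn).trans hv) ?_)
  refine wp_cons (wp_store F.fast rfl rfl ?_)
  refine wp_cons (wp_incr F.fast rfl hR.one (by omega) (wp_nil ?_))
  refine ⟨hO.push u v, ?_, hfr₁.store_out (x := 2 * l.length + 1) (y := .idx v) (by omega), by omega,
    by omega⟩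
  simp only [List.length_append, List.length_singleton, Nat.mul_add]
  rfl

/-- The edges selected by the components in `rs` that do not stay roots. -/
def newEdges (h bu bv : ℕ → ℕ) (rs : List ℕ) : List (ℕ × ℕ) :=
  (rs.filter (fun c => hookTo h c ≠ c)).map (fun c => (bu c, bv c))

theorem newEdges_append (h bu bv : ℕ → ℕ) (rs : List ℕ) (c : ℕ) :
    newEdges h bu bv (rs ++ [c]) =
      newEdges h bu bv rs ++ if hookTo h c = c then [] else [(bu c, bv c)] := by
  unfold newEdges
  rw [List.filter_append, List.map_append]
  by_cases e : hookTo h c = c <;> simp [e]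

theorem length_newEdges_take_le (h bu bv : ℕ → ℕ) (rs : List ℕ) (i : ℕ) :
    (newEdges h bu bv (rs.take i)).length ≤ (newEdges h bu bv rs).length := by
  unfold newEdges
  rw [List.length_map, List.length_map]
  exact ((List.take_sublist i rs).filter _).length_le

/-- The array `hk` is changed while it is being read: entries of components already treated hold
`hookTo h`, the others still `h`. At most two words per component are written, either the emitted
edge or the fixed pointer. -/
theorem hook_spec {rs : List ℕ} {h bu bv : ℕ → ℕ} {l : List (ℕ × ℕ)} (F : I.Fits M b)
    (hR : I.Regs s) (hrs : rs.Nodup) (hlt : ∀ c ∈ rs, c < I.n) (hact : I.Stored s.slow 8 rs)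
    (hlen : rs.length ≤ I.n)
    (hK : s.fast rK = .idx rs.length) (hh : I.IsArr s.slow 5 (· ∈ rs) h)
    (hbu : I.IsArr s.slow 6 (· ∈ rs) bu) (hbv : I.IsArr s.slow 7 (· ∈ rs) bv)
    (hmem : ∀ c ∈ rs, h c ∈ rs) (hne : ∀ c ∈ rs, h c ≠ c) (hO : I.Out s.slow l)
    (hl : l.length + (newEdges h bu bv rs).length ≤ I.n)
    (hr : s.fast rOut = .idx (I.P 0 + 2 * l.length)) :
    wp M b hook (fun s' t' w' => I.Frame [0, 1, 5] s.slow s'.slow ∧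
      I.IsArr s'.slow 5 (· ∈ rs) (hookTo h) ∧ I.Out s'.slow (l ++ newEdges h bu bv rs) ∧
      s'.fast rOut = .idx (I.P 0 + 2 * (l ++ newEdges h bu bv rs).length) ∧
      t' ≤ t + 50 * rs.length + 3 ∧ w' ≤ w + 2 * rs.length) s t w := by
  refine wp_forI F.fast (F.lt' (by omega)) hK hR.one (fun i s' t' w' =>
    I.Frame [0, 1, 5] s.slow s'.slow ∧
    I.IsArr s'.slow 5 (· ∈ rs) (fun c => if c ∈ rs.take i then hookTo h c else h c) ∧
    I.Out s'.slow (l ++ newEdges h bu bv (rs.take i)) ∧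
    s'.fast rOut = .idx (I.P 0 + 2 * (l ++ newEdges h bu bv (rs.take i)).length) ∧
    t' ≤ t + 1 + 50 * i ∧ w' ≤ w + 2 * i) ?_ ?_ ?_
  · exact ⟨.refl _ _, hh.mono fun c _ hc => ⟨hc, by simp⟩, by
        change I.Out s.slow (l ++ [])
        rwa [List.append_nil], by
        change s.fast rOut = .idx (I.P 0 + 2 * (l ++ []).length)
        rwa [List.append_nil], by omega, by omega⟩
  · rintro i hi s₁ t₁ w₁ hiI hf₁ ⟨hfr, hh₁, hO₁, hr₁, ht, hw⟩
    have hc := List.getElem_mem hi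
    have hRi : I.Regs s₁ := hR.frameI hf₁
    have htake : rs.take (i + 1) = rs.take i ++ [rs[i]] := by
      rw [List.take_add_one, List.getElem?_eq_getElem hi]; rfl
    have hnot : rs[i] ∉ rs.take i := by
      intro hm
      obtain ⟨k, hk, hki⟩ := List.mem_take_iff_getElem.1 hm
      have := hrs.getElem_inj_iff.1 hki
      omega
    have hat := (hact.frame hfr hlen) i hi
    rw [htake, newEdges_append]
    have hlen₁ := length_newEdges_take_le h bu bv rs (i + 1)
    rw [htake, newEdges_append] at hlen₁
    generalize rs[i] = c at *
    have hcn := hlt c hc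
    have hxn := hlt _ (hmem c hc)
    have hhc := hh₁ c hcn hc
    simp only [if_neg hnot] at hhc
    refine wp_cons (wp_geta F (hRi.base 8 (by decide) (by decide)) hiI (by omega) hat ?_)
    refine wp_cons (wp_geta F (hRi.base 5 (by decide) (by decide)) rfl hcn hhc ?_)
    refine wp_cons (wp_geta F (hRi.base 5 (by decide) (by decide)) rfl hxn
      (hh₁ _ hxn (hmem c hc)) ?_)
    have hemit : hookTo h c = h c → ∀ (s' : Mem K) (t' : ℕ), s'.slow = s₁.slow → I.Regs s' →
        s'.fast rC = .idx c → s'.fast rOut = s₁.fast rOut → t' ≤ t₁ + 27 →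
        wp M b emit (wp M b (block []) (fun s₂ t₂ w₂ =>
          I.Frame [0, 1, 5] s.slow (s₂.setFast rI (.idx (i + 1))).slow ∧
          I.IsArr (s₂.setFast rI (.idx (i + 1))).slow 5 (· ∈ rs)
            (fun c' => if c' ∈ rs.take i ++ [c] then hookTo h c' else h c') ∧
          I.Out (s₂.setFast rI (.idx (i + 1))).slow (l ++ (newEdges h bu bv (rs.take i) ++
            if hookTo h c = c then [] else [(bu c, bv c)])) ∧
          (s₂.setFast rI (.idx (i + 1))).fast rOut = .idx (I.P 0 + 2 *
            (l ++ (newEdges h bu bv (rs.take i) ++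
            if hookTo h c = c then [] else [(bu c, bv c)])).length) ∧
          t₂ ≤ t + 1 + 50 * (i + 1) ∧ w₂ ≤ w + 2 * (i + 1))) s' t' w₁ := by
      intro he s' t' hs' hR' hC' hO' ht'
      have hne' : hookTo h c ≠ c := by rw [he]; exact hne c hc
      rw [if_neg hne'] at hlen₁ ⊢
      have hll : (l ++ newEdges h bu bv (rs.take i)).length < I.n := by
        simp only [List.length_append, List.length_singleton] at hlen₁ ⊢
        omega
      refine wp_call (emit_spec F hR' hC' hcn (u := bu c) (v := bv c) ?_ ?_ (hs' ▸ hO₁) hll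
        (hO'.trans hr₁)) ?_
      · rw [hs']; exact (hbu.frame hfr) c hcn hc
      · rw [hs']; exact (hbv.frame hfr) c hcn hc
      · rintro s₂ t₂ w₂ - - ⟨h1, h2, h3, h4, h5⟩
        rw [hs'] at h3
        rw [← List.append_assoc]
        refine wp_nil ⟨hfr.trans h3, ?_, h1, h2, by omega, by omega⟩
        refine (hh₁.frame h3).mono fun x _ hx => ⟨hx, ?_⟩
        by_cases hxc : x = c
        · subst hxc; simp [hnot, he]
        · simp [hxc]
    have hR' : ∀ y z t', I.Regs (((((s₁.setFast rT (.idx t')).setFast rC (.idx c)).setFast rT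
        (.idx (I.P 5 + c))).setFast rX y |>.setFast rT (.idx (I.P 5 + h c))).setFast rP z) := by
      intro y z t'
      refine hRi.congr (p := fun r => decide (r < 16 ∧ r ≠ 2)) (fun r hr => ?_)
      simp only [decide_eq_true_eq] at hr
      have h1 : r ≠ rC := by simp only [rC]; omega
      have h2 : r ≠ rX := by simp only [rX]; omega
      have h4 : r ≠ rP := by simp only [rP]; omega
      have h3 : r ≠ rT := hr.2
      simp [Mem.setFast, Function.update_of_ne, h1, h2, h3, h4]
    -- The reading fails to reveal a mutual selection only if the partner is the smaller one and was
    -- treated before. Then `c` must emit its edge anyway, so the branch taken is still the right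
    -- one.
    have hcase : (if h c ∈ rs.take i then hookTo h (h c) else h (h c)) = c ↔
        (h (h c) = c ∧ ¬ (h c ∈ rs.take i ∧ h c < c)) := by
      by_cases hm : h c ∈ rs.take i
      · rw [if_pos hm]
        unfold hookTo
        split_ifs with hh'
        · constructor
          · exact fun e => absurd e (hne c hc)
          · rintro ⟨e1, e2⟩
            rw [e1] at hh'
            exact absurd ⟨hm, hh'.2⟩ e2
        · constructor
          · intro e
            rw [e] at hh'
            exact ⟨e, fun hlt => hh' ⟨rfl, hlt.2⟩⟩
          · exact fun e => e.1
      · rw [if_neg hm]; simp [hm]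
    refine wp_cons (wp_cond (Test.eval_idx F.fast rfl rfl) (fun e => ?_) (fun e => ?_))
    · have e1 := hcase.1 (of_decide_eq_true e)
      refine wp_cond (Test.eval_idx F.fast rfl rfl) (fun e' => ?_) (fun e' => ?_)
      · have hlt' : c < h c := of_decide_eq_true e'
        have hfix : hookTo h c = c := by rw [hookTo, if_pos ⟨e1.1, hlt'⟩]
        refine wp_puta F (hRi.base 5 (by decide) (by decide)) rfl hcn rfl (wp_nil ?_)
        rw [if_pos hfix, List.append_nil]
        refine ⟨hfr.store hcn, ?_, ?_, hr₁, by omega, by omega⟩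
        · refine (hh₁.store hcn).mono fun x _ hx => ⟨.inl hx, ?_⟩
          by_cases hxc : x = c
          · subst hxc; simp [hfix]
          · simp [hxc]
        · refine hO₁.frame (L := [5]) ((Input.Frame.refl _ _).store hcn) ?_
          simp only [List.length_append] at hlen₁ ⊢
          omega
      · have hlt' : ¬ c < h c := of_decide_eq_false e'
        exact hemit (by rw [hookTo, if_neg fun hh' => hlt' hh'.2]) _ _ rfl (hR' _ _ _) rfl rfl
          (by omega)
    · have e1 : ¬ (_ = c) := of_decide_eq_false e
      rw [hcase] at e1
      refine hemit ?_ _ _ rfl (hR' _ _ _) rfl rfl (by omega)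
      rw [hookTo, if_neg]
      rintro ⟨h1, h2⟩
      exact e1 ⟨h1, fun h3 => by omega⟩
  · rintro s₁ t₁ w₁ - ⟨h1, h2, h3, h4, h5, h6⟩
    rw [List.take_length] at h2 h3 h4
    exact ⟨h1, h2.mono fun c _ hc => ⟨hc, by simp [hc]⟩, h3, h4, by omega, h6⟩

/-- Let all components on the chain from `rC` to its end `rX` point to `rX`. -/
def compress : Prog :=
  .loop ⟨.ne, rP, rX⟩ (block [put aHk rC rX, move rC rP, get rP aHk rC])

/-- The components that do not point directly to their root. -/
def unresolved (rs : List ℕ) (g rt : ℕ → ℕ) : Finset ℕ := rs.toFinset.filter fun c => g c ≠ rt c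

/-- Each of the `k` writes removes one component from `unresolved`, which becomes the potential for
both time and writes. The last component before the root already points to it and is left alone. -/
theorem compress_spec {rs : List ℕ} {rt dep : ℕ → ℕ} (F : I.Fits M b)
    (hlt : ∀ c ∈ rs, c < I.n) (k : ℕ) :
    ∀ (g : ℕ → ℕ) (y : ℕ) (s : Mem K) (t w : ℕ), Hooks rs g rt dep → y ∈ rs → I.Regs s →
      I.IsArr s.slow 5 (· ∈ rs) g → g^[k] (g y) = rt y → (∀ j < k, g^[j] (g y) ≠ rt y) →
      s.fast rC = .idx y → s.fast rX = .idx (rt y) → s.fast rP = .idx (g y) →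
      wp M b compress (fun s' t' w' => ∃ g', Hooks rs g' rt dep ∧
        I.IsArr s'.slow 5 (· ∈ rs) g' ∧ I.Frame [5] s.slow s'.slow ∧
        (∀ c ∈ rs, g c = rt c → g' c = rt c) ∧ g' y = rt y ∧ t' ≤ t + 2 + 15 * k ∧ w' ≤ w + k ∧
        (unresolved rs g' rt).card + k ≤ (unresolved rs g rt).card) s t w := by
  induction k with
  | zero =>
    intro g y s t w hg hy hR hA hk hj hC hX hP
    refine wp_loop (Test.eval_idx F.fast hP hX) (fun e => absurd hk (of_decide_eq_true e))
      (fun _ => ⟨g, hg, hA, .refl _ _, fun _ _ e => e, hk, by omega, by omega, le_rfl⟩)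
  | succ k ih =>
    intro g y s t w hg hy hR hA hk hj hC hX hP
    have hne : g y ≠ rt y := hj 0 (Nat.succ_pos k)
    refine wp_loop (Test.eval_idx F.fast hP hX) (fun _ => ?_)
      (fun e => absurd (not_not.1 (of_decide_eq_false e)) hne)
    have hyn := hlt y hy
    have hgy := hg.mem y hy
    have hgne : g y ≠ y := fun e => hne (by rw [hg.rt_fixed y hy e, e])
    have hA' := (hA.store (y := rt y) hyn).mono (D' := (· ∈ rs))
      (f' := Function.update g y (rt y)) fun _ _ h => ⟨.inl h, rfl⟩
    refine wp_cons (wp_puta F (hR.base 5 (by decide) (by decide)) hC hyn hX ?_)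
    refine wp_cons (wp_move F.fast ?_)
    refine wp_cons (wp_geta F (hR.base 5 (by decide) (by decide)) hP (hlt _ hgy)
      (hA' _ (hlt _ hgy) hgy) (wp_nil ?_))
    -- Since `dep` drops strictly at `y`, the rest of the chain never returns to `y`, and
    -- redirecting `y` leaves it intact.
    have havoid : ∀ j, g^[j] (g y) ≠ y := fun j e => by
      have h1 := hg.dep_iter_le j _ hgy
      have h2 := hg.dep_lt y hy hgne
      rw [e] at h1
      omega
    have hit : ∀ j, (Function.update g y (rt y))^[j] (Function.update g y (rt y) (g y)) =
        g^[j] (g (g y)) := fun j => by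
      rw [← Function.iterate_succ_apply, ← Function.iterate_succ_apply (f := g)]
      exact iterate_update _ _ fun j _ => havoid j
    refine wp_call (ih (Function.update g y (rt y)) (g y) _ _ _ (hg.update hy) hgy ?_ hA' ?_ ?_
      hP ?_ rfl) ?_
    · refine hR.congr (p := fun r => decide (r < 16 ∧ r ≠ 2)) (fun r hr => ?_)
      simp only [decide_eq_true_eq] at hr
      have h1 : r ≠ rC := by simp only [rC]; omega
      have h4 : r ≠ rP := by simp only [rP]; omega
      have h3 : r ≠ rT := hr.2
      simp [Mem.setFast, Mem.setSlow, Function.update_of_ne, h1, h3, h4]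
    · rw [hit, hg.rt_step y hy, ← hk, Function.iterate_succ_apply]
    · intro j hjk
      rw [hit, hg.rt_step y hy, ← Function.iterate_succ_apply (f := g)]
      exact hj (j + 1) (by omega)
    · rw [hg.rt_step y hy]; exact hX
    rintro s' t' w' - - ⟨g', h1, h2, h3, h4, h5, h6, h7, h8⟩
    refine ⟨g', h1, h2, ((Input.Frame.refl [5] s.slow).store hyn).trans h3, fun c hc e => ?_, ?_,
      by omega, by omega, ?_⟩
    · refine h4 c hc ?_
      by_cases hcy : c = y
      · subst hcy; simp
      · simpa [hcy] using e
    · exact h4 y hy (by simp)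
    · have : (unresolved rs (Function.update g y (rt y)) rt).card <
          (unresolved rs g rt).card := by
        refine Finset.card_lt_card ⟨fun c hc => ?_, fun hss => ?_⟩
        · simp only [unresolved, Finset.mem_filter, List.mem_toFinset] at hc ⊢
          refine ⟨hc.1, fun e => hc.2 ?_⟩
          by_cases hcy : c = y
          · subst hcy; simp
          · simpa [hcy] using e
        · have := hss (show y ∈ unresolved rs g rt by simp [unresolved, hy, hne])
          simp [unresolved] at this
      omega

/-- A chain is walked twice, at 10 operations per step to find its end and 15 to redirect it. The
total of 25 is charged to the component that becomes resolved, so all chains together take linear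
time and one write per component. -/
theorem resolve_spec {rs : List ℕ} {g₀ rt dep : ℕ → ℕ} (F : I.Fits M b) (hR : I.Regs s)
    (hlt : ∀ c ∈ rs, c < I.n) (hact : I.Stored s.slow 8 rs) (hlen : rs.length ≤ I.n)
    (hK : s.fast rK = .idx rs.length) (hA : I.IsArr s.slow 5 (· ∈ rs) g₀)
    (hg₀ : Hooks rs g₀ rt dep) :
    wp M b resolve (fun s' t' w' => I.Frame [5] s.slow s'.slow ∧
      I.IsArr s'.slow 5 (· ∈ rs) rt ∧ t' ≤ t + 70 * rs.length + 3 ∧ w' ≤ w + rs.length)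
      s t w := by
  refine wp_forI F.fast (F.lt' (by omega)) hK hR.one (fun i s' t' w' =>
    I.Frame [5] s.slow s'.slow ∧ ∃ g, Hooks rs g rt dep ∧ I.IsArr s'.slow 5 (· ∈ rs) g ∧
    (∀ c ∈ rs.take i, g c = rt c) ∧
    t' + 25 * (unresolved rs g rt).card ≤ t + 1 + 45 * i + 25 * (unresolved rs g₀ rt).card ∧
    w' + (unresolved rs g rt).card ≤ w + (unresolved rs g₀ rt).card) ?_ ?_ ?_
  · exact ⟨.refl _ _, g₀, hg₀, hA, by simp, by omega, le_rfl⟩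
  · rintro i hi s₁ t₁ w₁ hiI hf₁ ⟨hfr, g, hg, hA₁, htk, ht, hw⟩
    have hc := List.getElem_mem hi
    have hRi : I.Regs s₁ := hR.frameI hf₁
    have htake : rs.take (i + 1) = rs.take i ++ [rs[i]] := by
      rw [List.take_add_one, List.getElem?_eq_getElem hi]; rfl
    have hat := (hact.frame hfr hlen) i hi
    rw [htake]
    generalize rs[i] = c at *
    have hcn := hlt c hc
    have hex : ∃ k, g^[k] (g c) = rt c := by
      obtain ⟨k, hk⟩ := hg.exists_iter _ (hg.mem c hc)
      exact ⟨k, hk.trans (hg.rt_step c hc)⟩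
    classical
    -- The least such `k` is the number of components on the chain of `c` that do not yet point to
    -- the root.
    have hk := Nat.find_spec hex
    have hkmin : ∀ j < Nat.find hex, g^[j] (g c) ≠ rt c := fun j hj => Nat.find_min hex hj
    generalize Nat.find hex = k at *
    refine wp_cons (wp_geta F (hRi.base 8 (by decide) (by decide)) hiI (by omega) hat ?_)
    refine wp_cons (wp_move F.fast ?_)
    refine wp_cons (wp_geta F (hRi.base 5 (by decide) (by decide)) rfl hcn (hA₁ c hcn hc) ?_)
    refine wp_cons (wp_call (wp_follow F (.inr rfl) (a := 5) (g := g) (D := (· ∈ rs)) (r := rt c)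
      (by decide) (by decide) (by decide) (hg.step_rt c hc) (k + 1) c _ _
      (hRi.base 5 (by decide) (by decide)) hA₁
      (fun j _ => ⟨hlt _ (hg.iter_mem j c hc), hg.iter_mem j c hc⟩) hk rfl rfl) ?_)
    rintro s₂ t₂ w₂ hf₂ - ⟨hX₂, hs₂, ht₂, rfl⟩
    have hR₂ : I.Regs s₂ := by
      refine hRi.congr (p := fun r => decide (r < 16 ∧ r ≠ 2 ∧ r ≠ 4)) (fun r hr => ?_)
      simp only [decide_eq_true_eq] at hr
      have h1 : r ≠ rC := by simp only [rC]; omega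
      have h2 : r ≠ rX := by simp only [rX]; omega
      have h4 : r ≠ rP := by simp only [rP]; omega
      have h3 : r ≠ rT := hr.2.1
      refine (hf₂ r ?_).trans (by simp [Mem.setFast, Function.update_of_ne, h1, h2, h3, h4])
      have : ∀ r < 16, r ≠ 2 → r ≠ 4 → (Prog.loop ⟨.ne, rP, rX⟩
        (block [move rX rP, get rP aHk rX])).keeps r = true := by decide
      exact this r hr.1 hr.2.1 hr.2.2
    have hC₂ : s₂.fast rC = .idx c := (hf₂ rC rfl).trans rfl
    have hs₂' : s₂.slow = s₁.slow := hs₂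
    have hA₂ : I.IsArr s₂.slow 5 (· ∈ rs) g := by rw [hs₂']; exact hA₁
    refine wp_cons (wp_geta F (hR₂.base 5 (by decide) (by decide)) hC₂ hcn (hA₂ c hcn hc) ?_)
    refine wp_cons (wp_call (compress_spec F hlt k g c _ _ _ hg hc ?_ hA₂ hk hkmin hC₂ hX₂ rfl) ?_)
    · refine hR₂.congr (p := fun r => decide (r < 16 ∧ r ≠ 2)) (fun r hr => ?_)
      simp only [decide_eq_true_eq] at hr
      have h4 : r ≠ rP := by simp only [rP]; omega
      have h3 : r ≠ rT := hr.2
      simp [Mem.setFast, Function.update_of_ne, h3, h4]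
    rintro s₃ t₃ w₃ - - ⟨g', h1, h2, h3, h4, h5, h6, h7, h8⟩
    replace h3 : I.Frame [5] s₂.slow s₃.slow := h3
    rw [hs₂'] at h3
    refine wp_nil ⟨hfr.trans h3, g', h1, h2, fun x hx => ?_, by omega, by omega⟩
    rcases List.mem_append.1 hx with hx | hx
    · exact h4 x (List.mem_of_mem_take hx) (htk x hx)
    · rw [List.mem_singleton.1 hx]; exact h5
  · rintro s₁ t₁ w₁ - ⟨h1, g, h2, h3, h4, h5, h6⟩
    rw [List.take_length] at h4
    have hcard : (unresolved rs g₀ rt).card ≤ rs.length :=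
      (Finset.card_filter_le _ _).trans (List.toFinset_card_le rs)
    exact ⟨h1, h3.mono fun c _ hc => ⟨hc, h4 c hc⟩, by omega, by omega⟩

end

end Boruvka

/-! ### Merging member lists, and shortcutting pointers. -/

namespace Boruvka

open ARAM

section
variable {K : Type}

/-- Linking the list of members of `C` to the end of the list of `X`. -/
theorem Input.Members.link {I : Input K} {sl : ℕ → Word K} {ρ ρ' : ℕ → ℕ} {C X : ℕ}
    (hC : I.Members sl ρ C) (hX : I.Members sl ρ X) (hne : C ≠ X)
    (hρ : ∀ v < I.n, ρ' v = if ρ v = C then X else ρ v) :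
    ∃ e e', e < I.n ∧ X < I.n ∧ sl (I.P 4 + X) = .idx e ∧ sl (I.P 4 + C) = .idx e' ∧
      I.Members (Function.update (Function.update sl (I.P 3 + e) (.idx C))
        (I.P 4 + X) (.idx e')) ρ' X ∧
      ∀ c, c ≠ C → c ≠ X → I.Members sl ρ c →
        I.Members (Function.update (Function.update sl (I.P 3 + e) (.idx C))
          (I.P 4 + X) (.idx e')) ρ' c := by
  obtain ⟨LC, hCch, hCnd, hCt, hCm⟩ := hC
  obtain ⟨LX, hXch, hXnd, hXt, hXm⟩ := hX
  set e := (X :: LX).getLast (List.cons_ne_nil X LX) with he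
  set e' := (C :: LC).getLast (List.cons_ne_nil C LC) with he'
  have heX : e ∈ X :: LX := List.getLast_mem _
  obtain ⟨hen, heρ⟩ := (hXm e).1 heX
  obtain ⟨hXn, -⟩ := (hXm X).1 List.mem_cons_self
  obtain ⟨hCn, -⟩ := (hCm C).1 List.mem_cons_self
  have hnxt : ∀ x, x < I.n → x ≠ e → Function.update (Function.update sl (I.P 3 + e) (.idx C))
      (I.P 4 + X) (.idx e') (I.P 3 + x) = sl (I.P 3 + x) := by
    intro x hx hxe
    rw [Function.update_of_ne fun h => absurd (Input.P_inj hx hXn h).1 (by decide),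
      Function.update_of_ne fun h => hxe (Input.P_inj hx hen h).2]
  refine ⟨e, e', hen, hXn, hXt, hCt, ?_, ?_⟩
  · refine ⟨LX ++ C :: LC, ?_, ?_, ?_, ?_⟩
    · rw [← List.cons_append, List.isChain_append]
      refine ⟨List.isChain_iff_getElem.2 fun i hi => ?_,
        List.isChain_iff_getElem.2 fun i hi => ?_, ?_⟩
      · rw [hnxt _ ((hXm _).1 (List.getElem_mem _)).1]
        · exact List.isChain_iff_getElem.1 hXch i hi
        -- The only redirected `nxt` cell is that of `e`, the last member of `X`, and by `Nodup` no
        -- link inside the list starts there.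
        · rw [he, List.getLast_eq_getElem]
          intro h
          have := hXnd.getElem_inj_iff.1 h
          omega
      · have hm := (hCm _).1 (List.getElem_mem (l := C :: LC) (n := i) (by omega))
        rw [hnxt _ hm.1]
        · exact List.isChain_iff_getElem.1 hCch i hi
        · intro h
          rw [h, heρ] at hm
          exact hne hm.2.symm
      · intro x hx y hy
        rw [List.getLast?_eq_getLast_of_ne_nil (List.cons_ne_nil X LX)] at hx
        simp only [Option.mem_def, Option.some.injEq, List.head?_cons] at hx hy
        rw [← hx, ← hy, ← he,
          Function.update_of_ne fun h => absurd (Input.P_inj hen hXn h).1 (by decide),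
          Function.update_self]
    · rw [← List.cons_append, List.nodup_append]
      refine ⟨hXnd, hCnd, fun x hx y hy hxy => hne ?_⟩
      subst hxy
      rw [← ((hXm x).1 hx).2, ((hCm x).1 hy).2]
    · rw [Function.update_self]
      congr 1
      simp [he']
    · intro v
      rw [← List.cons_append, List.mem_append, hXm, hCm, ← and_or_left]
      refine and_congr_right fun hv => ?_
      rw [hρ v hv]
      split_ifs with h
      · simp [h]
      · simp [h]
  · rintro c hcC hcX ⟨L, hch, hnd, ht, hm⟩
    obtain ⟨hcn, -⟩ := (hm c).1 List.mem_cons_self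
    refine ⟨L, List.isChain_iff_getElem.2 fun i hi => ?_, hnd, ?_, fun v => ?_⟩
    · have hmi := (hm _).1 (List.getElem_mem (l := c :: L) (n := i) (by omega))
      rw [hnxt _ hmi.1]
      · exact List.isChain_iff_getElem.1 hch i hi
      · intro h
        rw [h, heρ] at hmi
        exact hcX hmi.2.symm
    · rw [Function.update_of_ne fun h => hcX (Input.P_inj hcn hXn h).2,
        Function.update_of_ne fun h => absurd (Input.P_inj hcn hen h).1 (by decide), ht]
    · rw [hm v]
      refine and_congr_right fun hv => ?_
      rw [hρ v hv]
      split_ifs with h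
      · rw [h]; exact ⟨fun e => absurd e.symm hcC, fun e => absurd e.symm hcX⟩
      · exact Iff.rfl

theorem Input.Members.congr_root {I : Input K} {sl : ℕ → Word K} {ρ ρ' : ℕ → ℕ} {c : ℕ}
    (h : I.Members sl ρ c) (hρ : ∀ v < I.n, ρ' v = ρ v) : I.Members sl ρ' c := by
  obtain ⟨L, h1, h2, h3, h4⟩ := h
  exact ⟨L, h1, h2, h3, fun v => (h4 v).trans (and_congr_right fun hv => by rw [hρ v hv])⟩

end

section
variable {K : Type} [LinearOrder K] {M b : ℕ} {I : Input K} {Q : Mem K → ℕ → ℕ → Prop}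
  {s : Mem K} {t w : ℕ}

/-- Midway, a vertex has moved to its new root exactly if its old root has been treated. Lists are
maintained for roots that stay and for roots not yet treated. Targets `rt c` stay, so a list can be
appended to them at any time. -/
theorem merge_spec {rs : List ℕ} {rt par ρ : ℕ → ℕ} (F : I.Fits M b) (hR : I.Regs s)
    (hrs : Roots I.n ρ rs) (hact : I.Stored s.slow 8 rs) (hK : s.fast rK = .idx rs.length)
    (hA : I.IsArr s.slow 5 (· ∈ rs) rt) (hrt : ∀ c ∈ rs, rt c ∈ rs ∧ rt (rt c) = rt c)
    (hpar : I.IsArr s.slow 2 (fun _ => True) par) (hroot : ∀ c ∈ rs, par c = c)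
    (hρ : ∀ v < I.n, ρ v ∈ rs) (hmem : ∀ c ∈ rs, I.Members s.slow ρ c) :
    wp M b merge (fun s' t' w' => I.Frame [2, 3, 4, 8] s.slow s'.slow ∧
      I.IsArr s'.slow 2 (fun _ => True) (fun v => if v ∈ rs then rt v else par v) ∧
      I.Stored s'.slow 8 (rs.filter (fun c => rt c = c)) ∧
      s'.fast rK = .idx (rs.filter (fun c => rt c = c)).length ∧
      (∀ c ∈ rs, rt c = c → I.Members s'.slow (fun v => rt (ρ v)) c) ∧
      t' ≤ t + 50 * rs.length + 6 ∧ w' ≤ w + 3 * rs.length) s t w := by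
  have hlen := hrs.length_le
  have hlt : ∀ c ∈ rs, c < I.n := fun c hc => ((hrs.mem_iff c).1 hc).1
  refine wp_cons (wp_const F.fast (by positivity) ?_)
  have hR₀ : I.Regs (s.setFast rKK (.idx 0)) := by
    refine hR.congr (p := fun r => decide (r < 16)) (fun r hr => ?_)
    simp only [decide_eq_true_eq] at hr
    have h1 : r ≠ rKK := by simp only [rKK]; omega
    simp [Mem.setFast, Function.update_of_ne, h1]
  refine wp_cons (wp_forI F.fast (F.lt' (by omega)) hK hR.one (fun i s' t' w' =>
    I.Frame [2, 3, 4, 8] s.slow s'.slow ∧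
    I.IsArr s'.slow 2 (fun _ => True) (fun v => if v ∈ rs.take i then rt v else par v) ∧
    I.Stored s'.slow 8 ((rs.take i).filter (fun c => rt c = c)) ∧
    (∀ j (h : j < rs.length), i ≤ j → s'.slow (I.P 8 + j) = .idx rs[j]) ∧
    s'.fast rKK = .idx ((rs.take i).filter (fun c => rt c = c)).length ∧
    (∀ c ∈ rs, (rt c = c ∨ c ∉ rs.take i) →
      I.Members s'.slow (fun v => if ρ v ∈ rs.take i then rt (ρ v) else ρ v) c) ∧
    t' ≤ t + 2 + 50 * i ∧ w' ≤ w + 3 * i) ?_ ?_ ?_)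
  · refine ⟨.refl _ _, hpar.mono fun v _ _ => ⟨trivial, by simp⟩, ?_,
      fun j hj _ => hact j hj, rfl, fun c hc _ => ?_, by omega, by omega⟩
    · intro j hj
      simp at hj
    · exact (hmem c hc).congr_root fun v _ => by simp
  · rintro i hi s₁ t₁ w₁ hiI hf₁ ⟨hfr, hpar₁, hst, hrest, hKK, hmem₁, ht, hw⟩
    have hc := List.getElem_mem hi
    have hRi : I.Regs s₁ := hR₀.frameI hf₁
    have htake : rs.take (i + 1) = rs.take i ++ [rs[i]] := by
      rw [List.take_add_one, List.getElem?_eq_getElem hi]; rfl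
    have hnot : rs[i] ∉ rs.take i := by
      intro hm
      obtain ⟨k, hk, hki⟩ := List.mem_take_iff_getElem.1 hm
      have := hrs.nodup.getElem_inj_iff.1 hki
      omega
    have hat := hrest i hi le_rfl
    -- The compaction of `act` works in place: the write position never overtakes the read position,
    -- so the entries from `i` on are still the old ones.
    have hflen : ((rs.take i).filter (fun c => rt c = c)).length ≤ i :=
      (List.length_filter_le _ _).trans (List.length_take_le _ _)
    rw [htake]
    generalize rs[i] = c at *
    have hcn := hlt c hc
    have hA₁ := hA.frame hfr
    refine wp_cons (wp_geta F (hRi.base 8 (by decide) (by decide)) hiI (by omega) hat ?_)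
    refine wp_cons (wp_geta F (hRi.base 5 (by decide) (by decide)) rfl hcn (hA₁ c hcn hc) ?_)
    refine wp_cons (wp_cond (Test.eval_idx F.fast rfl rfl) (fun e => ?_) (fun e => ?_))
    · have hfix : rt c = c := of_decide_eq_true e
      refine wp_seq (wp_puta F (hRi.base 8 (by decide) (by decide)) hKK
        (by omega) rfl ?_)
      refine wp_incr F.fast hKK hRi.one (F.lt' (by omega)) (wp_nil ?_)
      have hfilt : (rs.take i ++ [c]).filter (fun c => rt c = c) =
          (rs.take i).filter (fun c => rt c = c) ++ [c] := by
        rw [List.filter_append]; simp [hfix]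
      have hfr₂ : I.Frame [8] s₁.slow (Function.update s₁.slow
          (I.P 8 + ((rs.take i).filter (fun c => rt c = c)).length) (.idx c)) :=
        (Input.Frame.refl _ _).store (by omega)
      rw [hfilt, List.length_append, List.length_singleton]
      refine ⟨hfr.trans hfr₂, ?_, ?_, ?_, rfl, ?_, by omega, by omega⟩
      · refine (hpar₁.frame hfr₂).mono fun v _ _ => ⟨trivial, ?_⟩
        by_cases hvc : v = c
        · subst hvc; simp [hnot, hfix, hroot v hc]
        · simp [hvc]
      · intro j hj
        rw [List.length_append, List.length_singleton] at hj
        simp only [Mem.setSlow, Mem.setFast]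
        by_cases hjl : j = ((rs.take i).filter (fun c => rt c = c)).length
        · subst hjl
          rw [Function.update_self]
          simp only [List.getElem_concat_length]
          rfl
        · have hj' : j < ((rs.take i).filter (fun c => rt c = c)).length := by omega
          rw [Function.update_of_ne (by omega), List.getElem_append_left hj']
          exact hst j hj'
      · intro j hj hij
        simp only [Mem.setSlow, Mem.setFast]
        rw [Function.update_of_ne (by omega)]
        exact hrest j hj (by omega)
      · intro x hx hxx
        refine ((hmem₁ x hx ?_).frame hfr₂).congr_root fun v _ => ?_
        · by_cases hxc : x = c
          · subst hxc; exact .inl hfix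
          · exact hxx.imp id fun h hm => h (List.mem_append_left _ hm)
        · by_cases hvc : ρ v = c
          · simp [hvc, hnot, hfix]
          · simp [hvc]
    · have hne : rt c ≠ c := of_decide_eq_false e
      have hxr := (hrt c hc).1
      have hxn := hlt _ hxr
      have hfilt : (rs.take i ++ [c]).filter (fun c => rt c = c) =
          (rs.take i).filter (fun c => rt c = c) := by
        rw [List.filter_append]; simp [hne]
      have hfr₂ : I.Frame [2] s₁.slow (Function.update s₁.slow (I.P 2 + c) (.idx (rt c))) :=
        (Input.Frame.refl _ _).store hcn
      obtain ⟨e, e', hen, -, hX, hC, hmX, hmo⟩ :=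
        ((hmem₁ c hc (.inr hnot)).frame hfr₂).link
          (ρ' := fun v => if ρ v ∈ rs.take i ++ [c] then rt (ρ v) else ρ v)
          ((hmem₁ (rt c) hxr (.inl (hrt c hc).2)).frame hfr₂) (Ne.symm hne) (by
            intro v hv
            by_cases hvc : ρ v = c
            · rw [if_pos (by simp [hvc]), if_pos (by simp [hvc, hnot]), hvc]
            · by_cases hvi : ρ v ∈ rs.take i
              -- A vertex that has moved lies in a component that stays a root, and `c` does not
              -- stay.
              · rw [if_pos (List.mem_append_left _ hvi), if_pos hvi, if_neg]
                intro h
                apply hne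
                rw [← h, (hrt _ (hρ v hv)).2]
              · rw [if_neg (by simp [hvi, hvc]), if_neg hvi, if_neg hvc])
      have hfr₃ : I.Frame [2, 3, 4] s₁.slow (Function.update (Function.update (Function.update
          s₁.slow (I.P 2 + c) (.idx (rt c))) (I.P 3 + e) (.idx c)) (I.P 4 + rt c) (.idx e')) :=
        (((Input.Frame.refl _ _).store hcn).store hen).store hxn
      refine wp_cons (wp_puta F (hRi.base 2 (by decide) (by decide)) rfl hcn rfl ?_)
      refine wp_cons (wp_geta F (hRi.base 4 (by decide) (by decide)) rfl hxn hX ?_)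
      refine wp_cons (wp_puta F (hRi.base 3 (by decide) (by decide)) rfl hen rfl ?_)
      refine wp_cons (wp_geta F (hRi.base 4 (by decide) (by decide)) rfl hcn (x := .idx e') ?_ ?_)
      · refine Eq.trans (Function.update_of_ne (fun h => ?_) _ _) hC
        exact absurd (Input.P_inj hcn hen h).1 (by decide)
      refine wp_cons (wp_puta F (hRi.base 4 (by decide) (by decide)) rfl hxn rfl ?_)
      rw [hfilt]
      refine wp_nil (wp_nil ⟨hfr.trans hfr₃, ?_, ?_, ?_, hKK, ?_, by omega, by omega⟩)
      · refine ((((hpar₁.store hcn).store_ne (a' := 3) hen).store_ne (a' := 4) hxn)).mono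
          fun v _ _ => ⟨.inl trivial, ?_⟩
        by_cases hvc : v = c
        · subst hvc; simp
        · simp [hvc]
      · exact hst.frame hfr₃ (by omega)
      · intro j hj hij
        exact (hfr₃.read (by omega)).trans (hrest j hj (by omega))
      · intro x hx hxx
        by_cases hxc : x = c
        · subst hxc
          exact absurd hxx (by simp [hne])
        · by_cases hxX : x = rt c
          · subst hxX; exact hmX
          · refine hmo x hxc hxX ((hmem₁ x hx ?_).frame hfr₂)
            exact hxx.imp id fun h hm => h (List.mem_append_left _ hm)
  · rintro s₁ t₁ w₁ hf₁ ⟨h1, h2, h3, -, h5, h6, h7, h8⟩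
    rw [List.take_length] at h2 h3 h5 h6
    refine wp_cons (wp_move F.fast (wp_nil ⟨h1, h2, h3, h5, ?_, by omega, h8⟩))
    intro c hc e
    exact (h6 c hc (.inl e)).congr_root fun v hv => by rw [if_pos (hρ v hv)]

/-- Pointers are overwritten while later searches use them. By `Forest.shortcut` every intermediate
structure has the same roots and no greater depth. The same argument serves `shortcutPhaseOne_spec`.
-/
theorem shortcutAll_spec {par ρ : ℕ → ℕ} {D : ℕ} (F : I.Fits M b) (hR : I.Regs s)
    (hA : I.IsArr s.slow 2 (fun _ => True) par) (hF : Forest I.n par ρ D) :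
    wp M b shortcutAll (fun s' t' w' => I.Frame [2] s.slow s'.slow ∧
      I.IsArr s'.slow 2 (fun _ => True) ρ ∧ t' ≤ t + (10 * D + 20) * I.n + 3 ∧ w' = w + I.n)
      s t w := by
  refine wp_forI F.fast (F.lt' (by omega)) hR.n hR.one (fun i s' t' w' =>
    I.Frame [2] s.slow s'.slow ∧
    I.IsArr s'.slow 2 (fun _ => True) (fun v => if v < i then ρ v else par v) ∧
    t' ≤ t + 1 + (10 * D + 20) * i ∧ w' = w + i) ?_ ?_ ?_
  · exact ⟨.refl _ _, hA.mono fun v _ _ => ⟨trivial, by simp⟩, by omega, rfl⟩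
  · rintro i hi s₁ t₁ w₁ hiI hf₁ ⟨hfr, hA₁, ht, hw⟩
    have hRi : I.Regs s₁ := hR.frameI hf₁
    have hFi := hF.shortcut (par' := fun v => if v < i then ρ v else par v)
      fun v _ => by split_ifs <;> simp
    refine wp_cons (wp_move F.fast ?_)
    have hRi' : I.Regs (s₁.setFast rX (s₁.fast rI)) := by
      refine hRi.congr (p := fun r => decide (r < 16)) (fun r hr => ?_)
      simp only [decide_eq_true_eq] at hr
      have h1 : r ≠ rX := by simp only [rX]; omega
      simp [Mem.setFast, Function.update_of_ne, h1]
    refine wp_cons (wp_call (findX_spec F hRi' hA₁ hFi hiI hi) ?_)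
    rintro s₂ t₂ w₂ hf₂ hs₂ ⟨hX, ht₂, rfl⟩
    replace hs₂ : s₂.slow = s₁.slow := hs₂ rfl
    have hR₂ : I.Regs s₂ := hRi'.frame hf₂
    have hI₂ : s₂.fast rI = .idx i := (hf₂ rI rfl).trans hiI
    have hA₂ : I.IsArr s₂.slow 2 (fun _ => True) (fun v => if v < i then ρ v else par v) :=
      hs₂ ▸ hA₁
    refine wp_cons (wp_puta F (hR₂.base 2 (by decide) (by decide)) hI₂ hi hX (wp_nil ?_))
    refine ⟨(hs₂ ▸ hfr : I.Frame [2] s.slow s₂.slow).store hi, ?_, by rw [Nat.mul_succ]; omega,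
      by omega⟩
    refine (hA₂.store hi).mono fun v _ _ => ⟨.inl trivial, ?_⟩
    by_cases hv : v = i
    · subst hv; simp
    · have : v < i + 1 ↔ v < i := by omega
      simp [hv, this]
  · rintro s₁ t₁ w₁ - ⟨h1, h2, h3, h4⟩
    exact ⟨h1, h2.mono fun v hv _ => ⟨trivial, by simp [hv]⟩, by omega, h4⟩

theorem shortcutPhaseOne_spec {par ρ : ℕ → ℕ} {ps : List ℕ} {D : ℕ} (F : I.Fits M b)
    (hR : I.Regs s) (hA : I.IsArr s.slow 2 (fun _ => True) par) (hF : Forest I.n par ρ D)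
    (hps : I.Stored s.slow 9 ps) (hlen : ps.length ≤ I.n) (hlt : ∀ c ∈ ps, c < I.n)
    (hK : s.fast rK1 = .idx ps.length) :
    wp M b shortcutPhaseOne (fun s' t' w' => I.Frame [2] s.slow s'.slow ∧
      I.IsArr s'.slow 2 (fun _ => True) (fun v => if v ∈ ps then ρ v else par v) ∧
      t' ≤ t + (10 * D + 30) * ps.length + 3 ∧ w' = w + ps.length) s t w := by
  refine wp_forI F.fast (F.lt' (by omega)) hK hR.one (fun i s' t' w' =>
    I.Frame [2] s.slow s'.slow ∧
    I.IsArr s'.slow 2 (fun _ => True) (fun v => if v ∈ ps.take i then ρ v else par v) ∧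
    t' ≤ t + 1 + (10 * D + 30) * i ∧ w' = w + i) ?_ ?_ ?_
  · exact ⟨.refl _ _, hA.mono fun v _ _ => ⟨trivial, by simp⟩, by omega, rfl⟩
  · rintro i hi s₁ t₁ w₁ hiI hf₁ ⟨hfr, hA₁, ht, hw⟩
    have hRi : I.Regs s₁ := hR.frameI hf₁
    have hFi := hF.shortcut (par' := fun v => if v ∈ ps.take i then ρ v else par v)
      fun v _ => by split_ifs <;> simp
    have hat := (hps.frame hfr hlen) i hi
    have hcn := hlt _ (List.getElem_mem hi)
    have htake : ps.take (i + 1) = ps.take i ++ [ps[i]] := by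
      rw [List.take_add_one, List.getElem?_eq_getElem hi]; rfl
    rw [htake]
    generalize ps[i] = c at *
    refine wp_cons (wp_geta F (hRi.base 9 (by decide) (by decide)) hiI (by omega) hat ?_)
    refine wp_cons (wp_move F.fast ?_)
    have hRi' : I.Regs (((s₁.setFast rT (.idx (I.P 9 + i))).setFast rC (.idx c)).setFast rX
        (((s₁.setFast rT (.idx (I.P 9 + i))).setFast rC (.idx c)).fast rC)) := by
      refine hRi.congr (p := fun r => decide (r < 16 ∧ r ≠ 2)) (fun r hr => ?_)
      simp only [decide_eq_true_eq] at hr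
      have h1 : r ≠ rC := by simp only [rC]; omega
      have h4 : r ≠ rX := by simp only [rX]; omega
      have h3 : r ≠ rT := hr.2
      simp [Mem.setFast, Function.update_of_ne, h1, h3, h4]
    refine wp_cons (wp_call (findX_spec F hRi' hA₁ hFi rfl hcn) ?_)
    rintro s₂ t₂ w₂ hf₂ hs₂ ⟨hX, ht₂, rfl⟩
    replace hs₂ : s₂.slow = s₁.slow := hs₂ rfl
    have hR₂ : I.Regs s₂ := hRi'.frame hf₂
    have hC₂ : s₂.fast rC = .idx c := (hf₂ rC rfl).trans rfl
    have hA₂ : I.IsArr s₂.slow 2 (fun _ => True) (fun v => if v ∈ ps.take i then ρ v else par v) :=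
      hs₂ ▸ hA₁
    refine wp_cons (wp_puta F (hR₂.base 2 (by decide) (by decide)) hC₂ hcn hX (wp_nil ?_))
    refine ⟨(hs₂ ▸ hfr : I.Frame [2] s.slow s₂.slow).store hcn, ?_,
      by rw [Nat.mul_succ]; omega, by omega⟩
    refine (hA₂.store hcn).mono fun v _ _ => ⟨.inl trivial, ?_⟩
    by_cases hv : v = c
    · subst hv; simp
    · simp [hv]
  · rintro s₁ t₁ w₁ - ⟨h1, h2, h3, h4⟩
    rw [List.take_length] at h2
    exact ⟨h1, h2, by omega, h4⟩

theorem savePhaseOne_spec {rs : List ℕ} (F : I.Fits M b) (hR : I.Regs s)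
    (hact : I.Stored s.slow 8 rs) (hlen : rs.length ≤ I.n) (hK : s.fast rK = .idx rs.length) :
    wp M b savePhaseOne (fun s' t' w' => I.Frame [9] s.slow s'.slow ∧ I.Stored s'.slow 9 rs ∧
      s'.fast rK1 = .idx rs.length ∧ t' ≤ t + 16 * rs.length + 5 ∧ w' = w + rs.length) s t w := by
  refine wp_seq (wp_move F.fast ?_)
  have hR₀ : I.Regs (s.setFast rK1 (s.fast rK)) := by
    refine hR.congr (p := fun r => decide (r < 16)) (fun r hr => ?_)
    simp only [decide_eq_true_eq] at hr
    have h1 : r ≠ rK1 := by simp only [rK1]; omega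
    simp [Mem.setFast, Function.update_of_ne, h1]
  refine wp_forI F.fast (F.lt' (by omega)) hK hR.one (fun i s' t' w' =>
    I.Frame [9] s.slow s'.slow ∧ (∀ j (h : j < rs.length), j < i →
      s'.slow (I.P 9 + j) = .idx rs[j]) ∧ t' ≤ t + 3 + 16 * i ∧ w' = w + i) ?_ ?_ ?_
  · exact ⟨.refl _ _, fun j _ hj => absurd hj (by omega), by omega, rfl⟩
  · rintro i hi s₁ t₁ w₁ hiI hf₁ ⟨hfr, hst, ht, hw⟩
    have hRi : I.Regs s₁ := hR₀.frameI hf₁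
    have hat := (hact.frame hfr hlen) i hi
    refine wp_cons (wp_geta F (hRi.base 8 (by decide) (by decide)) hiI (by omega) hat ?_)
    refine wp_cons (wp_puta F (hRi.base 9 (by decide) (by decide)) hiI (by omega) rfl (wp_nil ?_))
    refine ⟨hfr.store (by omega), fun j hj hji => ?_, by omega, by omega⟩
    simp only [Mem.setSlow, Mem.setFast]
    by_cases e : j = i
    · subst e
      rw [Function.update_self]
      rfl
    · rw [Function.update_of_ne (by omega)]
      exact hst j hj (by omega)
  · rintro s₁ t₁ w₁ hf₁ ⟨h1, h2, h3, h4⟩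
    exact ⟨h1, fun j hj => h2 j hj hj, (hf₁ rK1 (by decide) rfl).trans hK, by omega, h4⟩

end

-- The state between rounds, one round, and the setup.

end Boruvka

namespace Boruvka

open ARAM

variable {K : Type}

/-- The adjacency arrays describe a connected undirected weighted graph. -/
structure Input.Connected (I : Input K) : Prop where
  symm : ∀ v < I.n, ∀ j, I.IsSlot v j →
    ∃ j', I.IsSlot (I.nb j) j' ∧ I.nb j' = v ∧ I.wj j' = I.wj j
  exists_slot : ∀ p : ℕ → Prop, (∃ v < I.n, p v) → (∃ v < I.n, ¬ p v) →
    ∃ v < I.n, ∃ j, I.IsSlot v j ∧ p v ∧ ¬ p (I.nb j)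

/-- The memory between two rounds: the pointers `par` have depth `D` and lead to the roots given by
`ρ`, which are listed in `rs`, and the edges `l` have been output. -/
structure Input.State (I : Input K) (ρ par : ℕ → ℕ) (D : ℕ) (rs : List ℕ) (l : List (ℕ × ℕ))
    (s : Mem K) : Prop where
  regs : I.Regs s
  inp : I.Inp s.slow
  ptr : I.IsArr s.slow 2 (fun _ => True) par
  forest : Forest I.n par ρ D
  roots : Roots I.n ρ rs
  act : I.Stored s.slow 8 rs
  numComp : s.fast rK = .idx rs.length
  members : ∀ c ∈ rs, I.Members s.slow ρ c
  out : I.Out s.slow l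
  outAddr : s.fast rOut = .idx (I.P 0 + 2 * l.length)
  card : l.length + rs.length = I.n

theorem length_newEdges_add {h bu bv : ℕ → ℕ} {rs : List ℕ} :
    (newEdges h bu bv rs).length + (rs.filter (fun c => hookTo h c = c)).length = rs.length := by
  have h2 := List.length_eq_length_filter_add (l := rs) (fun c => decide (hookTo h c = c))
  have h3 : (newEdges h bu bv rs).length =
      (rs.filter (fun c => !decide (hookTo h c = c))).length := by
    rw [newEdges, List.length_map]; congr 2; funext c; simp
  omega

theorem Input.CompSlot.lt {I : Input K} (hV : I.Valid) {ρ : ℕ → ℕ} {c j : ℕ}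
    (h : I.CompSlot ρ c j) : j < I.S := by
  obtain ⟨v, hv, -, hs⟩ := h
  exact hs.2.trans_le (hV.off_le_S hv)

variable [LinearOrder K]

/-- What a round does: the component `c` selects the edge from `bu c` to `bv c`, which leads to the
component `h c`, and `rt` maps the old roots to the new ones. -/
structure Input.Merging (I : Input K) (ρ : ℕ → ℕ) (rs : List ℕ) (h bu bv rt dep : ℕ → ℕ) :
    Prop where
  sel : ∀ c ∈ rs, ∃ j, I.Selects ρ c j (bu c) ∧ bv c = I.nb j ∧ h c = ρ (bv c)
  ne : ∀ c ∈ rs, h c ≠ c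
  hooks : Hooks rs (hookTo h) rt dep

variable {M b : ℕ} {I : Input K} {Q : Mem K → ℕ → ℕ → Prop} {s : Mem K} {t w : ℕ}

theorem Input.Merging.filter_eq {ρ : ℕ → ℕ} {rs : List ℕ} {h bu bv rt dep : ℕ → ℕ}
    (hm : I.Merging ρ rs h bu bv rt dep) :
    rs.filter (fun c => rt c = c) = rs.filter (fun c => hookTo h c = c) := by
  refine List.filter_congr fun c hc => ?_
  rw [decide_eq_decide]
  refine ⟨fun e => ?_, hm.hooks.rt_fixed c hc⟩
  have := hm.hooks.step_rt c hc
  rwa [e] at this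

/-- Per component, `select` writes 3 words, `hook` at most 2, `resolve` at most 1 on average and
`merge` at most 3, which gives the factor 9. The old roots gain one more pointer, hence the depth `D
+ 1`. -/
theorem round_spec {ρ par : ℕ → ℕ} {D : ℕ} {rs : List ℕ} {l : List (ℕ × ℕ)} (F : I.Fits M b)
    (hV : I.Valid) (hG : I.Connected) (hS : I.State ρ par D rs l s) (hrs : 2 ≤ rs.length) :
    wp M b round (fun s' t' w' => ∃ h bu bv rt dep : ℕ → ℕ, I.Merging ρ rs h bu bv rt dep ∧
      I.State (fun v => rt (ρ v)) (fun v => if v ∈ rs then rt v else par v) (D + 1)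
        (rs.filter (fun c => rt c = c)) (l ++ newEdges h bu bv rs) s' ∧
      I.Frame [0, 1, 2, 3, 4, 5, 6, 7, 8] s.slow s'.slow ∧
      2 * (rs.filter (fun c => rt c = c)).length ≤ rs.length ∧
      0 < (rs.filter (fun c => rt c = c)).length ∧
      t' ≤ t + (10 * D + 45) * I.S + 240 * I.n + 15 ∧ w' ≤ w + 9 * rs.length) s t w := by
  have hlen := hS.roots.length_le
  have hlt : ∀ c ∈ rs, c < I.n := fun c hc => ((hS.roots.mem_iff c).1 hc).1
  have hρc : ∀ c ∈ rs, ρ c = c := fun c hc => ((hS.roots.mem_iff c).1 hc).2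
  have hρ : ∀ v < I.n, ρ v ∈ rs := fun v hv =>
    (hS.roots.mem_iff _).2 ⟨hS.forest.root_lt hv, hS.forest.root_root hv⟩
  have hex : ∀ c ∈ rs, ∃ j, I.CompSlot ρ c j ∧ ρ (I.nb j) ≠ c := by
    intro c hc
    obtain ⟨d, hd, hdc⟩ : ∃ d ∈ rs, d ≠ c := by
      by_contra! hall
      have := (List.subperm_of_subset hS.roots.nodup (l₂ := [c])
        fun d hd => List.mem_singleton.2 (hall d hd)).length_le
      simp only [List.length_singleton] at this
      omega
    obtain ⟨v, hv, j, hj, h1, h2⟩ := hG.exists_slot (fun v => ρ v = c)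
      ⟨c, hlt c hc, hρc c hc⟩ ⟨d, hlt d hd, by rwa [hρc d hd]⟩
    exact ⟨j, ⟨v, hv, h1, hj⟩, h2⟩
  refine wp_cons (wp_call (select_spec F hV hS.regs hS.inp hS.ptr hS.forest hS.roots hS.act
    hS.members hS.numComp hex) ?_)
  rintro s₁ t₁ w₁ hf₁ - ⟨hfr₁, hsel, ht₁, rfl⟩
  choose! sj bu hsel using hsel
  set bv : ℕ → ℕ := fun c => I.nb (sj c) with hbv
  set h : ℕ → ℕ := fun c => ρ (bv c) with hh
  have hslot : ∀ c ∈ rs, sj c < I.S := fun c hc => (hsel c hc).1.best.mem.lt hV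
  have hmem : ∀ c ∈ rs, h c ∈ rs := fun c hc => hρ _ (hV.nb_lt _ (hslot c hc))
  have hne : ∀ c ∈ rs, h c ≠ c := fun c hc => (hsel c hc).1.best.ne
  -- The edge selected by `c` also occupies a slot of `h c`, where it leads back to `c`. The choice
  -- of `h c` is at least as good as that slot, in weight and then in target.
  have hW : ∀ c ∈ rs, I.wj (sj (h c)) < I.wj (sj c) ∨
      I.wj (sj (h c)) = I.wj (sj c) ∧ h (h c) ≤ c := by
    intro c hc
    obtain ⟨hb, hbn, hbr, hbs⟩ := (hsel c hc).1
    obtain ⟨j', h1, h2, h3⟩ := hG.symm _ hbn _ hbs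
    have := (hsel _ (hmem c hc)).1.best.le j' ⟨_, hV.nb_lt _ (hslot c hc), rfl, h1⟩
      (by rw [h2, hbr]; exact (hne c hc).symm)
    rwa [h3, h2, hbr] at this
  obtain ⟨rt, dep, hhooks⟩ := hookTo_hooks (W := fun c => I.wj (sj c)) hmem hW
  have hM : I.Merging ρ rs h bu bv rt dep :=
    ⟨fun c hc => ⟨sj c, (hsel c hc).1, rfl, rfl⟩, hne, hhooks⟩
  have hR₁ : I.Regs s₁ := hS.regs.frame hf₁
  have hll : l.length + (newEdges h bu bv rs).length ≤ I.n := by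
    have := length_newEdges_add (h := h) (bu := bu) (bv := bv) (rs := rs)
    have := hS.card
    omega
  have hcard := hS.card
  refine wp_cons (wp_call (hook_spec F hR₁ hS.roots.nodup hlt (hS.act.frame hfr₁ hlen) hlen
    ((hf₁ rK rfl).trans hS.numComp) (h := h) (bu := bu) (bv := bv)
    (fun c _ hc => (hsel c hc).2.1) (fun c _ hc => (hsel c hc).2.2.1)
    (fun c _ hc => (hsel c hc).2.2.2) hmem hne (hS.out.frame hfr₁ (by omega)) hll
    ((hf₁ rOut rfl).trans hS.outAddr)) ?_)
  rintro s₂ t₂ w₂ hf₂ - ⟨hfr₂, hA₂, hO₂, hr₂, ht₂, hw₂⟩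
  have hR₂ : I.Regs s₂ := hR₁.frame hf₂
  have hK₂ : s₂.fast rK = .idx rs.length := (hf₂ rK rfl).trans ((hf₁ rK rfl).trans hS.numComp)
  have hfr12 : I.Frame [0, 1, 5, 6, 7] s.slow s₂.slow := hfr₁.trans hfr₂
  refine wp_cons (wp_call (resolve_spec F hR₂ hlt (hS.act.frame hfr12 hlen) hlen hK₂ hA₂
    hhooks) ?_)
  rintro s₃ t₃ w₃ hf₃ - ⟨hfr₃, hA₃, ht₃, hw₃⟩
  have hR₃ : I.Regs s₃ := hR₂.frame hf₃
  have hK₃ : s₃.fast rK = .idx rs.length := (hf₃ rK rfl).trans hK₂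
  have hfr13 : I.Frame [0, 1, 5, 6, 7] s.slow s₃.slow := hfr12.trans hfr₃
  refine wp_cons (wp_call (merge_spec F hR₃ hS.roots (hS.act.frame hfr13 hlen) hK₃ hA₃
    (fun c hc => ⟨hhooks.rt_mem c hc, hhooks.rt_rt hc⟩) (hS.ptr.frame hfr13)
    (fun c hc => (hS.forest.fixed_iff (hlt c hc)).2 (hρc c hc)) hρ
    (fun c hc => (hS.members c hc).frame hfr13)) ?_)
  rintro s₄ t₄ w₄ hf₄ - ⟨hfr₄, hpar₄, hact₄, hK₄, hmem₄, ht₄, hw₄⟩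
  have hfr14 : I.Frame [0, 1, 2, 3, 4, 5, 6, 7, 8] s.slow s₄.slow := hfr13.trans hfr₄
  have hhalf := two_mul_length_fixed_le hS.roots.nodup hmem hne
  have hnew := length_newEdges_add (h := h) (bu := bu) (bv := bv) (rs := rs)
  rw [← hM.filter_eq] at hhalf hnew
  refine wp_nil ⟨h, bu, bv, rt, dep, hM, ⟨hR₃.frame hf₄, hfr14.inp hS.inp, hpar₄, ?_, ?_, hact₄,
    hK₄, ?_, ?_, ?_, ?_⟩, hfr14, hhalf, ?_, by omega, by omega⟩
  · refine hS.forest.merge (fun c hc e => ?_) fun v hv => ?_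
    · have hc' := (hS.roots.mem_iff c).2 ⟨hc, e⟩
      exact ⟨hlt _ (hhooks.rt_mem c hc'), hρc _ (hhooks.rt_mem c hc'), hhooks.rt_rt hc'⟩
    · have : v ∈ rs ↔ ρ v = v := by rw [hS.roots.mem_iff]; simp [hv]
      simp only [this]
  · refine ⟨hS.roots.nodup.filter _, fun c => ?_⟩
    rw [List.mem_filter, decide_eq_true_eq]
    constructor
    · rintro ⟨h1, h2⟩
      exact ⟨hlt c h1, by rw [hρc c h1, h2]⟩
    · rintro ⟨h1, h2⟩
      have hc' : c ∈ rs := by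
        have := hhooks.rt_mem _ (hρ c h1)
        rwa [h2] at this
      rw [hρc c hc'] at h2
      exact ⟨hc', h2⟩
  · intro c hc
    rw [List.mem_filter, decide_eq_true_eq] at hc
    exact hmem₄ c hc.1 hc.2
  · have : I.Frame [2, 3, 4, 5, 8] s₂.slow s₄.slow := hfr₃.trans hfr₄
    exact hO₂.frame this (by rw [List.length_append]; exact hll)
  · exact (hf₄ _ rfl).trans ((hf₃ _ rfl).trans hr₂)
  · rw [List.length_append]; omega
  · obtain ⟨c, hc⟩ := List.exists_mem_of_length_pos (l := rs) (by omega)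
    exact List.length_pos_of_mem (List.mem_filter.2 ⟨hhooks.rt_mem c hc, by
      simpa using hhooks.rt_rt hc⟩)

/-- The loop keeps `p = 2 ^ y`. The last doubling starts below `N`, so `2 * N` has to fit in a word.
-/
theorem ceilLog_spec {y p x N : ℕ} (hM : 35 ≤ M) (hone : s.fast rOne = .idx 1)
    (hx : s.fast x = .idx N) (hN : 2 * N < 2 ^ b) (hb : 1 < 2 ^ b)
    (hy : y < 35 := by decide) (hp : p < 35 := by decide) (hx' : x < 35 := by decide)
    (hyp : y ≠ p := by decide) (hyx : y ≠ x := by decide) (hpx : p ≠ x := by decide)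
    (hy1 : y ≠ rOne := by decide) (hp1 : p ≠ rOne := by decide) :
    wp M b (ceilLog y p x) (fun s' t' w' => s'.fast y = .idx (Nat.clog 2 N) ∧
      s'.slow = s.slow ∧ t' ≤ t + 8 * Nat.clog 2 N + 4 ∧ w' = w) s t w := by
  refine wp_cons (wp_const hM (by omega) (wp_cons (wp_const hM hb (wp_cons ?_))))
  suffices H : ∀ d i s₁ t₁, i + d = Nat.clog 2 N → s₁.fast y = .idx i →
      s₁.fast p = .idx (2 ^ i) → s₁.fast x = .idx N → s₁.fast rOne = .idx 1 →
      wp M b (.loop ⟨.lt, p, x⟩ (block [add p p p, incr y])) (fun s' t' w' =>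
        s'.fast y = .idx (Nat.clog 2 N) ∧ s'.slow = s₁.slow ∧ t' ≤ t₁ + 8 * d + 2 ∧ w' = w)
        s₁ t₁ w by
    refine wp_call (H (Nat.clog 2 N) 0 _ _ (by omega) ?_ (by simp [Mem.setFast]) ?_ ?_) ?_
    · simp [Mem.setFast, Function.update_of_ne, hyp]
    · simpa [Mem.setFast, Function.update_of_ne, hyx.symm, hpx.symm] using hx
    · simpa [Mem.setFast, Function.update_of_ne, hy1.symm, hp1.symm] using hone
    · rintro s' t' w' - - ⟨h1, h2, h3, h4⟩
      exact wp_nil ⟨h1, h2, by omega, h4⟩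
  intro d
  induction d with
  | zero =>
    intro i s₁ t₁ hd hy₁ hp₁ hx₁ h1
    refine wp_loop (Test.eval_idx hM hp₁ hx₁ hp hx') (fun e => ?_)
      (fun _ => ⟨by rw [hy₁, ← hd, add_zero], rfl, by omega, rfl⟩)
    have : 2 ^ i < N := of_decide_eq_true e
    have := Nat.le_pow_clog (b := 2) (by decide) N
    rw [← hd, add_zero] at this
    omega
  | succ d ih =>
    intro i s₁ t₁ hd hy₁ hp₁ hx₁ h1
    have hlt : 2 ^ i < N := by
      by_contra h
      have := (Nat.clog_le_iff_le_pow (b := 2) (x := N) (y := i) (by decide)).2 (by omega)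
      omega
    refine wp_loop (Test.eval_idx hM hp₁ hx₁ hp hx') (fun _ => ?_)
      (fun e => absurd hlt (of_decide_eq_false e))
    have hi : i < 2 ^ i := Nat.lt_two_pow_self
    refine wp_cons (wp_add hM hp₁ hp₁ (by omega) ?_)
    refine wp_cons (wp_incr hM (k := i) ?_ ?_ (by omega) (wp_nil ?_))
    · simpa [Mem.setFast, Function.update_of_ne, hyp] using hy₁
    · simpa [Mem.setFast, Function.update_of_ne, hp1.symm] using h1
    refine wp_call (ih (i + 1) _ _ (by omega) ?_ ?_ ?_ ?_) ?_
    · simp [Mem.setFast]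
    · simp [Mem.setFast, Function.update_of_ne, hyp.symm, pow_succ, Nat.mul_two]
    · simpa [Mem.setFast, Function.update_of_ne, hyx.symm, hpx.symm] using hx₁
    · simpa [Mem.setFast, Function.update_of_ne, hy1.symm, hp1.symm] using h1
    rintro s' t' w' - - ⟨h1, h2, h3, h4⟩
    exact ⟨h1, h2, by omega, h4⟩

/-- The inner rounding does no harm for `n ≥ 2`: a number is at most a power of two with natural
exponent exactly if its ceiling is, so this is `⌈log₂ log₂ n⌉`. -/
theorem computeRounds_spec (F : I.Fits M b) (hR : I.Regs s) (hn : 0 < I.n) :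
    wp M b computeRounds (fun s' t' w' => s'.fast rR = .idx (Nat.clog 2 (Nat.clog 2 I.n)) ∧
      s'.slow = s.slow ∧ t' ≤ t + 16 * I.n + 8 ∧ w' = w) s t w := by
  have hclog : ∀ N : ℕ, Nat.clog 2 N ≤ N := fun N =>
    (Nat.clog_le_iff_le_pow (by decide)).2 Nat.lt_two_pow_self.le
  have h1 := hclog I.n
  have h2 := hclog (Nat.clog 2 I.n)
  refine wp_cons (wp_call (ceilLog_spec F.fast hR.one hR.n (F.lt' (by omega))
    (F.lt' (by omega))) ?_)
  rintro s₁ t₁ w₁ hf₁ - ⟨hX, hs₁, ht₁, rfl⟩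
  refine wp_cons (wp_call (ceilLog_spec F.fast ((hf₁ rOne rfl).trans hR.one) hX
    (F.lt' (by omega)) (F.lt' (by omega))) ?_)
  rintro s₂ t₂ w₂ hf₂ - ⟨hX₂, hs₂, ht₂, rfl⟩
  exact wp_nil ⟨hX₂, hs₂.trans hs₁, by omega, rfl⟩

theorem setup_spec (F : I.Fits M b) (h0 : s.slow 0 = .idx I.n) (hI : I.Inp s.slow)
    (hS : I.off I.n = I.S) :
    wp M b setup (fun s' t' w' => I.State id id 0 (List.range I.n) [] s' ∧
      t' ≤ t + 20 * I.n + 100 ∧ w' = w + 3 * I.n) s t w := by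
  have hF := F.slow
  refine wp_cons (wp_const F.fast (by omega) ?_)
  refine wp_cons (wp_const F.fast (by omega) ?_)
  refine wp_cons (wp_load F.fast rfl h0 ?_)
  refine wp_cons (wp_const F.fast (by omega) ?_)
  refine wp_cons (wp_get F.fast rfl rfl (by omega) (hI.off I.n le_rfl) ?_)
  rw [hS]
  refine wp_cons (wp_add F.fast rfl rfl (by omega) ?_)
  refine wp_cons (wp_incr F.fast rfl rfl (by omega) ?_)
  refine wp_cons (wp_add F.fast rfl rfl (by omega) ?_)
  refine wp_cons (wp_add F.fast rfl rfl (by omega) ?_)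
  refine wp_cons (wp_add F.fast rfl rfl (by omega) ?_)
  refine wp_cons (wp_add F.fast rfl rfl (by omega) ?_)
  refine wp_cons (wp_add F.fast rfl rfl (by omega) ?_)
  refine wp_cons (wp_add F.fast rfl rfl (by omega) ?_)
  refine wp_cons (wp_add F.fast rfl rfl (by omega) ?_)
  refine wp_cons (wp_add F.fast rfl rfl (by omega) ?_)
  refine wp_cons (wp_add F.fast rfl rfl (by omega) ?_)
  refine wp_cons (wp_add F.fast rfl rfl (by omega) ?_)
  refine wp_cons (wp_add F.fast rfl rfl (by omega) ?_)
  refine wp_cons (wp_move F.fast ?_)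
  refine wp_cons ?_
  generalize hs₁ : Mem.setFast _ rK _ = s₁
  have hR₁ : I.Regs s₁ := by
    subst hs₁
    refine ⟨rfl, rfl, rfl, rfl, rfl, rfl, fun a h2 ha => ?_⟩
    interval_cases a <;> (refine congrArg Word.idx ?_; simp only [Input.P]; omega)
  have hK₁ : s₁.fast rK = .idx I.n := by subst hs₁; rfl
  have hOut₁ : s₁.fast rOut = .idx (I.P 0) := by
    subst hs₁
    refine congrArg Word.idx ?_
    simp only [Input.P]; omega
  have hsl₁ : s₁.slow = s.slow := by subst hs₁; rfl
  clear hs₁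
  refine wp_forI F.fast (F.lt' (by omega)) hR₁.n hR₁.one (fun i s' t' w' =>
    I.Frame [2, 4, 8] s₁.slow s'.slow ∧ I.IsArr s'.slow 2 (· < i) id ∧
    I.IsArr s'.slow 4 (· < i) id ∧ I.IsArr s'.slow 8 (· < i) id ∧
    t' ≤ t + 71 + 20 * i ∧ w' = w + 3 * i) ?_ ?_ ?_
  · exact ⟨.refl _ _, fun i _ h => absurd h (by omega), fun i _ h => absurd h (by omega),
      fun i _ h => absurd h (by omega), by omega, rfl⟩
  · rintro i hi s₂ t₂ w₂ hiI hf₂ ⟨hfr, h2, h4, h8, ht, hw⟩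
    have hRi : I.Regs s₂ := hR₁.frameI hf₂
    refine wp_cons (wp_puta F (hRi.base 2 (by decide) (by decide)) hiI hi hiI ?_)
    refine wp_cons (wp_puta F (hRi.base 4 (by decide) (by decide)) hiI hi hiI ?_)
    refine wp_cons (wp_puta F (hRi.base 8 (by decide) (by decide)) hiI hi hiI (wp_nil ?_))
    have hup : ∀ j, (j < i ∨ j = i → Function.update id i i j = id j) := fun j _ => by
      by_cases e : j = i
      · subst e; simp
      · simp [e]
    refine ⟨((hfr.store hi).store hi).store hi, ?_, ?_, ?_, by omega, by omega⟩
    · exact (((h2.store hi).store_ne (a' := 4) hi).store_ne (a' := 8) hi).mono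
        fun j _ hj => ⟨by omega, hup j (by omega)⟩
    · exact (((h4.store_ne (a' := 2) hi).store hi).store_ne (a' := 8) hi).mono
        fun j _ hj => ⟨by omega, hup j (by omega)⟩
    · exact (((h8.store_ne (a' := 2) hi).store_ne (a' := 4) hi).store hi).mono
        fun j _ hj => ⟨by omega, hup j (by omega)⟩
  · rintro s₂ t₂ w₂ hf₂ ⟨hfr, h2, h4, h8, ht, hw⟩
    refine wp_nil ⟨⟨hR₁.frameI hf₂, hfr.inp (hsl₁ ▸ hI), h2.mono fun i hi _ => ⟨hi, rfl⟩,
      ⟨fun v hv => hv, fun v _ => rfl, fun v _ => rfl, fun v _ => rfl⟩,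
      ⟨List.nodup_range, fun c => by simp⟩, fun i hi => ?_, ?_, fun c hc => ?_,
      fun i hi => absurd hi (by simp), (hf₂ rOut (by decide) rfl).trans hOut₁, by simp⟩,
      by omega, by omega⟩
    · have hi' : i < I.n := by simpa using hi
      simpa using h8 i hi' hi'
    · rw [List.length_range]
      exact (hf₂ rK (by decide) rfl).trans hK₁
    · have hc' : c < I.n := by simpa using hc
      refine ⟨[], by simp, by simp, h4 c hc' hc', fun v => ?_⟩
      simp only [List.mem_singleton, id_eq]
      exact ⟨fun e => ⟨by omega, e⟩, fun e => e.2⟩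

end Boruvka

/-! ### Minimum spanning trees and the cut property. -/

section
variable {V : Type} [Fintype V] {G : SimpleGraph V} {w : Sym2 V → ℝ}

theorem exists_isMinSpanningTree (hG : G.Connected) (w : Sym2 V → ℝ) :
    ∃ T, IsMinSpanningTree G w T := by
  obtain ⟨T₀, h₀⟩ := hG.exists_isTree_le
  obtain ⟨T, hT, hmin⟩ := Set.exists_min_image {T : SimpleGraph V | T ≤ G ∧ T.IsTree}
    (fun T => ∑ᶠ e ∈ T.edgeSet, w e) (Set.toFinite _) ⟨T₀, h₀⟩
  exact ⟨T, hT, fun T' h1 h2 => hmin T' ⟨h1, h2⟩⟩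

theorem SimpleGraph.IsTree.ncard_edgeSet {T : SimpleGraph V} (hT : T.IsTree) :
    T.edgeSet.ncard + 1 = Fintype.card V := by
  have := (SimpleGraph.isTree_iff_connected_and_card.1 hT).2
  rwa [Nat.card_eq_fintype_card (α := V)] at this

/-- The cut property: a lightest edge leaving `S` can be added to a part of a minimum spanning tree
that has no edge leaving `S`. -/
theorem IsMinSpanningTree.exists_insert {T : SimpleGraph V} (hT : IsMinSpanningTree G w T)
    {S : Set V} {u v : V} (huv : G.Adj u v) (hu : u ∈ S) (hv : v ∉ S)
    (hmin : ∀ x y, G.Adj x y → x ∈ S → y ∉ S → w s(u, v) ≤ w s(x, y)) {E : Set (Sym2 V)}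
    (hE : E ⊆ T.edgeSet) (hES : ∀ x y, s(x, y) ∈ E → x ∈ S → y ∈ S) :
    ∃ T', IsMinSpanningTree G w T' ∧ insert s(u, v) E ⊆ T'.edgeSet := by
  classical
  by_cases hmem : s(u, v) ∈ T.edgeSet
  · exact ⟨T, hT, Set.insert_subset hmem hE⟩
  -- Exchange argument: the tree path between `u` and `v` must leave `S` through some edge `d`. That
  -- edge is not in `E`, and it is to be replaced by `s(u, v)`.
  obtain ⟨p, hp⟩ := hT.1.2.connected.exists_isPath v u
  obtain ⟨d, hd, hdS, hdS'⟩ := p.reverse.exists_boundary_dart S hu hv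
  have hdp : s(d.fst, d.snd) ∈ p.edges := by
    have : d.edge ∈ p.reverse.edges := List.mem_map_of_mem hd
    rw [SimpleGraph.Walk.edges_reverse, List.mem_reverse] at this
    exact this
  have hdT : s(d.fst, d.snd) ∈ T.edgeSet := p.edges_subset_edgeSet hdp
  have hdE : s(d.fst, d.snd) ∉ E := fun h => hdS' (hES _ _ h hdS)
  have hne : s(u, v) ≠ s(d.fst, d.snd) := fun h => hmem (h ▸ hdT)
  set T₁ := T ⊔ SimpleGraph.edge u v with hT₁
  have hT₁E : T₁.edgeSet = insert s(u, v) T.edgeSet := by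
    rw [hT₁, SimpleGraph.edgeSet_sup, SimpleGraph.edgeSet_edge, Set.insert_eq, Set.union_comm]
    congr 1
    ext e
    simp only [Set.mem_sdiff, Set.mem_singleton_iff, and_iff_left_iff_imp]
    rintro rfl
    simpa using huv.ne
  have hconn : T₁.Connected := hT.1.2.connected.mono le_sup_left
  have huv₁ : T₁.Adj u v := by
    rw [← SimpleGraph.mem_edgeSet, hT₁E]; exact Set.mem_insert _ _
  -- The new edge closes the path `p` to a cycle through `d`, so removing `d` keeps the graph
  -- connected.
  have hnb : ¬ T₁.IsBridge s(d.fst, d.snd) := by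
    intro hb
    have hc : (SimpleGraph.Walk.cons huv₁ (p.mapLe le_sup_left)).IsCycle := by
      rw [SimpleGraph.Walk.cons_isCycle_iff]
      refine ⟨(SimpleGraph.Walk.isPath_mapLe _).2 hp, fun h => hmem ?_⟩
      rw [SimpleGraph.Walk.edges_mapLe_eq_edges] at h
      exact p.edges_subset_edgeSet h
    refine hb.notMem_edges_of_isCycle hc ?_
    rw [SimpleGraph.Walk.edges_cons, SimpleGraph.Walk.edges_mapLe_eq_edges]
    exact List.mem_cons_of_mem _ hdp
  have hconn' := hconn.connected_delete_edge_of_not_isBridge hnb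
  set T' := T₁.deleteEdges {s(d.fst, d.snd)} with hT'
  set A := T.edgeSet \ {s(d.fst, d.snd)} with hA
  have hA1 : T.edgeSet = insert s(d.fst, d.snd) A := by
    rw [hA, Set.insert_sdiff_singleton, Set.insert_eq_of_mem hdT]
  have hA2 : T'.edgeSet = insert s(u, v) A := by
    rw [hT', SimpleGraph.edgeSet_deleteEdges, hT₁E, hA, Set.insert_sdiff_of_notMem]
    simpa using hne
  have hA3 : s(d.fst, d.snd) ∉ A := fun h => h.2 rfl
  have hA4 : s(u, v) ∉ A := fun h => hmem h.1
  have hcard : T'.edgeSet.ncard = T.edgeSet.ncard := by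
    rw [hA1, hA2, Set.ncard_insert_of_notMem hA3, Set.ncard_insert_of_notMem hA4]
  have hT'G : T' ≤ G := by
    rw [← SimpleGraph.edgeSet_subset_edgeSet, hA2]
    exact Set.insert_subset huv
      (Set.sdiff_subset.trans (SimpleGraph.edgeSet_subset_edgeSet.2 hT.1.1))
  -- A connected graph with as many edges as the tree `T` is a tree.
  have hT'T : T'.IsTree := by
    refine SimpleGraph.isTree_iff_connected_and_card.2 ⟨hconn', ?_⟩
    rw [← (SimpleGraph.isTree_iff_connected_and_card.1 hT.1.2).2]
    exact congrArg (· + 1) hcard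
  refine ⟨T', ⟨⟨hT'G, hT'T⟩, fun T'' h1 h2 => le_trans ?_ (hT.2 T'' h1 h2)⟩, ?_⟩
  · rw [hA1, hA2, finsum_mem_insert w hA3 (Set.toFinite _),
      finsum_mem_insert w hA4 (Set.toFinite _)]
    have := hmin d.fst d.snd (hT.1.1 d.adj) hdS hdS'
    linarith
  · rw [hA2]
    exact Set.insert_subset_insert fun e he => ⟨hE he, fun h => hdE (h ▸ he)⟩

/-- If every component in `N` selects a lightest edge leaving it, and the selected edges make no
cycles, then they can all be added to a part of a minimum spanning tree. -/
theorem exists_isMinSpanningTree_union {E : Set (Sym2 V)} {σ : V → ℕ} {N : Finset ℕ}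
    {a b : ℕ → V} {h dep : ℕ → ℕ} (hE : ∃ T, IsMinSpanningTree G w T ∧ E ⊆ T.edgeSet)
    (hEσ : ∀ x y, s(x, y) ∈ E → σ x = σ y) (hadj : ∀ c ∈ N, G.Adj (a c) (b c))
    (ha : ∀ c ∈ N, σ (a c) = c) (hb : ∀ c ∈ N, σ (b c) = h c) (hne : ∀ c ∈ N, h c ≠ c)
    (hmin : ∀ c ∈ N, ∀ x y, G.Adj x y → σ x = c → σ y ≠ c → w s(a c, b c) ≤ w s(x, y))
    (hdep : ∀ c ∈ N, dep (h c) < dep c) :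
    (∃ T, IsMinSpanningTree G w T ∧ E ∪ (fun c => s(a c, b c)) '' N ⊆ T.edgeSet) ∧
      (E ∪ (fun c => s(a c, b c)) '' N).ncard = E.ncard + N.card := by
  -- The components are added by increasing `dep`, so `c` has the largest `dep` so far.
  induction N using Finset.induction_on_max_value dep with
  | empty => simpa using hE
  | insert c N hc hmax ih =>
    obtain ⟨⟨T, hT, hET⟩, hcard⟩ := ih (fun x hx => hadj x (Finset.mem_insert_of_mem hx))
      (fun x hx => ha x (Finset.mem_insert_of_mem hx))
      (fun x hx => hb x (Finset.mem_insert_of_mem hx))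
      (fun x hx => hne x (Finset.mem_insert_of_mem hx))
      (fun x hx => hmin x (Finset.mem_insert_of_mem hx))
      (fun x hx => hdep x (Finset.mem_insert_of_mem hx))
    have hcN := Finset.mem_insert_self c N
    -- No earlier edge leaves the component `c`. Edges of `E` stay within components, and the edge
    -- selected by `d` ends in `h d`, whose `dep` is smaller than that of `d` and so smaller than
    -- that of `c`. This also shows that the edge of `c` is new.
    have hcross : ∀ x y, s(x, y) ∈ E ∪ (fun c => s(a c, b c)) '' N → σ x = c → σ y = c := by
      rintro x y (hxy | ⟨d, hd, hxy⟩) hx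
      · rw [← hEσ x y hxy, hx]
      · replace hd : d ∈ N := hd
        have hd' := Finset.mem_insert_of_mem (b := c) hd
        have hdc : d ≠ c := fun e => hc (e ▸ hd)
        have hhd : h d ≠ c := fun e => by
          have h1 := hmax d hd
          have h2 := hdep d hd'
          rw [e] at h2
          omega
        rcases Sym2.eq_iff.1 hxy with ⟨e1, e2⟩ | ⟨e1, e2⟩
        · rw [← e1, ha d hd'] at hx; exact absurd hx hdc
        · rw [← e2, hb d hd'] at hx; exact absurd hx hhd
    have hnot : σ (b c) ≠ c := by rw [hb c hcN]; exact hne c hcN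
    have hset : E ∪ (fun c => s(a c, b c)) '' (insert c N : Finset ℕ) =
        insert s(a c, b c) (E ∪ (fun c => s(a c, b c)) '' N) := by
      rw [Finset.coe_insert, Set.image_insert_eq, Set.union_insert]
    rw [hset]
    constructor
    · exact hT.exists_insert (S := {x | σ x = c}) (hadj c hcN) (ha c hcN) hnot
        (fun x y hxy hx hy => hmin c hcN x y hxy hx hy) hET hcross
    · rw [Set.ncard_insert_of_notMem (fun hm => hnot (hcross _ _ hm (ha c hcN))) (Set.toFinite _),
        hcard, Finset.card_insert_of_notMem hc]
      omega

end

/-! ### The output as part of a minimum spanning tree. -/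

namespace Boruvka

open ARAM

theorem Forest.succ {n D : ℕ} {par ρ : ℕ → ℕ} (h : Forest n par ρ D) : Forest n par ρ (D + 1) :=
  ⟨h.lt, h.root_par, h.par_root, fun v hv => by
    rw [Function.iterate_succ_apply', h.iter v hv, h.par_root v hv]⟩

section
variable {K : Type} {I : Input K}

theorem Input.Valid.exists_isSlot (hV : I.Valid) {j : ℕ} (hj : j < I.S) :
    ∃ v < I.n, I.IsSlot v j := by
  suffices H : ∀ m ≤ I.n, j < I.off m → ∃ v < m, I.IsSlot v j from
    H I.n le_rfl (by rwa [hV.off_last])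
  intro m
  induction m with
  | zero => intro _ h; rw [hV.off_zero] at h; omega
  | succ m ih =>
    intro hm h
    by_cases h' : j < I.off m
    · obtain ⟨v, hv, hs⟩ := ih (by omega) h'
      exact ⟨v, by omega, hs⟩
    · exact ⟨m, by omega, by omega, h⟩

/-- Changing only the array of pointers. -/
theorem Input.State.setPar {ρ par par' : ℕ → ℕ} {D D' : ℕ} {rs : List ℕ} {l : List (ℕ × ℕ)}
    {s s' : Mem K} {L : List ℕ} (h : I.State ρ par D rs l s) (hR : I.Regs s')
    (hfr : I.Frame L s.slow s'.slow) (hpar : I.IsArr s'.slow 2 (fun _ => True) par')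
    (hF : Forest I.n par' ρ D') (hK : s'.fast rK = s.fast rK) (hO : s'.fast rOut = s.fast rOut)
    (h0 : 0 ∉ L := by decide) (h1 : 1 ∉ L := by decide) (h3 : 3 ∉ L := by decide)
    (h4 : 4 ∉ L := by decide) (h8 : 8 ∉ L := by decide) : I.State ρ par' D' rs l s' := by
  have hc := h.card
  exact ⟨hR, hfr.inp h.inp, hpar, hF, h.roots, h.act.frame hfr (by omega) h8, hK.trans h.numComp,
    fun c hc => (h.members c hc).frame hfr h3 h4, h.out.frame hfr (by omega) h0 h1,
    hO.trans h.outAddr, hc⟩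

end

/-- The adjacency arrays are those of the graph `G` with weights `w`. -/
structure Input.Represents (I : Input ℝ) (G : SimpleGraph (Fin I.n)) (w : Sym2 (Fin I.n) → ℝ) :
    Prop where
  adj : ∀ (v : Fin I.n) (j : ℕ), I.IsSlot v j →
    ∃ u : Fin I.n, u = I.nb j ∧ G.Adj v u ∧ I.wj j = w s(v, u)
  slot : ∀ v u : Fin I.n, G.Adj v u → ∃ j, I.IsSlot v j ∧ I.nb j = u ∧ I.wj j = w s(v, u)

section
variable {I : Input ℝ} {G : SimpleGraph (Fin I.n)} {w : Sym2 (Fin I.n) → ℝ}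

/-- A walk from a vertex with `p` to one without it must cross the boundary along some edge, and
that edge has a slot. -/
theorem Input.Represents.connected (h : I.Represents G w) (hG : G.Connected) :
    I.Connected := by
  refine ⟨fun v hv j hj => ?_, ?_⟩
  · obtain ⟨u, hu, hadj, hw⟩ := h.adj ⟨v, hv⟩ j hj
    obtain ⟨j', h1, h2, h3⟩ := h.slot u ⟨v, hv⟩ hadj.symm
    exact ⟨j', hu ▸ h1, h2, by rw [h3, hw, Sym2.eq_swap]⟩
  · rintro p ⟨u, hu, hpu⟩ ⟨v, hv, hpv⟩
    obtain ⟨q⟩ := hG.preconnected ⟨u, hu⟩ ⟨v, hv⟩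
    obtain ⟨d, -, h1, h2⟩ := q.exists_boundary_dart {x : Fin I.n | p x} hpu hpv
    obtain ⟨j, h3, h4, -⟩ := h.slot _ _ d.adj
    exact ⟨d.fst, d.fst.2, j, h3, h1, by rw [h4]; exact h2⟩

/-- The edges in `l`. -/
def edgeSetOf (n : ℕ) (l : List (ℕ × ℕ)) : Set (Sym2 (Fin n)) :=
  {e | ∃ u v : Fin n, ((u : ℕ), (v : ℕ)) ∈ l ∧ e = s(u, v)}

/-- The edges `l` belong to a minimum spanning tree, and connect vertices of the same component. -/
structure TreeInv (G : SimpleGraph (Fin I.n)) (w : Sym2 (Fin I.n) → ℝ) (ρ : ℕ → ℕ)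
    (l : List (ℕ × ℕ)) : Prop where
  exists_mst : ∃ T, IsMinSpanningTree G w T ∧ edgeSetOf I.n l ⊆ T.edgeSet
  lt : ∀ p ∈ l, p.1 < I.n ∧ p.2 < I.n
  root : ∀ p ∈ l, ρ p.1 = ρ p.2
  card : (edgeSetOf I.n l).ncard = l.length

theorem TreeInv.nil (hG : G.Connected) (ρ : ℕ → ℕ) : TreeInv (I := I) G w ρ [] := by
  have h0 : edgeSetOf I.n [] = ∅ := by ext e; simp [edgeSetOf]
  obtain ⟨T, hT⟩ := exists_isMinSpanningTree hG w
  exact ⟨⟨T, hT, by simp [h0]⟩, by simp, by simp, by simp [h0]⟩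

theorem TreeInv.merge {ρ : ℕ → ℕ} {l : List (ℕ × ℕ)} {rs : List ℕ} {h bu bv rt dep : ℕ → ℕ}
    (hT : TreeInv (I := I) G w ρ l) (hI : I.Represents G w) (hV : I.Valid)
    (hrs : rs.Nodup) (hn : 0 < I.n) (hM : I.Merging ρ rs h bu bv rt dep) :
    TreeInv (I := I) G w (fun v => rt (ρ v)) (l ++ newEdges h bu bv rs) := by
  -- Endpoints are lifted to `Fin I.n`; the default vertex 0 is used only for values out of range.
  have hch : ∀ (f : ℕ → ℕ), ∃ a : ℕ → Fin I.n, ∀ c, f c < I.n → (a c : ℕ) = f c := by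
    intro f
    refine ⟨fun c => if hc : f c < I.n then ⟨f c, hc⟩ else ⟨0, hn⟩, fun c hc => ?_⟩
    simp [hc]
  obtain ⟨a, ha⟩ := hch bu
  obtain ⟨b, hb⟩ := hch bv
  set N : Finset ℕ := (rs.filter (fun c => hookTo h c ≠ c)).toFinset with hN
  have hmemN : ∀ c, c ∈ N ↔ c ∈ rs ∧ hookTo h c ≠ c := fun c => by simp [hN]
  have hhook : ∀ c, hookTo h c ≠ c → hookTo h c = h c := by
    intro c hc
    unfold hookTo at hc ⊢
    split_ifs at hc ⊢
    · exact absurd rfl hc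
    · rfl
  have hlt : ∀ c ∈ rs, bu c < I.n ∧ bv c < I.n := by
    intro c hc
    obtain ⟨j, hj, h1, -⟩ := hM.sel c hc
    exact ⟨hj.lt, h1 ▸ hV.nb_lt j (hj.best.mem.lt hV)⟩
  have hau : ∀ c ∈ rs, (a c : ℕ) = bu c := fun c hc => ha c (hlt c hc).1
  have hbv : ∀ c ∈ rs, (b c : ℕ) = bv c := fun c hc => hb c (hlt c hc).2
  have hrbu : ∀ c ∈ rs, ρ (bu c) = c := fun c hc => by
    obtain ⟨j, hj, -⟩ := hM.sel c hc
    exact hj.root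
  have hrbv : ∀ c ∈ rs, ρ (bv c) = h c := fun c hc => by
    obtain ⟨j, -, -, h2⟩ := hM.sel c hc
    exact h2.symm
  have hedge : ∀ c ∈ rs, G.Adj (a c) (b c) ∧
      ∀ x y : Fin I.n, G.Adj x y → ρ x = c → ρ y ≠ c → w s(a c, b c) ≤ w s(x, y) := by
    intro c hc
    obtain ⟨j, hj, h1, -⟩ := hM.sel c hc
    obtain ⟨u, hu, hadj, hw⟩ := hI.adj (a c) j (by rw [hau c hc]; exact hj.slot)
    have hub : u = b c := Fin.ext (by rw [hu, hbv c hc, h1])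
    subst hub
    refine ⟨hadj, fun x y hxy hx hy => ?_⟩
    obtain ⟨j', h3, h4, h5⟩ := hI.slot x y hxy
    rw [← hw, ← h5]
    rcases hj.best.le j' ⟨x, x.2, hx, h3⟩ (by rwa [h4]) with h6 | h6
    exacts [h6.le, h6.1.le]
  have hset : edgeSetOf I.n (l ++ newEdges h bu bv rs) =
      edgeSetOf I.n l ∪ (fun c => s(a c, b c)) '' N := by
    ext e
    simp only [edgeSetOf, newEdges, List.mem_append, List.mem_map, List.mem_filter,
      decide_eq_true_eq, Set.mem_union, Set.mem_image, Set.mem_ofPred_eq, Finset.mem_coe, hmemN,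
      Prod.mk.injEq]
    constructor
    · rintro ⟨u, v, huv | ⟨c, ⟨hc, hcN⟩, e1, e2⟩, rfl⟩
      · exact .inl ⟨u, v, huv, rfl⟩
      · refine .inr ⟨c, ⟨hc, hcN⟩, ?_⟩
        rw [Fin.ext ((hau c hc).trans e1), Fin.ext ((hbv c hc).trans e2)]
    · rintro (⟨u, v, huv, rfl⟩ | ⟨c, ⟨hc, hcN⟩, rfl⟩)
      · exact ⟨u, v, .inl huv, rfl⟩
      · exact ⟨a c, b c, .inr ⟨c, ⟨hc, hcN⟩, (hau c hc).symm, (hbv c hc).symm⟩, rfl⟩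
  -- The cuts are around the components that do not stay roots, each with its selected edge; on
  -- these components `hookTo h` agrees with `h`, so `dep` decreases along `h`.
  have key := exists_isMinSpanningTree_union (w := w) (G := G) (E := edgeSetOf I.n l)
    (σ := fun v => ρ v) (N := N) (a := a) (b := b) (h := h) (dep := dep) hT.exists_mst
    (by
      rintro x y ⟨u, v, huv, e⟩
      have := hT.root _ huv
      rcases Sym2.eq_iff.1 e with ⟨rfl, rfl⟩ | ⟨rfl, rfl⟩
      exacts [this, this.symm])
    (fun c hc => (hedge c ((hmemN c).1 hc).1).1)
    (fun c hc => by rw [hau c ((hmemN c).1 hc).1, hrbu c ((hmemN c).1 hc).1])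
    (fun c hc => by rw [hbv c ((hmemN c).1 hc).1, hrbv c ((hmemN c).1 hc).1])
    (fun c hc => hM.ne c ((hmemN c).1 hc).1)
    (fun c hc => (hedge c ((hmemN c).1 hc).1).2)
    (fun c hc => by
      have := hM.hooks.dep_lt c ((hmemN c).1 hc).1 ((hmemN c).1 hc).2
      rwa [hhook c ((hmemN c).1 hc).2] at this)
  rw [← hset] at key
  have hnew : ∀ p ∈ newEdges h bu bv rs, ∃ c ∈ rs, hookTo h c ≠ c ∧ p = (bu c, bv c) := by
    intro p hp
    simp only [newEdges, List.mem_map, List.mem_filter, decide_eq_true_eq] at hp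
    obtain ⟨c, ⟨h1, h2⟩, h3⟩ := hp
    exact ⟨c, h1, h2, h3.symm⟩
  refine ⟨key.1, fun p hp => ?_, fun p hp => ?_, ?_⟩
  · rcases List.mem_append.1 hp with hp | hp
    · exact hT.lt p hp
    · obtain ⟨c, hc, -, rfl⟩ := hnew p hp
      exact hlt c hc
  · rcases List.mem_append.1 hp with hp | hp
    · simp only [hT.root p hp]
    · obtain ⟨c, hc, hcc, rfl⟩ := hnew p hp
      have := hM.hooks.rt_step c hc
      rw [hhook c hcc] at this
      simp only [hrbu c hc, hrbv c hc, this]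
  · rw [key.2, hT.card, List.length_append, hN, List.toFinset_card_of_nodup (hrs.filter _),
      newEdges, List.length_map]

/-- When only one component is left, the output is a minimum spanning tree. -/
theorem TreeInv.holdsTree {ρ : ℕ → ℕ} {l : List (ℕ × ℕ)} {sl : ℕ → Word ℝ}
    (hT : TreeInv (I := I) G w ρ l) (hO : I.Out sl l) (hn : 0 < I.n) (hl : l.length + 1 = I.n) :
    ∃ T, IsMinSpanningTree G w T ∧ HoldsTree sl (I.P 0) T := by
  obtain ⟨T, hMST, hsub⟩ := hT.exists_mst
  have hcard := hMST.1.2.ncard_edgeSet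
  rw [Fintype.card_fin] at hcard
  -- The output consists of n − 1 distinct edges inside a tree that has only n − 1 edges.
  have heq : edgeSetOf I.n l = T.edgeSet :=
    Set.eq_of_subset_of_ncard_le hsub (by rw [hT.card]; omega) (Set.toFinite _)
  refine ⟨T, hMST, fun i => if h : i < l.length then ⟨l[i].1, (hT.lt _ (List.getElem_mem h)).1⟩
    else ⟨0, hn⟩, fun i => if h : i < l.length then ⟨l[i].2, (hT.lt _ (List.getElem_mem h)).2⟩
    else ⟨0, hn⟩, fun i hi => ?_, ?_⟩
  · have hi' : i < l.length := by omega
    simp only [hi', dif_pos]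
    exact hO i hi'
  · rw [← heq]
    ext e
    simp only [edgeSetOf, Set.mem_ofPred_eq]
    constructor
    · rintro ⟨u, v, huv, rfl⟩
      obtain ⟨i, hi, e⟩ := List.getElem_of_mem huv
      refine ⟨i, by omega, ?_⟩
      simp only [hi, dif_pos, e]
    · rintro ⟨i, hi, rfl⟩
      have hi' : i < l.length := by omega
      refine ⟨_, _, ?_, rfl⟩
      simp only [hi', dif_pos]
      exact List.getElem_mem hi'

end

end Boruvka

/-! ### The two phases and the total cost. -/

namespace Boruvka

open ARAM

section
variable {M b : ℕ} {I : Input ℝ} {G : SimpleGraph (Fin I.n)} {wt : Sym2 (Fin I.n) → ℝ}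
  {s : Mem ℝ} {t w : ℕ}

/-- The rounds of phase one. -/
def phaseOne : Prog :=
  .loop ⟨.lt, rZero, rR⟩ (block [.cond ⟨.lt, rOne, rK⟩ round .skip, sub rR rR rOne])

/-- Here `i` counts the iterations made, so it bounds the depth, and `k ≤ n / 2 ^ i` unless a single
component is left. The potential `18 * k` pays for the writes: a round costs at most `9 * k` and at
least halves `k`. -/
theorem phaseOne_spec {R : ℕ} (F : I.Fits M b) (hV : I.Valid) (hI : I.Represents G wt)
    (hG : G.Connected) (hn : 0 < I.n) (hR : R < 2 ^ b) (r : ℕ) :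
    ∀ (ρ par : ℕ → ℕ) (D i : ℕ) (rs : List ℕ) (l : List (ℕ × ℕ)) (s : Mem ℝ) (t w : ℕ),
      I.State ρ par D rs l s → TreeInv (I := I) G wt ρ l → s.fast rR = .idx r → D ≤ i →
      i + r = R → 0 < rs.length → (rs.length = 1 ∨ 2 ^ i * rs.length ≤ I.n) →
      wp M b phaseOne (fun s' t' w' => ∃ ρ' par' D' rs' l', I.State ρ' par' D' rs' l' s' ∧
        TreeInv (I := I) G wt ρ' l' ∧ D' ≤ R ∧ 0 < rs'.length ∧
        (rs'.length = 1 ∨ 2 ^ R * rs'.length ≤ I.n) ∧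
        t' ≤ t + r * ((10 * R + 45) * I.S + 240 * I.n + 25) + 2 ∧
        w' + 18 * rs'.length ≤ w + 18 * rs.length) s t w := by
  induction r with
  | zero =>
    intro ρ par D i rs l s t w hS hT hr hD hi hpos hk
    refine wp_loop (Test.eval_idx F.fast hS.regs.zero hr) (fun e => ?_) (fun _ => ?_)
    · have : 0 < 0 := of_decide_eq_true e
      omega
    · obtain rfl : i = R := by omega
      exact ⟨ρ, par, D, rs, l, hS, hT, hD, hpos, hk, by omega, le_rfl⟩
  | succ r ih =>
    intro ρ par D i rs l s t w hS hT hr hD hi hpos hk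
    refine wp_loop (Test.eval_idx F.fast hS.regs.zero hr) (fun _ => ?_) (fun e => ?_)
    swap
    · have : ¬ 0 < r + 1 := of_decide_eq_false e
      omega
    have next : ∀ ρ' par' D' rs' l' (s' : Mem ℝ) (t' w' : ℕ), I.State ρ' par' D' rs' l' s' →
        TreeInv (I := I) G wt ρ' l' → s'.fast rR = .idx (r + 1) → D' ≤ i + 1 → 0 < rs'.length →
        (rs'.length = 1 ∨ 2 ^ (i + 1) * rs'.length ≤ I.n) →
        t' ≤ t + 4 + ((10 * R + 45) * I.S + 240 * I.n + 15) →
        w' + 18 * rs'.length ≤ w + 18 * rs.length →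
        wp M b (block [sub rR rR rOne]) (wp M b phaseOne (fun s' t' w' =>
          ∃ ρ' par' D' rs' l', I.State ρ' par' D' rs' l' s' ∧ TreeInv (I := I) G wt ρ' l' ∧
          D' ≤ R ∧ 0 < rs'.length ∧ (rs'.length = 1 ∨ 2 ^ R * rs'.length ≤ I.n) ∧
          t' ≤ t + (r + 1) * ((10 * R + 45) * I.S + 240 * I.n + 25) + 2 ∧
          w' + 18 * rs'.length ≤ w + 18 * rs.length)) s' t' w' := by
      intro ρ' par' D' rs' l' s' t' w' hS' hT' hr' hD' hpos' hk' ht' hw'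
      refine wp_cons (wp_sub F.fast hr' hS'.regs.one (by omega) (wp_nil ?_))
      refine wp_call (ih ρ' par' D' (i + 1) rs' l' _ _ _ (hS'.setPar (L := []) ?_
        (Input.Frame.refl _ _) hS'.ptr hS'.forest rfl rfl) hT' rfl hD' (by omega) hpos' hk') ?_
      · refine hS'.regs.congr (p := fun r => decide (r < 16)) (fun r hr => ?_)
        simp only [decide_eq_true_eq] at hr
        have h1 : r ≠ rR := by simp only [rR]; omega
        simp [Mem.setFast, Function.update_of_ne, h1]
      · rintro s₂ t₂ w₂ - - ⟨ρ₂, par₂, D₂, rs₂, l₂, h1, h2, h3, h4, h5, h6, h7⟩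
        refine ⟨ρ₂, par₂, D₂, rs₂, l₂, h1, h2, h3, h4, h5, ?_, by omega⟩
        rw [Nat.add_mul, Nat.one_mul]
        omega
    refine wp_cons (wp_cond (Test.eval_idx F.fast hS.regs.one hS.numComp) (fun e => ?_)
      (fun e => ?_))
    · have h2 : 1 < rs.length := of_decide_eq_true e
      refine wp_call (round_spec F hV (hI.connected hG) hS h2) ?_
      rintro s₁ t₁ w₁ hf₁ - ⟨h, bu, bv, rt, dep, hM, hS₁, -, hhalf, hpos₁, ht₁, hw₁⟩
      refine next _ _ _ _ _ _ _ _ hS₁ (hT.merge hI hV hS.roots.nodup hn hM)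
        ((hf₁ rR rfl).trans hr) (by omega) hpos₁ (.inr ?_) ?_ (by omega)
      · refine le_trans ?_ (hk.resolve_left (by omega))
        rw [pow_succ, Nat.mul_assoc]
        exact Nat.mul_le_mul_left _ hhalf
      · have : (10 * D + 45) * I.S ≤ (10 * R + 45) * I.S := Nat.mul_le_mul_right _ (by omega)
        omega
    · have h2 : ¬ 1 < rs.length := of_decide_eq_false e
      exact wp_skip (next _ _ _ _ _ _ _ _ hS hT hr (by omega) hpos (.inl (by omega))
        (by omega) le_rfl)

/-- The rounds of phase two. -/
def phaseTwo : Prog := .loop ⟨.lt, rOne, rK⟩ (.seq round shortcutPhaseOne)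

/-- The invariant behind the constant depth is that every pointer lands in `ps`, and members of `ps`
point directly to their root. Roots are always members of `ps`, so a merge keeps the first part and
the shortcut restores the second. The number of rounds is bounded by the logarithm of the number of
components. -/
theorem phaseTwo_spec {ps : List ℕ} (F : I.Fits M b) (hV : I.Valid) (hI : I.Represents G wt)
    (hG : G.Connected) (hn : 0 < I.n) (hps : ps.length ≤ I.n) (hlt : ∀ q ∈ ps, q < I.n) (d : ℕ) :
    ∀ (ρ par : ℕ → ℕ) (rs : List ℕ) (l : List (ℕ × ℕ)) (s : Mem ℝ) (t w : ℕ),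
      I.State ρ par 2 rs l s → TreeInv (I := I) G wt ρ l → I.Stored s.slow 9 ps →
      s.fast rK1 = .idx ps.length → (∀ v < I.n, par v ∈ ps) → (∀ q ∈ ps, par q = ρ q) →
      (∀ c ∈ rs, c ∈ ps) → 0 < rs.length → Nat.log 2 rs.length ≤ d →
      wp M b phaseTwo (fun s' t' w' => ∃ ρ' par' rs' l', I.State ρ' par' 2 rs' l' s' ∧
        TreeInv (I := I) G wt ρ' l' ∧ rs'.length = 1 ∧
        t' ≤ t + d * (65 * I.S + 300 * I.n + 20) + 2 ∧
        w' + 18 ≤ w + 18 * rs.length + d * ps.length) s t w := by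
  induction d with
  | zero =>
    intro ρ par rs l s t w hS hT hst hK1 hpar hparq hsub hpos hd
    have h2 : rs.length < 2 := (Nat.log_eq_zero_iff.1 (by omega)).resolve_right (by omega)
    refine wp_loop (Test.eval_idx F.fast hS.regs.one hS.numComp) (fun e => ?_) (fun _ => ?_)
    · have : 1 < rs.length := of_decide_eq_true e
      omega
    · exact ⟨ρ, par, rs, l, hS, hT, by omega, by omega, by omega⟩
  | succ d ih =>
    intro ρ par rs l s t w hS hT hst hK1 hpar hparq hsub hpos hd
    refine wp_loop (Test.eval_idx F.fast hS.regs.one hS.numComp) (fun e => ?_) (fun e => ?_)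
    swap
    · have : ¬ 1 < rs.length := of_decide_eq_false e
      exact ⟨ρ, par, rs, l, hS, hT, by omega, by omega, by omega⟩
    have h2 : 1 < rs.length := of_decide_eq_true e
    refine wp_seq (wp_call (round_spec F hV (hI.connected hG) hS h2) ?_)
    rintro s₁ t₁ w₁ hf₁ - ⟨h, bu, bv, rt, dep, hM, hS₁, hfr₁, hhalf, hpos₁, ht₁, hw₁⟩
    have hK1₁ : s₁.fast rK1 = .idx ps.length := (hf₁ rK1 rfl).trans hK1
    have hst₁ := hst.frame hfr₁ hps
    refine wp_call (shortcutPhaseOne_spec F hS₁.regs hS₁.ptr hS₁.forest hst₁ hps hlt hK1₁) ?_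
    rintro s₂ t₂ w₂ hf₂ - ⟨hfr₂, hptr₂, ht₂, hw₂⟩
    have hF₂ := hS₁.forest.shortcut
      (par' := fun v => if v ∈ ps then rt (ρ v) else if v ∈ rs then rt v else par v)
      (fun v _ => by split_ifs <;> simp)
    have hpar₂ : ∀ v < I.n, (if v ∈ ps then rt (ρ v) else if v ∈ rs then rt v else par v) ∈ ps := by
      intro v hv
      by_cases hvp : v ∈ ps
      · rw [if_pos hvp]
        refine hsub _ (hM.hooks.rt_mem _ ((hS.roots.mem_iff _).2
          ⟨hS.forest.root_lt hv, hS.forest.root_root hv⟩))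
      · rw [if_neg hvp, if_neg fun hr => hvp (hsub v hr)]
        exact hpar v hv
    -- After the merge the depth is 3. The shortcut brings it back to 2: one step into `ps`, one
    -- step to the root.
    have hF2 : Forest I.n (fun v => if v ∈ ps then rt (ρ v) else if v ∈ rs then rt v else par v)
        (fun v => rt (ρ v)) 2 := by
      refine ⟨hF₂.lt, hF₂.root_par, hF₂.par_root, fun v hv => ?_⟩
      have h1 := hpar₂ v hv
      have h2 := hF₂.root_par v hv
      rw [Function.iterate_succ_apply, Function.iterate_one]
      rw [if_pos h1, h2]
    have hS₂ := hS₁.setPar (hS₁.regs.frame hf₂) hfr₂ hptr₂ hF2 (hf₂ rK rfl) (hf₂ rOut rfl)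
    have hlog : Nat.log 2 (rs.filter (fun c => rt c = c)).length ≤ d := by
      have h3 : Nat.log 2 (rs.filter (fun c => rt c = c)).length ≤ Nat.log 2 (rs.length / 2) :=
        Nat.log_mono_right (by omega)
      rw [Nat.log_div_base] at h3
      omega
    refine wp_call (ih _ _ _ _ s₂ t₂ w₂ hS₂ (hT.merge hI hV hS.roots.nodup hn hM)
      (hst₁.frame hfr₂ hps) ((hf₂ rK1 rfl).trans hK1₁) hpar₂ (fun q hq => if_pos hq)
      (fun c hc => hsub c (List.mem_of_mem_filter hc)) hpos₁ hlog) ?_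
    rintro s₃ t₃ w₃ - - ⟨ρ₃, par₃, rs₃, l₃, h3, h4, h5, h6, h7⟩
    refine ⟨ρ₃, par₃, rs₃, l₃, h3, h4, h5, ?_, ?_⟩
    · rw [Nat.add_mul, Nat.one_mul]
      omega
    · rw [Nat.add_mul, Nat.one_mul]
      omega

theorem clog_two_le_self (N : ℕ) : Nat.clog 2 N ≤ N :=
  (Nat.clog_le_iff_le_pow (by decide)).2 Nat.lt_two_pow_self.le

/-- The number `R` of rounds of phase one satisfies `R² = O(log n)`. -/
theorem rounds_mul_le (L : ℕ) :
    Nat.clog 2 L * (10 * Nat.clog 2 L + 45) ≤ 165 * L := by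
  -- With `r + 1` rounds, `2 ^ r < L` and `10 * (r + 1) ^ 2 + 45 * (r + 1) ≤ 55 * (r + 1) ^ 2`,
  -- which yields the factor 165 = 55 · 3.
  have hsq : ∀ r : ℕ, (r + 1) ^ 2 ≤ 3 * 2 ^ r := by
    intro r
    induction r with
    | zero => norm_num
    | succ r ih =>
      rcases r with _ | _ | r
      · norm_num
      · norm_num
      · have h : 2 ^ (r + 1 + 1 + 1) = 2 * 2 ^ (r + 1 + 1) := pow_succ' 2 _
        have h' : (r + 1 + 1 + 1 + 1) ^ 2 ≤ 2 * (r + 1 + 1 + 1) ^ 2 := by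
          nlinarith [Nat.zero_le r, Nat.zero_le (r * r)]
        omega
  rcases h : Nat.clog 2 L with _ | r
  · simp
  · have h1 : 2 ^ r < L := (Nat.lt_clog_iff_pow_lt (by decide)).1 (by omega)
    have h2 := hsq r
    nlinarith

/-- The slow writes add up to 3n for the setup, 18n for the potential of the rounds, n for
shortcutting all vertices, at most n for saving the phase-one roots, and at most n for shortcutting
them in phase two. -/
theorem boruvka_spec (F : I.Fits M b) (hV : I.Valid) (hI : I.Represents G wt)
    (hG : G.Connected) (hn : 0 < I.n) (h0 : s.slow 0 = .idx I.n) (hInp : I.Inp s.slow) :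
    wp M b boruvka (fun s' t' w' => (∃ T, IsMinSpanningTree G wt T ∧
      HoldsTree s'.slow (I.P 0) T) ∧
      t' ≤ 230 * (Nat.clog 2 I.n * I.S) + 600 * (Nat.clog 2 I.n * I.n) + 200 * I.n ∧
      w' ≤ 24 * I.n) s 0 0 := by
  set L := Nat.clog 2 I.n with hL
  set R := Nat.clog 2 L with hR
  have hLn : L ≤ I.n := clog_two_le_self _
  have hRL : R ≤ L := clog_two_le_self _
  refine wp_cons (wp_call (setup_spec F h0 hInp hV.off_last) ?_)
  rintro s₁ t₁ w₁ - - ⟨hS₁, ht₁, hw₁⟩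
  refine wp_cons (wp_call (computeRounds_spec F hS₁.regs hn) ?_)
  rintro s₂ t₂ w₂ hf₂ - ⟨hR₂, hs₂, ht₂, rfl⟩
  have hS₂ := hS₁.setPar (L := []) (hS₁.regs.frame hf₂) (hs₂ ▸ Input.Frame.refl _ _)
    (hs₂ ▸ hS₁.ptr) hS₁.forest (hf₂ rK rfl) (hf₂ rOut rfl)
  refine wp_cons (wp_call (phaseOne_spec F hV hI hG hn (R := R) (F.lt' (by omega)) R id id 0 0
    (List.range I.n) [] s₂ t₂ w₂ hS₂ (.nil hG _) hR₂ le_rfl (by omega) (by simpa using hn)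
    (.inr (by simp))) ?_)
  rintro s₃ t₃ w₃ - - ⟨ρ, par, D, rs, l, hS₃, hT, hD, hpos, hk, ht₃, hw₃⟩
  rw [List.length_range] at hw₃
  refine wp_cons (wp_call (shortcutAll_spec F hS₃.regs hS₃.ptr hS₃.forest) ?_)
  rintro s₄ t₄ w₄ hf₄ - ⟨hfr₄, hptr₄, ht₄, rfl⟩
  -- All pointers are direct now; depth 1 is weakened to the depth 2 that phase two maintains.
  have hS₄ := hS₃.setPar (hS₃.regs.frame hf₄) hfr₄ hptr₄
    (hS₃.forest.of_eq_root fun _ _ => rfl).succ (hf₄ rK rfl) (hf₄ rOut rfl)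
  have hlen := hS₃.roots.length_le
  refine wp_cons (wp_call (savePhaseOne_spec F hS₄.regs hS₄.act hlen hS₄.numComp) ?_)
  rintro s₅ t₅ w₅ hf₅ - ⟨hfr₅, hst₅, hK₅, ht₅, rfl⟩
  have hS₅ := hS₄.setPar (hS₄.regs.frame hf₅) hfr₅ (hS₄.ptr.frame hfr₅) hS₄.forest
    (hf₅ rK rfl) (hf₅ rOut rfl)
  refine wp_cons (wp_call (phaseTwo_spec F hV hI hG hn hlen
    (fun q hq => ((hS₃.roots.mem_iff q).1 hq).1) (Nat.log 2 rs.length) ρ ρ rs l s₅ _ _ hS₅ hT hst₅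
    hK₅ (fun v hv => (hS₃.roots.mem_iff _).2 ⟨hS₃.forest.root_lt hv, hS₃.forest.root_root hv⟩)
    (fun _ _ => rfl) (fun _ hc => hc) hpos le_rfl) ?_)
  rintro s₆ t₆ w₆ - - ⟨ρ₆, par₆, rs₆, l₆, hS₆, hT₆, hone, ht₆, hw₆⟩
  have hcard := hS₆.card
  refine wp_nil ⟨hT₆.holdsTree hS₆.out hn (by omega), ?_, ?_⟩
  · have hlog : Nat.log 2 rs.length ≤ L :=
      (Nat.log_mono_right hlen).trans (Nat.log_le_clog 2 I.n)
    have e1 : R * ((10 * R + 45) * I.S + 240 * I.n + 25) ≤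
        165 * (L * I.S) + 240 * (L * I.n) + 25 * L := by
      have h1 : R * (10 * R + 45) * I.S ≤ 165 * L * I.S :=
        Nat.mul_le_mul_right _ (rounds_mul_le L)
      have h2 : R * I.n ≤ L * I.n := Nat.mul_le_mul_right _ hRL
      nlinarith
    have e2 : Nat.log 2 rs.length * (65 * I.S + 300 * I.n + 20) ≤
        L * (65 * I.S + 300 * I.n + 20) := Nat.mul_le_mul_right _ hlog
    have e3 : (10 * D + 20) * I.n ≤ 10 * (L * I.n) + 20 * I.n := by
      have : (10 * D + 20) * I.n ≤ (10 * L + 20) * I.n := Nat.mul_le_mul_right _ (by omega)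
      linarith
    have e4 : L ≤ L * I.n := Nat.le_mul_of_pos_right L hn
    have e5 : L * (65 * I.S + 300 * I.n + 20) = 65 * (L * I.S) + 300 * (L * I.n) + 20 * L := by
      ring
    omega
  · have hlogk : Nat.log 2 rs.length * rs.length ≤ I.n := by
      rcases hk with hk | hk
      · simp [hk]
      · refine le_trans (Nat.mul_le_mul_right _ ?_) hk
        exact ((Nat.log_mono_right hlen).trans (Nat.log_le_clog 2 I.n)).trans
          (Nat.le_pow_clog (by decide) L)
    omega

end

end Boruvka

/-! ### Reading the input, word length, and the final constants. -/

namespace Boruvka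

open ARAM

theorem exists_input {n : ℕ} {G : SimpleGraph (Fin n)} {w : Sym2 (Fin n) → ℝ}
    {sl : ℕ → Word ℝ} (h : HoldsGraph sl G w) :
    ∃ (S : ℕ) (off nb : ℕ → ℕ) (wj : ℕ → ℝ), S = 2 * G.edgeSet.ncard ∧
      (Input.mk n S off nb wj).Valid ∧ (Input.mk n S off nb wj).Inp sl ∧
      (Input.mk n S off nb wj).Represents G w := by
  classical
  obtain ⟨-, off, nbr, h0, hmono, hoff, hbij, hsl⟩ := h
  -- The default weight 0 is irrelevant: all words in the range concerned hold weights.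
  let wj : ℕ → ℝ := fun j => match sl (n + 2 + off n + j) with
    | .wt x => x
    | .idx _ => 0
  have hwj : ∀ v : Fin n, ∀ j, off v ≤ j ∧ j < off (v + 1) → wj j = w s(v, nbr j) := by
    intro v j hj
    simp only [wj, (hsl v j hj).2]
  set I : Input ℝ := ⟨n, off n, off, fun j => nbr j, wj⟩ with hI
  have hV : I.Valid := ⟨h0, hmono, rfl, fun j _ => (nbr j).2⟩
  refine ⟨off n, off, fun j => nbr j, wj, ?_, hV, ⟨hoff, fun j hj => ?_, fun j hj => ?_⟩,
    ⟨fun v j hj => ?_, fun v u hvu => ?_⟩⟩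
  -- The slots of `v` biject with its neighbours, so by the handshake lemma there are twice as many
  -- slots as edges.
  · have hdeg : ∀ v : Fin n, G.degree v = off (v + 1) - off v := by
      intro v
      have h1 := (hbij v).injOn.ncard_image
      rw [(hbij v).image_eq] at h1
      rw [← SimpleGraph.card_neighborSet_eq_degree, ← Nat.card_eq_fintype_card,
        Nat.card_coe_set_eq, h1, ← Finset.coe_Ico, Set.ncard_coe_finset, Nat.card_Ico]
    have hsum := G.sum_degrees_eq_twice_card_edges
    simp only [hdeg] at hsum
    rw [Fin.sum_univ_eq_sum_range (fun v => off (v + 1) - off v)] at hsum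
    have h2 : ∀ m ≤ n, ∑ v ∈ Finset.range m, (off (v + 1) - off v) = off m := by
      intro m
      induction m with
      | zero => simp [h0]
      | succ m ih =>
        intro hm
        rw [Finset.sum_range_succ, ih (by omega)]
        have := hmono m hm
        omega
    rw [h2 n le_rfl] at hsum
    rw [hsum, ← SimpleGraph.coe_edgeFinset, Set.ncard_coe_finset]
  · obtain ⟨v, hv, hs⟩ := hV.exists_isSlot hj
    exact (hsl ⟨v, hv⟩ j hs).1
  · obtain ⟨v, hv, hs⟩ := hV.exists_isSlot hj
    have h1 := (hsl ⟨v, hv⟩ j hs).2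
    rw [← hwj ⟨v, hv⟩ j hs] at h1
    exact h1
  · exact ⟨nbr j, rfl, (hbij v).mapsTo hj, hwj v j hj⟩
  · obtain ⟨j, hj, rfl⟩ := (hbij v).surjOn hvu
    exact ⟨j, hj, rfl, hwj v j hj⟩

/-- Words of `5 (log₂ n + 1)` bits can hold all addresses. -/
theorem fits_of_le {n m b : ℕ} (hn : 0 < n) (hm : 2 * m ≤ n * n)
    (hb : ((5 : ℕ) : ℝ) * (Real.logb 2 n + 1) ≤ b) :
    n + 2 + 2 * (2 * m) + 10 * n < 2 ^ b := by
  have hn' : (0 : ℝ) < n := by exact_mod_cast hn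
  have h1 : ((2 * n : ℝ)) ^ 5 ≤ 2 ^ b := by
    have e : (2 * n : ℝ) = 2 ^ (Real.logb 2 n + 1) := by
      rw [Real.rpow_add (by norm_num), Real.rpow_logb (by norm_num) (by norm_num) hn',
        Real.rpow_one, mul_comm]
    rw [e, ← Real.rpow_natCast, ← Real.rpow_mul (by norm_num), ← Real.rpow_natCast 2 b]
    refine Real.rpow_le_rpow_of_exponent_le (by norm_num) ?_
    rw [mul_comm]
    exact hb
  have h2 : (2 * n) ^ 5 ≤ 2 ^ b := by exact_mod_cast h1
  refine lt_of_lt_of_le ?_ h2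
  have h3 : n * n ≤ n ^ 5 := by
    calc n * n = n ^ 2 := by ring
      _ ≤ n ^ 5 := Nat.pow_le_pow_right hn (by norm_num)
  have h4 : n ≤ n ^ 5 := Nat.le_self_pow (by norm_num) n
  have h5 : (2 * n) ^ 5 = 32 * n ^ 5 := by ring
  have h6 : 1 ≤ n ^ 5 := Nat.one_le_pow _ _ hn
  omega

/-- Because the graph is simple, all addresses are O(n²), so a word length of order `log n` need not
refer to the number of edges. -/
theorem two_mul_ncard_edgeSet_le {n : ℕ} (G : SimpleGraph (Fin n)) :
    2 * G.edgeSet.ncard ≤ n * n := by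
  classical
  rw [← SimpleGraph.coe_edgeFinset, Set.ncard_coe_finset,
    ← SimpleGraph.sum_degrees_eq_twice_card_edges]
  calc ∑ v, G.degree v ≤ ∑ _v : Fin n, n := Finset.sum_le_sum fun v _ => by
        simpa using (G.degree_lt_card_verts v).le
    _ = n * n := by simp

/-- For `n ≥ 2` the logarithm is at least 1 and absorbs the rounding; for smaller `n` both sides
vanish. -/
theorem clog_le_two_mul_logb (n : ℕ) : (Nat.clog 2 n : ℝ) ≤ 2 * Real.logb 2 n := by
  rcases Nat.lt_or_ge n 2 with h | h
  · interval_cases n <;> simp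
  · have h1 : (1 : ℝ) ≤ Real.logb 2 n := by
      rw [Real.le_logb_iff_rpow_le (by norm_num) (by positivity), Real.rpow_one]
      exact_mod_cast h
    have h2 := Nat.ceil_lt_add_one (show (0 : ℝ) ≤ Real.logb 2 n by linarith)
    have h3 := Real.natCeil_logb_natCast 2 n
    rw [Nat.cast_ofNat] at h3
    rw [h3] at h2
    linarith

end Boruvka

theorem mainTheorem7 :
    ∃ M₀ b₀ C : ℕ, ∀ (n : ℕ) (G : SimpleGraph (Fin n)) (w : Sym2 (Fin n) → ℝ), G.Connected →
      ∀ M b : ℕ, M₀ ≤ M → (b₀ : ℝ) * (Real.logb 2 n + 1) ≤ b →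
      ∀ s : ARAM.Mem ℝ, ARAM.HoldsGraph s.slow G w →
      ∃ (c : ARAM.Cost) (s' : ARAM.Mem ℝ), ARAM.Exec M b Boruvka.boruvka s c s' ∧
        (∃ T : SimpleGraph (Fin n), IsMinSpanningTree G w T ∧
          ARAM.HoldsTree s'.slow (n + 2 + 4 * G.edgeSet.ncard) T) ∧
        ∀ ω : ℕ, 1 ≤ ω →
          (c.ioCost ω : ℝ) ≤ C * (G.edgeSet.ncard * Real.logb 2 n + ω * n) ∧
          (c.work ω : ℝ) ≤ C * (G.edgeSet.ncard * Real.logb 2 n + ω * n) := by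
  -- With `L = Nat.clog 2 n`, the operations are at most `460 * L * m + 600 * L * n + 200 * n`, and
  -- `L * n ≤ 2 * L * m`, so `1700 * L * m` suffices apart from the linear term. Passing from `L` to
  -- `Real.logb 2 n` doubles this to 3400, which also exceeds the 224 needed for the terms in `ω *
  -- n`.
  refine ⟨35, 5, 3400, fun n G w hG M b hM hb s hs => ?_⟩
  have hn : 0 < n := by
    obtain ⟨v⟩ := hG.nonempty
    exact v.pos
  obtain ⟨S, off, nb, wj, rfl, hV, hInp, hI⟩ := Boruvka.exists_input hs
  set m := G.edgeSet.ncard with hm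
  have F : (Boruvka.Input.mk n (2 * m) off nb wj).Fits M b :=
    ⟨hM, Boruvka.fits_of_le hn (Boruvka.two_mul_ncard_edgeSet_le G) hb⟩
  obtain ⟨c, s', hexec, ⟨T, hT, hTree⟩, ht, hw⟩ :=
    Boruvka.boruvka_spec F hV hI hG hn hs.1 hInp
  refine ⟨c, s', hexec, ⟨T, hT, ?_⟩, fun ω hω => ?_⟩
  · have e : n + 2 + 4 * m = (Boruvka.Input.mk n (2 * m) off nb wj).P 0 := by
      simp only [Boruvka.Input.P]; omega
    rw [e]
    exact hTree
  have hmn : n ≤ m + 1 := by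
    obtain ⟨T₀, h1, h2⟩ := hG.exists_isTree_le
    have h3 := h2.ncard_edgeSet
    rw [Fintype.card_fin] at h3
    have h4 : T₀.edgeSet.ncard ≤ m :=
      Set.ncard_le_ncard (SimpleGraph.edgeSet_subset_edgeSet.2 h1) (Set.toFinite _)
    omega
  have hwork : (c.work ω : ℝ) ≤ (3400 : ℕ) * (m * Real.logb 2 n + ω * n) := by
    rw [ARAM.Cost.work_eq]
    -- For `n = 1` there may be no edges at all, but then the logarithm is 0; otherwise `n ≤ m + 1 ≤
    -- 2 * m`.
    have hLm : Nat.clog 2 n * n ≤ Nat.clog 2 n * (2 * m) := by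
      rcases Nat.lt_or_ge n 2 with h | h
      · obtain rfl : n = 1 := by omega
        simp
      · exact Nat.mul_le_mul_left _ (by omega)
    have h1 : c.ops + ω * c.slowWrites ≤ 1700 * (m * Nat.clog 2 n) + 3400 * (ω * n) := by
      simp only [Nat.zero_add] at ht hw
      have h2 : ω * c.slowWrites ≤ ω * (24 * n) := Nat.mul_le_mul_left _ hw
      have h3 : n ≤ ω * n := Nat.le_mul_of_pos_left n hω
      nlinarith
    have h2 := Boruvka.clog_le_two_mul_logb n
    have h3 : (m : ℝ) * Nat.clog 2 n ≤ m * (2 * Real.logb 2 n) :=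
      mul_le_mul_of_nonneg_left h2 (Nat.cast_nonneg m)
    have h4 : ((c.ops + ω * c.slowWrites : ℕ) : ℝ) ≤
        1700 * ((m : ℝ) * Nat.clog 2 n) + 3400 * (ω * n) := by exact_mod_cast h1
    refine h4.trans ?_
    push_cast
    linarith
  refine ⟨le_trans ?_ hwork, hwork⟩
  have : c.ioCost ω ≤ c.work ω := by simp only [ARAM.Cost.work]; omega
  exact_mod_cast this
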